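/- Let $\mathcal H=\int^\oplus dE\,\mathcal H_E$ be a separable complex Hilbert space, given as the direct integral over $E\in\mathbb R$ with Lebesgue measure of separable Hilbert spaces $\mathcal H_E$, with Hamiltonian $(H\psi)(E)=E\,\psi(E)$. Let $\widehat\sigma=\int^\oplus dE\,\widehat\sigma(E)$ be a stationary beam: a bounded operator on $\mathcal H$ that is decomposable with fibres $\widehat\sigma(E)\ge 0$ on $\mathcal H_E$ (for almost every $E$), whose rate is finite: $$\gamma=\frac1{2\pi}\int dE\ \operatorname{tr}\widehat\sigma(E)<\infty .$$ Let $X$ be a measurable space and let $F$ be a time-covariant arrival-time observable, i.e. a positive operator valued measure on $\mathbb R\times X$ in $\mathcal H$ with $F(\mathbb R\times X)\le 1$ such that, with $F[f]=\int F(dt\,dx)\,f(t,x)$, $$e^{iHt}F[f]e^{-iHt}=F[\tau_tf],\qquad (\tau_tf)(t',x)=f(t'-t,x),$$ for all $t\in\mathbb R$ and all bounded measurable $f:\mathbb R\times X\to\mathbb C$. Let $t_1,t_2\in\mathbb R$ (if $t_1>t_2$, then $[t_1,t_2]=\emptyset$). (1) For every bounded measurable $f:\mathbb R\times X\to\mathbb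 C$ with $f(t,x)=0$ for $t\notin[t_1,t_2]$, with $\|f\|_\infty=\sup|f|$ and with $\|\cdot\|_1$ the trace norm, $$\bigl\|\sqrt{\widehat\sigma}\,F[f]\,\sqrt{\widehat\sigma}\bigr\|_1\le\|f\|_\infty\,\gamma\,|t_2-t_1| ;$$ in particular the operator on the left is trace class. (2) The local counting statistics are well defined. Let $s=+1$ (Bosons), or let $s=-1$ (Fermions) and suppose $\|\widehat\sigma\|<1$. Then there is exactly one point process in $[t_1,t_2]\times X$ (the law, on the space of measures on $\mathbb R\times X$ with the $\sigma$-algebra generated by the evaluations on measurable sets, of an empirical measure $\xi=\sum_i\delta_{y(i)}$ of a finite random list of points $y(i)\in[t_1,t_2]\times X$) whose characteristic function is $$\bigl\langle e^{i\xi[f]}\bigr\rangle=\det\Bigl(1-s\sqrt{\widehat\sigma}\,F[e^{if}-1]\,\sqrt{\widehat\sigma}\Bigr)^{-s}$$ for all measurable $f:\mathbb R\times X\to\mathbb R$ with $f(t,x)=0$ for $t\notin[t_1,t_2]$. Here $\xi[f]=\int \xi(dy)\,f(y)$ and $\det$ is the Fredholm determinant. -/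

import Mathlib

open MeasureTheory Filter Topology
open scoped ENNReal InnerProductSpace

noncomputable section

namespace Beam

/-! ### Traces, trace norm and Fredholm determinant -/

section Trace

variable {H : Type*} [NormedAddCommGroup H] [InnerProductSpace ℂ H] [CompleteSpace H]

variable (H) in
/-- The index set of a Hilbert basis (complete orthonormal system) of `H`, chosen once and for
all.  The trace and the determinant below do not depend on this choice. -/
def basisIndex : Set H := (exists_hilbertBasis ℂ H).choose

variable (H) in
/-- The chosen Hilbert basis of `H`. -/
def basis : HilbertBasis (basisIndex H) ℂ H := (exists_hilbertBasis ℂ H).choose_spec.choose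

/-- The trace `∑ i, ⟨e i, A e i⟩ ∈ [0, ∞]` of a positive operator. -/
def posTrace (A : H →L[ℂ] H) : ℝ≥0∞ :=
  ∑' i, ENNReal.ofReal (⟪basis H i, A (basis H i)⟫_ℂ).re

/-- The trace norm `‖A‖₁ = tr √(A* A) ∈ [0, ∞]`; `A` is trace class iff this is finite. -/
def traceNorm (A : H →L[ℂ] H) : ℝ≥0∞ := posTrace (CFC.abs A)

open scoped Classical in
/-- The Fredholm determinant `det (1 + A) = ∑ₖ tr (Λᵏ A)` of a trace class operator `A`.  The
vectors `e i₁ ∧ ⋯ ∧ e iₖ` form an orthonormal basis of `Λᵏ H`, and the corresponding diagonal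
matrix elements of `Λᵏ A` are the principal `k × k` minors of the matrix of `A`; so the sum runs
over all finite sets of indices. -/
def detOneAdd (A : H →L[ℂ] H) : ℂ :=
  ∑' S : Finset (basisIndex H),
    (Matrix.of fun i j : S => ⟪basis H i, A (basis H j)⟫_ℂ).det

end Trace

/-! ### Positive operator valued measures -/

/-- A (possibly subnormalized) observable with outcome space `Y`: a positive operator valued
measure `F` with `F(Y) ≤ 1`.  Values on non-measurable sets are irrelevant. -/
structure POVM (Y : Type*) [MeasurableSpace Y] (H : Type*) [NormedAddCommGroup H]
    [InnerProductSpace ℂ H] [CompleteSpace H] where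
  /-- The operator `F(A)`. -/
  op : Set Y → H →L[ℂ] H
  isPositive : ∀ A, MeasurableSet A → (op A).IsPositive
  hasSum : ∀ A : ℕ → Set Y, (∀ n, MeasurableSet (A n)) →
    Pairwise (Function.onFun Disjoint A) → ∀ ψ : H,
      HasSum (fun n => ⟪ψ, op (A n) ψ⟫_ℂ) ⟪ψ, op (⋃ n, A n) ψ⟫_ℂ
  le_one : op Set.univ ≤ 1

namespace POVM

variable {Y : Type*} [MeasurableSpace Y] {H : Type*} [NormedAddCommGroup H]
  [InnerProductSpace ℂ H] [CompleteSpace H] (F : POVM Y H)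

theorem hasSum_re (A : ℕ → Set Y) (hA : ∀ n, MeasurableSet (A n))
    (hd : Pairwise (Function.onFun Disjoint A)) (ψ : H) :
    HasSum (fun n => (⟪ψ, F.op (A n) ψ⟫_ℂ).re) (⟪ψ, F.op (⋃ n, A n) ψ⟫_ℂ).re :=
  Complex.hasSum_re (F.hasSum A hA hd ψ)

theorem re_nonneg {A : Set Y} (hA : MeasurableSet A) (ψ : H) :
    0 ≤ (⟪ψ, F.op A ψ⟫_ℂ).re :=
  (F.isPositive A hA).re_inner_nonneg_right ψ

theorem inner_empty (ψ : H) : ⟪ψ, F.op ∅ ψ⟫_ℂ = 0 := by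
  have h := F.hasSum (fun _ => ∅) (fun _ => MeasurableSet.empty)
    (fun _ _ _ => Set.disjoint_empty _) ψ
  exact tendsto_nhds_unique tendsto_const_nhds h.summable.tendsto_atTop_zero

/-- The finite measure `A ↦ ⟨ψ, F(A) ψ⟩`. -/
def diag (ψ : H) : Measure Y :=
  Measure.ofMeasurable (fun A _ => ENNReal.ofReal (⟪ψ, F.op A ψ⟫_ℂ).re)
    (by simp [F.inner_empty])
    (fun A hA hd => by
      have h := F.hasSum_re A hA hd ψ
      rw [← h.tsum_eq, ENNReal.ofReal_tsum_of_nonneg (fun n => F.re_nonneg (hA n) ψ) h.summable])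

theorem diag_apply (ψ : H) {A : Set Y} (hA : MeasurableSet A) :
    F.diag ψ A = ENNReal.ofReal (⟪ψ, F.op A ψ⟫_ℂ).re :=
  Measure.ofMeasurable_apply A hA

theorem diag_real_apply (ψ : H) {A : Set Y} (hA : MeasurableSet A) :
    (((F.diag ψ).real A : ℝ) : ℂ) = ⟪ψ, F.op A ψ⟫_ℂ := by
  rw [Measure.real, F.diag_apply ψ hA, ENNReal.toReal_ofReal (F.re_nonneg hA ψ)]
  have h := (F.isPositive A hA).inner_nonneg_right ψ
  exact (Complex.eq_re_of_ofReal_le (r := 0) (by simpa using h)).symm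

instance (ψ : H) : IsFiniteMeasure (F.diag ψ) :=
  ⟨by rw [F.diag_apply ψ MeasurableSet.univ]; exact ENNReal.ofReal_lt_top⟩

/-- A sequence of operators whose quadratic forms converge has a weak limit. -/
theorem exists_weak_limit (T : ℕ → H →L[ℂ] H)
    (h : ∀ ψ : H, ∃ l : ℂ, Tendsto (fun n => ⟪ψ, T n ψ⟫_ℂ) atTop (𝓝 l)) :
    ∃ S : H →L[ℂ] H, ∀ ψ : H, Tendsto (fun n => ⟪ψ, T n ψ⟫_ℂ) atTop (𝓝 ⟪ψ, S ψ⟫_ℂ) := by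
  have h2 : ∀ ψ φ : H, ∃ l : ℂ, Tendsto (fun n => ⟪T n ψ, φ⟫_ℂ) atTop (𝓝 l) := by
    intro ψ φ
    have h' : ∀ χ : H, ∃ l : ℂ, Tendsto (fun n => ⟪(T n) χ, χ⟫_ℂ) atTop (𝓝 l) := by
      intro χ
      obtain ⟨l, hl⟩ := h χ
      refine ⟨(starRingEnd ℂ) l, ?_⟩
      have := (Complex.continuous_conj.tendsto l).comp hl
      refine this.congr fun n => ?_
      simp
    obtain ⟨a, ha⟩ := h' (φ + ψ)
    obtain ⟨b, hb⟩ := h' (φ - ψ)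
    obtain ⟨c, hc⟩ := h' (φ + Complex.I • ψ)
    obtain ⟨d, hd⟩ := h' (φ - Complex.I • ψ)
    refine ⟨(a - b + Complex.I * c - Complex.I * d) / 4, ?_⟩
    have := (((ha.sub hb).add (hc.const_mul Complex.I)).sub (hd.const_mul Complex.I)).div_const 4
    refine this.congr fun n => ?_
    exact (inner_map_polarization (T n : H →ₗ[ℂ] H) φ ψ).symm
  have hb1 : ∀ ψ : H, ∃ C, ∀ n, ‖T n ψ‖ ≤ C := by
    intro ψ
    obtain ⟨C, hC⟩ := banach_steinhaus (g := fun n => innerSL ℂ (T n ψ)) (fun φ => by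
      obtain ⟨l, hl⟩ := h2 ψ φ
      obtain ⟨C, hC⟩ := hl.norm.bddAbove_range
      exact ⟨C, fun n => hC ⟨n, rfl⟩⟩)
    exact ⟨C, fun n => by simpa using hC n⟩
  obtain ⟨C, hC⟩ := banach_steinhaus hb1
  choose l hl using h2
  let L : H → (H →L[ℂ] ℂ) := fun ψ =>
    continuousLinearMapOfTendsto (fun n => innerSL ℂ (T n ψ)) (f := l ψ)
      (tendsto_pi_nhds.2 fun φ => hl ψ φ)
  let S : H → H := fun ψ => (InnerProductSpace.toDual ℂ H).symm (L ψ)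
  have hS : ∀ ψ φ, Tendsto (fun n => ⟪T n ψ, φ⟫_ℂ) atTop (𝓝 ⟪S ψ, φ⟫_ℂ) := by
    intro ψ φ
    rw [InnerProductSpace.toDual_symm_apply]
    exact hl ψ φ
  let S' : H →ₗ[ℂ] H :=
    { toFun := S
      map_add' := fun x y => ext_inner_right ℂ fun φ => by
        refine tendsto_nhds_unique (hS _ φ) ?_
        simpa [inner_add_left] using (hS x φ).add (hS y φ)
      map_smul' := fun c x => ext_inner_right ℂ fun φ => by
        refine tendsto_nhds_unique (hS _ φ) ?_
        simpa [inner_smul_left, mul_comm] using (hS x φ).const_mul ((starRingEnd ℂ) c) }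
  have hbd : ∀ ψ, ‖S' ψ‖ ≤ C * ‖ψ‖ := by
    intro ψ
    have h1 : ‖⟪S ψ, S ψ⟫_ℂ‖ ≤ C * ‖ψ‖ * ‖S ψ‖ := by
      refine le_of_tendsto (hS ψ (S ψ)).norm (Eventually.of_forall fun n => ?_)
      refine (norm_inner_le_norm _ _).trans ?_
      gcongr
      exact ((T n).le_opNorm ψ).trans (by gcongr; exact hC n)
    rw [inner_self_eq_norm_sq_to_K] at h1
    have h2 : ‖S ψ‖ ^ 2 ≤ C * ‖ψ‖ * ‖S ψ‖ := by simpa using h1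
    have hC0 : 0 ≤ C := (norm_nonneg _).trans (hC 0)
    change ‖S ψ‖ ≤ _
    rcases (norm_nonneg (S ψ)).eq_or_lt with h0 | h0
    · rw [← h0]; positivity
    · nlinarith
  refine ⟨S'.mkContinuous C hbd, fun ψ => ?_⟩
  have := (Complex.continuous_conj.tendsto _).comp (hS ψ ψ)
  have h3 : Tendsto (fun n => ⟪ψ, T n ψ⟫_ℂ) atTop (𝓝 ⟪ψ, S ψ⟫_ℂ) := by
    simpa [Function.comp_def] using this
  exact h3

theorem exists_integral_simple (g : SimpleFunc Y ℂ) :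
    ∃ T : H →L[ℂ] H, ∀ ψ : H, ⟪ψ, T ψ⟫_ℂ = ∫ y, g y ∂(F.diag ψ) := by
  refine ⟨∑ z ∈ g.range, z • F.op (g ⁻¹' {z}), fun ψ => ?_⟩
  rw [← SimpleFunc.integral_eq_integral g (SimpleFunc.integrable_of_isFiniteMeasure g)]
  simp only [SimpleFunc.integral_eq, sum_apply, inner_sum,
    smul_apply, inner_smul_right]
  refine Finset.sum_congr rfl fun z _ => ?_
  rw [← F.diag_real_apply ψ (g.measurableSet_fiber z), Complex.real_smul, mul_comm]

theorem exists_integral {f : Y → ℂ} (hf : Measurable f) (hb : ∃ C : ℝ, ∀ y, ‖f y‖ ≤ C) :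
    ∃ T : H →L[ℂ] H, ∀ ψ : H, ⟪ψ, T ψ⟫_ℂ = ∫ y, f y ∂(F.diag ψ) := by
  obtain ⟨C, hC⟩ := hb
  let g : ℕ → SimpleFunc Y ℂ := SimpleFunc.approxOn f hf Set.univ 0 (Set.mem_univ 0)
  choose T hT using fun n => F.exists_integral_simple (g n)
  have hlim : ∀ ψ : H, Tendsto (fun n => ⟪ψ, T n ψ⟫_ℂ) atTop (𝓝 (∫ y, f y ∂(F.diag ψ))) := by
    intro ψ
    simp only [hT]
    refine tendsto_integral_of_dominated_convergence (fun _ => C + C)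
      (fun n => (g n).stronglyMeasurable.aestronglyMeasurable) (integrable_const _)
      (fun n => Eventually.of_forall fun y => ?_) (Eventually.of_forall fun y => ?_)
    · exact (SimpleFunc.norm_approxOn_zero_le hf (Set.mem_univ 0) y n).trans
        (add_le_add (hC y) (hC y))
    · exact SimpleFunc.tendsto_approxOn hf (Set.mem_univ 0) (by simp)
  obtain ⟨S, hS⟩ := exists_weak_limit T fun ψ => ⟨_, hlim ψ⟩
  exact ⟨S, fun ψ => tendsto_nhds_unique (hS ψ) (hlim ψ)⟩

open scoped Classical in
/-- The expectation operator `F[f] = ∫ F(dy) f(y)` of a bounded measurable function `f`: the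
bounded operator determined by `⟨ψ, F[f] ψ⟩ = ∫ f(y) ⟨ψ, F(dy) ψ⟩` for all `ψ`.  It exists by
`exists_integral` and is unique since the Hilbert space is complex. -/
def expect (f : Y → ℂ) : H →L[ℂ] H :=
  if h : ∃ T : H →L[ℂ] H, ∀ ψ : H, ⟪ψ, T ψ⟫_ℂ = ∫ y, f y ∂(F.diag ψ) then h.choose else 0

theorem inner_expect {f : Y → ℂ} (hf : Measurable f) (hb : ∃ C : ℝ, ∀ y, ‖f y‖ ≤ C) (ψ : H) :
    ⟪ψ, F.expect f ψ⟫_ℂ = ∫ y, f y ∂(F.diag ψ) := by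
  have h := F.exists_integral hf hb
  rw [expect, dif_pos h]
  exact h.choose_spec ψ

end POVM

/-! ### Direct integrals, time evolution and stationary beams -/

/-- `H` is the direct integral `∫^⊕ dE H_E` of the family of Hilbert spaces `H_E`, `E ∈ ℝ`, with
respect to Lebesgue measure: to each `ψ ∈ H` corresponds a wave function `E ↦ ψ(E) ∈ H_E` such that
`E ↦ ⟨φ(E), ψ(E)⟩` is integrable with integral `⟨φ, ψ⟩`, and every field `u` for which all
`E ↦ ⟨u(E), ψ(E)⟩` are integrable agrees almost everywhere with the wave function of a vector. -/
structure DirectIntegral (H : Type*) [NormedAddCommGroup H] [InnerProductSpace ℂ H]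
    (HE : ℝ → Type*) [∀ E, NormedAddCommGroup (HE E)] [∀ E, InnerProductSpace ℂ (HE E)] where
  /-- The wave function `E ↦ ψ(E)` of the vector `ψ`. -/
  wave : H → ∀ E, HE E
  integrable_inner : ∀ φ ψ : H, Integrable fun E => ⟪wave φ E, wave ψ E⟫_ℂ
  inner_eq : ∀ φ ψ : H, ⟪φ, ψ⟫_ℂ = ∫ E, ⟪wave φ E, wave ψ E⟫_ℂ
  exists_of_integrable : ∀ u : (∀ E, HE E),
    (∀ ψ : H, Integrable fun E => ⟪u E, wave ψ E⟫_ℂ) → ∃ φ : H, ∀ᵐ E, wave φ E = u E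

namespace DirectIntegral

variable {H : Type*} [NormedAddCommGroup H] [InnerProductSpace ℂ H]
  {HE : ℝ → Type*} [∀ E, NormedAddCommGroup (HE E)] [∀ E, InnerProductSpace ℂ (HE E)]
  (D : DirectIntegral H HE)

/-- `A = ∫^⊕ dE A_E`, that is, `(A ψ)(E) = A_E ψ(E)` for almost every `E`. -/
def IsDecomposition (A : H →L[ℂ] H) (AE : ∀ E, HE E →L[ℂ] HE E) : Prop :=
  ∀ ψ : H, ∀ᵐ E, D.wave (A ψ) E = AE E (D.wave ψ E)

theorem norm_phase (t E : ℝ) : ‖Complex.exp (Complex.I * t * E)‖ = 1 := by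
  rw [show Complex.I * t * E = ((t * E : ℝ) : ℂ) * Complex.I by push_cast; ring]
  exact Complex.norm_exp_ofReal_mul_I _

theorem exists_evolution (t : ℝ) (ψ : H) :
    ∃ φ : H, ∀ᵐ E, D.wave φ E = Complex.exp (Complex.I * t * E) • D.wave ψ E := by
  refine D.exists_of_integrable _ fun χ => ?_
  simp only [inner_smul_left]
  refine (D.integrable_inner ψ χ).bdd_mul (c := 1) ?_ (Eventually.of_forall fun E => ?_)
  · exact Continuous.aestronglyMeasurable (by fun_prop)
  · rw [RCLike.norm_conj, norm_phase]

theorem inner_of_ae {φ : H} {u : ∀ E, HE E} (h : ∀ᵐ E, D.wave φ E = u E) (χ : H) :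
    ⟪φ, χ⟫_ℂ = ∫ E, ⟪u E, D.wave χ E⟫_ℂ := by
  rw [D.inner_eq]
  refine integral_congr_ae ?_
  filter_upwards [h] with E hE
  rw [hE]

theorem wave_add (φ ψ : H) : ∀ᵐ E, D.wave (φ + ψ) E = D.wave φ E + D.wave ψ E := by
  obtain ⟨χ, hχ⟩ := D.exists_of_integrable (fun E => D.wave φ E + D.wave ψ E) fun χ => by
    simp only [inner_add_left]
    exact (D.integrable_inner φ χ).add (D.integrable_inner ψ χ)
  have : φ + ψ = χ := ext_inner_right ℂ fun η => by
    rw [D.inner_of_ae hχ, inner_add_left, D.inner_eq φ, D.inner_eq ψ,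
      ← integral_add (D.integrable_inner φ η) (D.integrable_inner ψ η)]
    simp only [inner_add_left]
  rw [this]
  exact hχ

theorem wave_smul (c : ℂ) (ψ : H) : ∀ᵐ E, D.wave (c • ψ) E = c • D.wave ψ E := by
  obtain ⟨χ, hχ⟩ := D.exists_of_integrable (fun E => c • D.wave ψ E) fun χ => by
    simp only [inner_smul_left]
    exact (D.integrable_inner ψ χ).const_mul _
  have : c • ψ = χ := ext_inner_right ℂ fun η => by
    rw [D.inner_of_ae hχ, inner_smul_left, D.inner_eq ψ, ← integral_const_mul]
    simp only [inner_smul_left]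
  rw [this]
  exact hχ

/-- Two vectors with almost everywhere equal wave functions are equal. -/
theorem ext_wave {φ ψ : H} (h : ∀ᵐ E, D.wave φ E = D.wave ψ E) : φ = ψ :=
  ext_inner_right ℂ fun η => by rw [D.inner_of_ae h, D.inner_eq ψ]

/-- The time evolution `exp(i H t)` generated by the Hamiltonian `(H ψ)(E) = E ψ(E)`:
the bounded operator with `(exp(i H t) ψ)(E) = exp(i t E) ψ(E)` for almost every `E`. -/
def evolution (t : ℝ) : H →L[ℂ] H :=
  LinearMap.mkContinuous
    { toFun := fun ψ => (D.exists_evolution t ψ).choose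
      map_add' := fun φ ψ => D.ext_wave <| by
        filter_upwards [(D.exists_evolution t (φ + ψ)).choose_spec,
          (D.exists_evolution t φ).choose_spec, (D.exists_evolution t ψ).choose_spec,
          D.wave_add φ ψ, D.wave_add (D.exists_evolution t φ).choose
            (D.exists_evolution t ψ).choose] with E h1 h2 h3 h4 h5
        rw [h1, h5, h2, h3, h4, smul_add]
      map_smul' := fun c ψ => D.ext_wave <| by
        filter_upwards [(D.exists_evolution t (c • ψ)).choose_spec,
          (D.exists_evolution t ψ).choose_spec, D.wave_smul c ψ,
          D.wave_smul c (D.exists_evolution t ψ).choose] with E h1 h2 h3 h4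
        rw [RingHom.id_apply, h1, h4, h2, h3, smul_comm] }
    1 (fun ψ => by
      have h : ⟪(D.exists_evolution t ψ).choose, (D.exists_evolution t ψ).choose⟫_ℂ =
          ⟪ψ, ψ⟫_ℂ := by
        rw [D.inner_eq, D.inner_eq]
        refine integral_congr_ae ?_
        filter_upwards [(D.exists_evolution t ψ).choose_spec] with E hE
        rw [hE, inner_smul_left, inner_smul_right, ← mul_assoc, RCLike.conj_mul, norm_phase]
        simp
      rw [inner_self_eq_norm_sq_to_K, inner_self_eq_norm_sq_to_K] at h
      have h' : ‖(D.exists_evolution t ψ).choose‖ ^ 2 = ‖ψ‖ ^ 2 := by exact_mod_cast h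
      rw [one_mul]
      exact ((sq_eq_sq₀ (norm_nonneg _) (norm_nonneg _)).1 h').le)

theorem wave_evolution (t : ℝ) (ψ : H) :
    ∀ᵐ E, D.wave (D.evolution t ψ) E = Complex.exp (Complex.I * t * E) • D.wave ψ E :=
  (D.exists_evolution t ψ).choose_spec

/-- An arrival time observable `F` with outcomes `(t, x) ∈ ℝ × X` is covariant for time
translations: `exp(i H t) F[f] exp(-i H t) = F[τ_t f]` with `(τ_t f)(t', x) = f(t' - t, x)`. -/
def IsTimeCovariant [CompleteSpace H] {X : Type*} [MeasurableSpace X] (F : POVM (ℝ × X) H) :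
    Prop :=
  ∀ (t : ℝ) (f : ℝ × X → ℂ), Measurable f → (∃ C : ℝ, ∀ y, ‖f y‖ ≤ C) →
    D.evolution t ∘L F.expect f ∘L D.evolution (-t) = F.expect fun y => f (y.1 - t, y.2)

end DirectIntegral

/-- The one-particle operator `σ̂ = ∫^⊕ dE σ̂(E)` of a stationary beam: a bounded operator with
positive fibres `σ̂(E)`.  (When the rate below is finite, almost all fibres are trace class.) -/
structure StationaryBeam {H : Type*} [NormedAddCommGroup H] [InnerProductSpace ℂ H]
    {HE : ℝ → Type*} [∀ E, NormedAddCommGroup (HE E)] [∀ E, InnerProductSpace ℂ (HE E)]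
    (D : DirectIntegral H HE) where
  /-- The operator `σ̂` on `H`. -/
  op : H →L[ℂ] H
  /-- The fibre `σ̂(E)` on `H_E`. -/
  fiber : ∀ E, HE E →L[ℂ] HE E
  isDecomposition : D.IsDecomposition op fiber
  fiber_isPositive : ∀ᵐ E, (fiber E).IsPositive

namespace StationaryBeam

variable {H : Type*} [NormedAddCommGroup H] [InnerProductSpace ℂ H]
  {HE : ℝ → Type*} [∀ E, NormedAddCommGroup (HE E)] [∀ E, InnerProductSpace ℂ (HE E)]
  {D : DirectIntegral H HE}

/-- The rate `γ = (1 / 2π) ∫ dE tr σ̂(E) ∈ [0, ∞]`. -/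
def rate [∀ E, CompleteSpace (HE E)] (σ : StationaryBeam D) : ℝ≥0∞ :=
  ENNReal.ofReal (1 / (2 * Real.pi)) * ∫⁻ E, posTrace (σ.fiber E)

/-- The operator `√σ̂ F[f] √σ̂`. -/
def sandwich [CompleteSpace H] {Y : Type*} [MeasurableSpace Y] (σ : StationaryBeam D)
    (F : POVM Y H) (f : Y → ℂ) : H →L[ℂ] H :=
  CFC.sqrt σ.op ∘L F.expect f ∘L CFC.sqrt σ.op

/-- The function `C(f) = det (1 - s √σ̂ F[e^{if} - 1] √σ̂)^{-s}`, where `s = 1` for Bosons and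
`s = -1` for Fermions. -/
def countingFunction [CompleteSpace H] {Y : Type*} [MeasurableSpace Y] (σ : StationaryBeam D)
    (F : POVM Y H) (s : ℤ) (f : Y → ℝ) : ℂ :=
  detOneAdd (-(s : ℂ) • σ.sandwich F fun y => Complex.exp (Complex.I * f y) - 1) ^ (-s)

end StationaryBeam

/-! ### Point processes -/

/-- The empirical measure `ξ = ∑ᵢ δ_{y(i)}` of a finite list of points. -/
def empirical {Y : Type*} [MeasurableSpace Y] (ω : Σ n : ℕ, Fin n → Y) : Measure Y :=
  ∑ i, Measure.dirac (ω.2 i)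

theorem measurable_empirical {Y : Type*} [MeasurableSpace Y] :
    Measurable (empirical : (Σ n : ℕ, Fin n → Y) → Measure Y) := by
  refine Measure.measurable_of_measurable_coe _ fun A hA => ?_
  have h : ∀ n : ℕ, Measurable fun y : Fin n → Y => empirical ⟨n, y⟩ A := by
    intro n
    simp only [empirical, Measure.finsetSum_apply]
    have h1 : ∀ i : Fin n, Measurable fun y : Fin n → Y => Measure.dirac (y i) A := fun i =>
      (Measure.measurable_coe hA).comp (Measure.measurable_dirac.comp (measurable_pi_apply i))
    exact Finset.measurable_fun_sum (M := ℝ≥0∞) Finset.univ fun i _ => h1 i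
  exact fun B hB => MeasurableSpace.measurableSet_iInf.2 fun n => h n hB

/-- `P` is a point process in `Y₀` with finitely many points: a probability measure on the space
of measures on `Y` which is the law of the empirical measure `ξ = ∑ᵢ δ_{y(i)}` of a random finite
list of (not necessarily distinct) points `y(i)`, almost surely all lying in `Y₀`. -/
def IsPointProcessIn {Y : Type*} [MeasurableSpace Y] (Y₀ : Set Y) (P : Measure (Measure Y)) :
    Prop :=
  ∃ Q : Measure (Σ n : ℕ, Fin n → Y), IsProbabilityMeasure Q ∧
    (∀ᵐ ω ∂Q, ∀ i, ω.2 i ∈ Y₀) ∧ P = Q.map empirical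

/-- The characteristic function `⟨e^{i ξ[f]}⟩` of a point process, where `ξ[f] = ∫ ξ(dy) f(y)`. -/
def characteristicFunction {Y : Type*} [MeasurableSpace Y] (P : Measure (Measure Y))
    (f : Y → ℝ) : ℂ :=
  ∫ ξ, Complex.exp (Complex.I * ((∫ y, f y ∂ξ : ℝ) : ℂ)) ∂P

end Beam

end

namespace Beam

/-! ### Traces of positive operators -/

section Trace

variable {H : Type*} [NormedAddCommGroup H] [InnerProductSpace ℂ H]

/-! Trace bound. Let `A = [t₁, t₂] × X` and `Q = √F(A)`. By cyclicity the trace of `√σ̂ F(A) √σ̂` is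
`∑ₘ ⟨Q eₘ, σ̂ Q eₘ⟩`. Tested on the vectors `Q eₘ`, the fibre `σ̂(E)` is a sum of rank one operators
`|uⱼ(E)⟩⟨uⱼ(E)|`, where `uⱼ` is the wave function of a vector `φⱼ` and `∑ ‖φⱼ‖² ≤ ∫ tr σ̂(E) dE`
(`exists_rankOne_fields`). Plancherel turns `∫ |⟨φⱼ(E), (Q eₘ)(E)⟩|² dE` into a time integral of
`|⟨exp(-iHt) φⱼ, Q eₘ⟩|² / 2π`. Summed over `m` this is the probability that the evolved `φⱼ`
arrives in the window; by covariance every arrival is in the window for a duration `t₂ - t₁`, so the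
time integral is at most `(t₂ - t₁) ‖φⱼ‖²` (`posTrace_window_le`). For general `f` the sesquilinear
form of `F[f]` is at most `‖f‖∞` times the mean of two values of the quadratic form of `F(A)`, and
an approximate polar decomposition converts this into a trace norm bound
(`traceNorm_le_of_norm_inner_le`).

Existence of the process. In a basis the operator becomes a matrix `K[z] = ∫ z κ dν` with positive
semidefinite densities `κ(y)` and a measure `ν` on the window that is finite by the trace bound
(`exists_isMatrixDensity`). Put `z = e^{if}` and `B = K[1]`. For Fermions `det(1 + K[z - 1]) = det(1
- B + K[z])`, and a congruence removing `1 - B` gives `Z det(1 + K'[z])`, where `K'` again has a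
positive density. Its expansion in principal minors consists of integrals of `∏ z(yₖ)` against mixed
discriminants, which are nonnegative. Hence it is the characteristic function of a random finite
configuration. For Bosons `det(1 + B - K[z])⁻¹` becomes `Z det(1 - K'[z])⁻¹`, which MacMahon's
master theorem expands in permanents, with nonnegative mixed permanents as densities. The value at
`f = 0` fixes the total mass.

The congruence is chosen triangular, so it commutes with truncation to upper left corners. All
identities are then proved for finite matrices and pass to the limit under bounds by the trace of
`B` (`exists_fermi_expansion`, `exists_bose_expansion`). The condition `‖σ̂‖ < 1` bounds `det(1 -
B)` of the corners away from zero.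

Uniqueness. Linear combinations of indicators as test functions give the Fourier transforms of the
joint laws of finitely many counts, and these laws determine the process (`IsPointProcessIn.ext`).
-/

theorem tsum_enorm_inner_sq {ι : Type*} (b : HilbertBasis ι ℂ H) (x : H) :
    ∑' i, ‖⟪b i, x⟫_ℂ‖ₑ ^ 2 = ‖x‖ₑ ^ 2 := by
  have h := (b.hasSum_inner_mul_inner x x)
  have h2 : HasSum (fun i => ‖⟪b i, x⟫_ℂ‖ ^ 2) (‖x‖ ^ 2) := by
    have h3 := Complex.hasSum_re h
    rw [inner_self_eq_norm_sq_to_K] at h3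
    convert h3 using 1
    · ext i
      rw [← inner_conj_symm x (b i), ← Complex.normSq_eq_conj_mul_self, Complex.ofReal_re,
        Complex.normSq_eq_norm_sq]
    · norm_cast
  have h4 : ∀ z : ℂ, ‖z‖ₑ ^ 2 = ENNReal.ofReal (‖z‖ ^ 2) := fun z => by
    rw [← ofReal_norm, ENNReal.ofReal_pow (norm_nonneg _)]
  simp_rw [h4]
  rw [← ENNReal.ofReal_tsum_of_nonneg (fun _ => by positivity) h2.summable, h2.tsum_eq,
    ENNReal.ofReal_pow (norm_nonneg _), ofReal_norm]

theorem ofReal_re_inner_self (x : H) : ENNReal.ofReal (⟪x, x⟫_ℂ).re = ‖x‖ₑ ^ 2 := by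
  have : (⟪x, x⟫_ℂ).re = ‖x‖ ^ 2 := by
    rw [inner_self_eq_norm_sq_to_K]; norm_cast
  rw [this, ENNReal.ofReal_pow (norm_nonneg _), ofReal_norm]

/-- By Parseval both sides are the double sum of `|⟨cⱼ, C bᵢ⟩|²`. This replaces cyclicity of the
trace and its independence of the basis. -/
theorem tsum_enorm_sq_adjoint {K : Type*} [NormedAddCommGroup K] [InnerProductSpace ℂ K]
    [CompleteSpace H] [CompleteSpace K]
    {ι κ : Type*} (b : HilbertBasis ι ℂ H) (c : HilbertBasis κ ℂ K) (C : H →L[ℂ] K) :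
    ∑' i, ‖C (b i)‖ₑ ^ 2 = ∑' j, ‖C.adjoint (c j)‖ₑ ^ 2 := by
  simp_rw [← tsum_enorm_inner_sq c (C _), ← tsum_enorm_inner_sq b (C.adjoint _)]
  rw [ENNReal.tsum_comm]
  simp_rw [ContinuousLinearMap.adjoint_inner_right]
  refine tsum_congr fun j => tsum_congr fun i => ?_
  rw [← inner_conj_symm, ← ofReal_norm, RCLike.norm_conj, ofReal_norm]

variable [CompleteSpace H]

theorem posTrace_adjoint_comp {K : Type*} [NormedAddCommGroup K] [InnerProductSpace ℂ K]
    [CompleteSpace K] (C : H →L[ℂ] K) :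
    posTrace (C.adjoint ∘L C) = ∑' i, ‖C (basis H i)‖ₑ ^ 2 := by
  rw [posTrace]
  refine tsum_congr fun i => ?_
  rw [ContinuousLinearMap.comp_apply, ContinuousLinearMap.adjoint_inner_right,
    ofReal_re_inner_self]

/-- Conjugation of a positive operator by a contraction decreases the trace. -/
theorem tsum_re_inner_contraction_le {B W : H →L[ℂ] H} (hB : B.IsPositive)
    (hW : ‖W‖ ≤ 1) :
    ∑' i, ENNReal.ofReal (⟪W (basis H i), B (W (basis H i))⟫_ℂ).re ≤ posTrace B := by
  have h0 : 0 ≤ B := (ContinuousLinearMap.nonneg_iff_isPositive B).2 hB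
  set R := CFC.sqrt B with hR
  have hRR : R * R = B := CFC.sqrt_mul_sqrt_self B h0
  have hRs : R.adjoint = R := (IsSelfAdjoint.of_nonneg (CFC.sqrt_nonneg B)).adjoint_eq
  have e1 : posTrace B = ∑' i, ‖R (basis H i)‖ₑ ^ 2 := by
    rw [← posTrace_adjoint_comp, hRs]; exact congrArg _ hRR.symm
  have e2 : ∀ x, ENNReal.ofReal (⟪W x, B (W x)⟫_ℂ).re = ‖(R ∘L W) x‖ₑ ^ 2 := by
    intro x
    rw [← ofReal_re_inner_self, ← hRR]
    congr 2
    rw [ContinuousLinearMap.comp_apply, mul_apply_eq_comp,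
      ← ContinuousLinearMap.adjoint_inner_left, hRs]
  simp_rw [e2]
  -- Passing to the adjoint `W* R` puts the contraction outside, where it can be dropped vector by
  -- vector.
  rw [tsum_enorm_sq_adjoint (basis H) (basis H), e1]
  refine ENNReal.tsum_le_tsum fun j => ?_
  rw [ContinuousLinearMap.adjoint_comp, hRs, ContinuousLinearMap.comp_apply]
  gcongr
  rw [enorm_le_iff_norm_le]
  calc _ ≤ ‖W.adjoint‖ * ‖R (basis H j)‖ := W.adjoint.le_opNorm _
    _ ≤ 1 * _ := by
      gcongr
      simpa using hW
    _ = _ := one_mul _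

end Trace

/-! ### Enumeration of the basis -/

section Enumeration

variable (H : Type*) [NormedAddCommGroup H] [InnerProductSpace ℂ H] [CompleteSpace H]
  [TopologicalSpace.SeparableSpace H]

/-- Orthonormal vectors have distance `√2`, so the balls of radius `1/2` around them are disjoint,
and a separable space holds only countably many. -/
theorem countable_basisIndex : Countable (basisIndex H) := by
  have hd : Orthonormal ℂ (basis H) := (basis H).orthonormal
  have hs : Set.univ.PairwiseDisjoint
      (fun i : basisIndex H => Metric.ball (basis H i) (1 / 2)) := by
    intro i _ j _ hij
    refine Metric.ball_disjoint_ball ?_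
    have h2 : ‖basis H i - basis H j‖ ^ 2 = 2 := by
      rw [@norm_sub_sq ℂ, hd.1, hd.1, hd.2 hij]; norm_num
    rw [dist_eq_norm]
    nlinarith [norm_nonneg (basis H i - basis H j)]
  exact Set.countable_univ_iff.1 (hs.countable_of_isOpen (fun _ _ => Metric.isOpen_ball)
    (fun i _ => Metric.nonempty_ball.2 (by norm_num)))

theorem exists_enum_basisIndex : ∃ f : basisIndex H → ℕ, Function.Injective f :=
  haveI := countable_basisIndex H
  exists_injective_nat _

/-- An injective enumeration of the basis index set. -/
noncomputable def enum : basisIndex H → ℕ := (exists_enum_basisIndex H).choose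

theorem enum_injective : Function.Injective (enum H) := (exists_enum_basisIndex H).choose_spec

/-- The chosen basis as a sequence, padded with zeros. -/
noncomputable def basisSeq : ℕ → H := Function.extend (enum H) (basis H) 0

theorem basisSeq_enum (i : basisIndex H) : basisSeq H (enum H i) = basis H i :=
  (enum_injective H).extend_apply _ _ _

variable {H}

theorem basisSeq_of_notMem {n : ℕ} (h : n ∉ Set.range (enum H)) : basisSeq H n = 0 :=
  Function.extend_apply' _ _ _ h

theorem inner_basisSeq_of_ne {m n : ℕ} (h : m ≠ n) : ⟪basisSeq H m, basisSeq H n⟫_ℂ = 0 := by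
  by_cases hm : m ∈ Set.range (enum H)
  · by_cases hn : n ∈ Set.range (enum H)
    · obtain ⟨i, rfl⟩ := hm
      obtain ⟨j, rfl⟩ := hn
      rw [basisSeq_enum, basisSeq_enum]
      exact (basis H).orthonormal.2 fun hij => h (by rw [hij])
    · rw [basisSeq_of_notMem hn, inner_zero_right]
  · rw [basisSeq_of_notMem hm, inner_zero_left]

theorem inner_basisSeq_self (n : ℕ) :
    ⟪basisSeq H n, basisSeq H n⟫_ℂ = 0 ∧ basisSeq H n = 0 ∨
      ⟪basisSeq H n, basisSeq H n⟫_ℂ = 1 := by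
  by_cases hn : n ∈ Set.range (enum H)
  · obtain ⟨i, rfl⟩ := hn
    right
    rw [basisSeq_enum, inner_self_eq_norm_sq_to_K, (basis H).orthonormal.1]
    norm_num
  · left
    simp [basisSeq_of_notMem hn]

theorem tsum_basisSeq (φ : H → ℝ≥0∞) (h0 : φ 0 = 0) :
    ∑' n, φ (basisSeq H n) = ∑' i, φ (basis H i) := by
  rw [← (enum_injective H).tsum_eq]
  · simp_rw [basisSeq_enum]
  · intro n hn
    by_contra h
    exact hn (by simp [basisSeq_of_notMem h, h0])

theorem tsum_enorm_inner_basisSeq_sq (x : H) :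
    ∑' n, ‖⟪basisSeq H n, x⟫_ℂ‖ₑ ^ 2 = ‖x‖ₑ ^ 2 := by
  rw [tsum_basisSeq (fun y => ‖⟪y, x⟫_ℂ‖ₑ ^ 2) (by simp), tsum_enorm_inner_sq]

/-- The principal minor of an infinite matrix belonging to a finite index set. -/
noncomputable def minor (A : Matrix ℕ ℕ ℂ) (S : Finset ℕ) : ℂ :=
  (A.submatrix (Subtype.val : S → ℕ) (Subtype.val : S → ℕ)).det

/-- A set containing an index outside the enumeration gives a minor with a zero row, so padding by
zeros is harmless. Indexing by `ℕ` makes corners available. -/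
theorem detOneAdd_eq_tsum_minor (A : H →L[ℂ] H) :
    detOneAdd A = ∑' S : Finset ℕ,
      minor (Matrix.of fun i j => ⟪basisSeq H i, A (basisSeq H j)⟫_ℂ) S := by
  classical
  have hinj : Function.Injective
      (fun S : Finset (basisIndex H) => S.map ⟨enum H, enum_injective H⟩) :=
    Finset.map_injective _
  rw [← hinj.tsum_eq]
  · refine tsum_congr fun S => ?_
    let e : S ≃ (S.map ⟨enum H, enum_injective H⟩ : Finset ℕ) :=
      Equiv.ofBijective (fun i => ⟨enum H i, Finset.mem_map.2 ⟨i, i.2, rfl⟩⟩)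
        ⟨fun i j hij => Subtype.ext (enum_injective H (congrArg Subtype.val hij)), by
          rintro ⟨n, hn⟩
          obtain ⟨i, hi, rfl⟩ := Finset.mem_map.1 hn
          exact ⟨⟨i, hi⟩, rfl⟩⟩
    rw [minor, ← Matrix.det_submatrix_equiv_self e]
    convert rfl using 2
    ext i j
    change ⟪basisSeq H (enum H i), A (basisSeq H (enum H j))⟫_ℂ = _
    rw [basisSeq_enum, basisSeq_enum]
    rfl
  · intro S hS
    by_contra h
    apply hS
    have : ∃ n ∈ S, n ∉ Set.range (enum H) := by
      by_contra! h2
      apply h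
      refine ⟨S.preimage (enum H) (enum_injective H).injOn, ?_⟩
      ext n
      simp only [Finset.mem_map, Finset.mem_preimage, Function.Embedding.coeFn_mk]
      constructor
      · rintro ⟨i, hi, rfl⟩; exact hi
      · intro hn
        obtain ⟨i, rfl⟩ := h2 n hn
        exact ⟨i, hn, rfl⟩
    obtain ⟨n, hn, hn2⟩ := this
    refine Matrix.det_eq_zero_of_row_eq_zero ⟨n, hn⟩ fun j => ?_
    simp [basisSeq_of_notMem hn2]

end Enumeration

end Beam

namespace Beam

/-! ### Plancherel's theorem for integrable functions -/

section Plancherel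

open FourierTransform SchwartzMap

/-- Both sides are locally integrable, so it suffices to test against smooth compactly supported
functions. There the transform moves onto the test function: on the left by its definition for
tempered distributions, on the right by Fubini. -/
theorem fourier_toLp_ae_eq {g : ℝ → ℂ} (h1 : Integrable g) (h2 : MemLp g 2) :
    (𝓕 (h2.toLp g) : Lp (α := ℝ) ℂ 2 volume) =ᵐ[volume] (𝓕 g : ℝ → ℂ) := by
  have hcont : Continuous (𝓕 g) :=
    VectorFourier.fourierIntegral_continuous Real.continuous_fourierChar continuous_inner h1
  refine ae_eq_of_integral_contDiff_smul_eq
    ((Lp.memLp (𝓕 (h2.toLp g) : Lp (α := ℝ) ℂ 2 volume)).locallyIntegrable (by norm_num))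
    hcont.locallyIntegrable fun φ hφ hφc => ?_
  have hφ' : ContDiff ℝ ((⊤ : ℕ∞) : WithTop ℕ∞) (fun x => (φ x : ℂ)) := Complex.ofRealCLM.contDiff.comp hφ
  have hφc' : HasCompactSupport (fun x => (φ x : ℂ)) :=
    hφc.comp_left (g := fun x : ℝ => (x : ℂ)) (by simp)
  let ψ : 𝓢(ℝ, ℂ) := hφc'.toSchwartzMap hφ'
  have hψ : ∀ x, ψ x = (φ x : ℂ) := fun x => rfl
  have e1 : ∫ x, φ x • (𝓕 (h2.toLp g) : Lp (α := ℝ) ℂ 2 volume) x =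
      Lp.toTemperedDistribution (𝓕 (h2.toLp g) : Lp (α := ℝ) ℂ 2 volume) ψ := by
    rw [Lp.toTemperedDistribution_apply]
    simp [hψ]
  rw [e1]
  have e2 := congrArg (fun T : 𝓢'(ℝ, ℂ) => T ψ) (Lp.fourier_toTemperedDistribution_eq (h2.toLp g))
  beta_reduce at e2
  rw [← e2, TemperedDistribution.fourier_apply, Lp.toTemperedDistribution_apply]
  have e3 : ∫ x, (𝓕 ψ) x • (h2.toLp g : ℝ → ℂ) x = ∫ x, (𝓕 ψ) x • g x := by
    refine integral_congr_ae ?_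
    filter_upwards [h2.coeFn_toLp] with x hx
    rw [hx]
  rw [e3]
  have e4 := VectorFourier.integral_fourierIntegral_smul_eq_flip (μ := volume) (ν := volume)
    (L := innerₗ ℝ) Real.continuous_fourierChar (by exact continuous_inner) ψ.integrable h1
  rw [flip_innerₗ] at e4
  refine Eq.trans ?_ (e4.trans ?_)
  · refine integral_congr_ae (Eventually.of_forall fun x => ?_)
    rfl
  · refine integral_congr_ae (Eventually.of_forall fun x => ?_)
    simp only [hψ, Complex.real_smul, smul_eq_mul]
    rfl

theorem lintegral_enorm_fourier_sq {g : ℝ → ℂ} (h1 : Integrable g) (h2 : MemLp g 2) :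
    ∫⁻ w, ‖𝓕 g w‖ₑ ^ 2 = ∫⁻ x, ‖g x‖ₑ ^ 2 := by
  have key : ∀ (f : ℝ → ℂ), eLpNorm f 2 volume ^ 2 = ∫⁻ x, ‖f x‖ₑ ^ 2 := by
    intro f
    rw [eLpNorm_eq_lintegral_rpow_enorm_toReal (by norm_num) (by norm_num)]
    rw [← ENNReal.rpow_natCast, ← ENNReal.rpow_mul]
    norm_num
  rw [← key, ← key, ← eLpNorm_congr_ae (fourier_toLp_ae_eq h1 h2),
    ← eLpNorm_congr_ae h2.coeFn_toLp, ← Lp.enorm_def, ← Lp.enorm_def, ← ofReal_norm, ← ofReal_norm,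
    Lp.norm_fourier_eq]

/-- Plancherel after the substitution `t = -2πw`, whose Jacobian is the factor `2π`. -/
theorem lintegral_enorm_integral_exp_sq {g : ℝ → ℂ} (h1 : Integrable g) (h2 : MemLp g 2) :
    ∫⁻ t : ℝ, ‖∫ x : ℝ, Complex.exp (Complex.I * t * x) * g x‖ₑ ^ 2 =
      ENNReal.ofReal (2 * Real.pi) * ∫⁻ x, ‖g x‖ₑ ^ 2 := by
  have hpi := Real.pi_pos
  have e : ∀ w : ℝ, 𝓕 g w = ∫ x : ℝ, Complex.exp (Complex.I * ((-(2 * Real.pi) * w : ℝ)) * x) * g x := by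
    intro w
    rw [Real.fourier_real_eq_integral_exp_smul]
    refine integral_congr_ae (Eventually.of_forall fun x => ?_)
    simp only [smul_eq_mul]
    congr 2
    push_cast
    ring
  rw [← lintegral_enorm_fourier_sq h1 h2]
  simp_rw [e]
  have hm := Real.map_volume_mul_left (a := -(2 * Real.pi)) (by nlinarith)
  have hemb : MeasurableEmbedding (fun w : ℝ => -(2 * Real.pi) * w) :=
    (Homeomorph.mulLeft₀ (-(2 * Real.pi)) (by nlinarith)).measurableEmbedding
  have := hemb.lintegral_map (μ := volume)
    (fun t : ℝ => ‖∫ x : ℝ, Complex.exp (Complex.I * t * x) * g x‖ₑ ^ 2)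
  rw [← this]
  rw [hm, lintegral_smul_measure, smul_eq_mul, ← mul_assoc, abs_inv, abs_neg, abs_of_pos (by positivity), 
    ← ENNReal.ofReal_mul (by positivity), mul_inv_cancel₀ (by positivity), ENNReal.ofReal_one, one_mul]

end Plancherel
end Beam

namespace Beam

/-! ### Quadratic forms of expectation operators -/

section Operators

variable {H : Type*} [NormedAddCommGroup H] [InnerProductSpace ℂ H] [CompleteSpace H]

theorem ext_of_inner_self {H : Type*} [NormedAddCommGroup H] [InnerProductSpace ℂ H]
    {S T : H →L[ℂ] H} (h : ∀ ψ : H, ⟪ψ, S ψ⟫_ℂ = ⟪ψ, T ψ⟫_ℂ) : S = T := by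
  have := (ext_inner_map (S : H →ₗ[ℂ] H) (T : H →ₗ[ℂ] H)).1 fun ψ => by
    have := congrArg (starRingEnd ℂ) (h ψ)
    simpa using this
  exact ContinuousLinearMap.coe_injective this

theorem sqrt_adjoint (B : H →L[ℂ] H) : (CFC.sqrt B).adjoint = CFC.sqrt B :=
  (IsSelfAdjoint.of_nonneg (CFC.sqrt_nonneg B)).adjoint_eq

theorem sqrt_comp_sqrt {B : H →L[ℂ] H} (hB : B.IsPositive) : CFC.sqrt B ∘L CFC.sqrt B = B :=
  CFC.sqrt_mul_sqrt_self B ((ContinuousLinearMap.nonneg_iff_isPositive B).2 hB)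

theorem inner_sqrt_sqrt {B : H →L[ℂ] H} (hB : B.IsPositive) (φ ψ : H) :
    ⟪CFC.sqrt B φ, CFC.sqrt B ψ⟫_ℂ = ⟪φ, B ψ⟫_ℂ := by
  rw [← ContinuousLinearMap.adjoint_inner_right, sqrt_adjoint, ← ContinuousLinearMap.comp_apply,
    sqrt_comp_sqrt hB]

/-- Cauchy–Schwarz followed by the inequality of means; the arithmetic mean is linear in `B`, so
such bounds can be summed over the values of a simple function. -/
theorem norm_inner_le_half_add {B : H →L[ℂ] H} (hB : B.IsPositive) (φ ψ : H) :
    ‖⟪φ, B ψ⟫_ℂ‖ ≤ ((⟪φ, B φ⟫_ℂ).re + (⟪ψ, B ψ⟫_ℂ).re) / 2 := by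
  have e : ∀ χ : H, (⟪χ, B χ⟫_ℂ).re = ‖CFC.sqrt B χ‖ ^ 2 := fun χ => by
    rw [← inner_sqrt_sqrt hB, inner_self_eq_norm_sq_to_K]; norm_cast
  rw [e, e, ← inner_sqrt_sqrt hB]
  have := norm_inner_le_norm (𝕜 := ℂ) (CFC.sqrt B φ) (CFC.sqrt B ψ)
  nlinarith [sq_nonneg (‖CFC.sqrt B φ‖ - ‖CFC.sqrt B ψ‖)]

end Operators

namespace POVM

variable {Y : Type*} [MeasurableSpace Y] {H : Type*} [NormedAddCommGroup H]
  [InnerProductSpace ℂ H] [CompleteSpace H] (F : POVM Y H)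

theorem expect_eq {f : Y → ℂ} (hf : Measurable f) (hb : ∃ C : ℝ, ∀ y, ‖f y‖ ≤ C)
    {T : H →L[ℂ] H} (hT : ∀ ψ : H, ⟪ψ, T ψ⟫_ℂ = ∫ y, f y ∂(F.diag ψ)) : F.expect f = T :=
  ext_of_inner_self fun ψ => by rw [F.inner_expect hf hb, hT]

theorem expect_indicator {A : Set Y} (hA : MeasurableSet A) :
    F.expect (A.indicator fun _ => 1) = F.op A := by
  refine F.expect_eq (measurable_const.indicator hA) ⟨1, fun y => ?_⟩ fun ψ => ?_
  · by_cases h : y ∈ A <;> simp [h]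
  · rw [integral_indicator_const _ hA, ← F.diag_real_apply ψ hA]
    simp

theorem exists_bound_simple (g : SimpleFunc Y ℂ) : ∃ C : ℝ, ∀ y, ‖g y‖ ≤ C := by
  obtain ⟨C, hC⟩ := (g.map fun z => ‖z‖).finite_range.bddAbove
  exact ⟨C, fun y => hC ⟨y, rfl⟩⟩

theorem expect_simple (g : SimpleFunc Y ℂ) :
    F.expect g = ∑ z ∈ g.range, z • F.op (g ⁻¹' {z}) := by
  refine F.expect_eq g.measurable (exists_bound_simple g) fun ψ => ?_
  rw [← SimpleFunc.integral_eq_integral g (SimpleFunc.integrable_of_isFiniteMeasure g)]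
  simp only [SimpleFunc.integral_eq, sum_apply, inner_sum, smul_apply, inner_smul_right]
  refine Finset.sum_congr rfl fun z _ => ?_
  rw [← F.diag_real_apply ψ (g.measurableSet_fiber z), Complex.real_smul, mul_comm]

/-- Off-diagonal matrix elements become combinations of integrals against the finite positive
measures `F.diag`, to which dominated convergence applies. -/
theorem inner_expect_polarization {f : Y → ℂ} (hf : Measurable f)
    (hb : ∃ C : ℝ, ∀ y, ‖f y‖ ≤ C) (φ ψ : H) :
    ⟪φ, F.expect f ψ⟫_ℂ = ((∫ y, f y ∂(F.diag (ψ + φ))) - (∫ y, f y ∂(F.diag (ψ - φ))) +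
      Complex.I * (∫ y, f y ∂(F.diag (ψ + Complex.I • φ))) -
      Complex.I * (∫ y, f y ∂(F.diag (ψ - Complex.I • φ)))) / 4 := by
  simp only [← F.inner_expect hf hb]
  simp only [inner_add_left, inner_sub_left, inner_smul_left, inner_add_right, inner_sub_right,
    inner_smul_right, map_add, map_sub, map_smul, Complex.conj_I]
  linear_combination ((1:ℂ) / 2 * ⟪φ, F.expect f ψ⟫_ℂ - 1 / 2 * ⟪ψ, F.expect f φ⟫_ℂ) * Complex.I_sq

/-- For simple functions this is `norm_inner_le_half_add` applied to each level set; both sides are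
continuous along bounded pointwise approximation. -/
theorem norm_inner_expect_le {f : Y → ℂ} (hf : Measurable f) (hb : ∃ C : ℝ, ∀ y, ‖f y‖ ≤ C)
    (φ ψ : H) : ‖⟪φ, F.expect f ψ⟫_ℂ‖ ≤
      ((∫ y, ‖f y‖ ∂(F.diag φ)) + ∫ y, ‖f y‖ ∂(F.diag ψ)) / 2 := by
  have simple : ∀ g : SimpleFunc Y ℂ, ‖⟪φ, F.expect g ψ⟫_ℂ‖ ≤
      ((∫ y, ‖g y‖ ∂(F.diag φ)) + ∫ y, ‖g y‖ ∂(F.diag ψ)) / 2 := by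
    intro g
    have hn : ∀ χ : H, ∫ y, ‖g y‖ ∂(F.diag χ) =
        ∑ z ∈ g.range, ‖z‖ * (⟪χ, F.op (g ⁻¹' {z}) χ⟫_ℂ).re := by
      intro χ
      have h1 : ∫ y, ‖g y‖ ∂(F.diag χ) = (g.map norm).integral (F.diag χ) := by
        rw [SimpleFunc.integral_eq_integral _ (SimpleFunc.integrable_of_isFiniteMeasure _)]
        rfl
      rw [h1, SimpleFunc.map_integral _ _ (SimpleFunc.integrable_of_isFiniteMeasure _) norm_zero]
      refine Finset.sum_congr rfl fun z _ => ?_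
      rw [← F.diag_real_apply χ (g.measurableSet_fiber z), Complex.ofReal_re, smul_eq_mul, mul_comm]
    rw [hn, hn, F.expect_simple, sum_apply, inner_sum, ← Finset.sum_add_distrib,
      Finset.sum_div]
    refine (norm_sum_le _ _).trans (Finset.sum_le_sum fun z _ => ?_)
    rw [smul_apply, inner_smul_right, norm_mul, ← mul_add, mul_div_assoc]
    gcongr
    exact norm_inner_le_half_add (F.isPositive _ (g.measurableSet_fiber z)) φ ψ
  obtain ⟨C, hC⟩ := hb
  let g : ℕ → SimpleFunc Y ℂ := SimpleFunc.approxOn f hf Set.univ 0 (Set.mem_univ 0)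
  have hg : ∀ n y, ‖g n y‖ ≤ C + C := fun n y =>
    (SimpleFunc.norm_approxOn_zero_le hf (Set.mem_univ 0) y n).trans (add_le_add (hC y) (hC y))
  have hgt : ∀ y, Tendsto (fun n => g n y) atTop (𝓝 (f y)) := fun y =>
    SimpleFunc.tendsto_approxOn hf (Set.mem_univ 0) (by simp)
  have hlim : ∀ ψ : H, Tendsto (fun n => ∫ y, g n y ∂(F.diag ψ)) atTop
      (𝓝 (∫ y, f y ∂(F.diag ψ))) := fun ψ =>
    tendsto_integral_of_dominated_convergence (fun _ => C + C)
      (fun n => (g n).stronglyMeasurable.aestronglyMeasurable) (integrable_const _)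
      (fun n => Eventually.of_forall (hg n)) (Eventually.of_forall hgt)
  have hlim2 : ∀ ψ : H, Tendsto (fun n => ∫ y, ‖g n y‖ ∂(F.diag ψ)) atTop
      (𝓝 (∫ y, ‖f y‖ ∂(F.diag ψ))) := fun ψ =>
    tendsto_integral_of_dominated_convergence (fun _ => C + C)
      (fun n => (g n).stronglyMeasurable.norm.aestronglyMeasurable) (integrable_const _)
      (fun n => Eventually.of_forall fun y => by simpa using hg n y)
      (Eventually.of_forall fun y => (hgt y).norm)
  refine le_of_tendsto_of_tendsto (f := fun n => ‖⟪φ, F.expect (g n) ψ⟫_ℂ‖) (b := atTop)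
    ?_ (((hlim2 φ).add (hlim2 ψ)).div_const 2) (Eventually.of_forall fun n => simple (g n))
  refine Tendsto.norm ?_
  rw [F.inner_expect_polarization hf ⟨C, hC⟩]
  simp_rw [F.inner_expect_polarization (g _).measurable ⟨C + C, hg _⟩]
  exact ((((hlim _).sub (hlim _)).add ((hlim _).const_mul _)).sub ((hlim _).const_mul _)).div_const 4

theorem norm_inner_expect_le_of_support {f : Y → ℂ} (hf : Measurable f) {C : ℝ}
    (hC : ∀ y, ‖f y‖ ≤ C) {A : Set Y} (hA : MeasurableSet A) (h0 : ∀ y, y ∉ A → f y = 0)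
    (φ ψ : H) : ‖⟪φ, F.expect f ψ⟫_ℂ‖ ≤
      C * (((⟪φ, F.op A φ⟫_ℂ).re + (⟪ψ, F.op A ψ⟫_ℂ).re) / 2) := by
  refine (F.norm_inner_expect_le hf ⟨C, hC⟩ φ ψ).trans ?_
  have h : ∀ χ : H, ∫ y, ‖f y‖ ∂(F.diag χ) ≤ C * (⟪χ, F.op A χ⟫_ℂ).re := by
    intro χ
    calc ∫ y, ‖f y‖ ∂(F.diag χ) ≤ ∫ y, A.indicator (fun _ => C) y ∂(F.diag χ) := by
          refine integral_mono_of_nonneg (Eventually.of_forall fun y => norm_nonneg _)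
            ((integrable_const C).indicator hA) (Eventually.of_forall fun y => ?_)
          by_cases hy : y ∈ A
          · simpa [hy] using hC y
          · simp [hy, h0 y hy]
      _ = C * (⟪χ, F.op A χ⟫_ℂ).re := by
          rw [integral_indicator_const _ hA, ← F.diag_real_apply χ hA]
          simp [mul_comm]
  linarith [h φ, h ψ]

end POVM
end Beam

namespace Beam

theorem enorm_sq_eq_ofReal {V : Type*} [NormedAddCommGroup V] (z : V) :
    ‖z‖ₑ ^ 2 = ENNReal.ofReal (‖z‖ ^ 2) := by
  rw [← ofReal_norm, ENNReal.ofReal_pow (norm_nonneg _)]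

/-! ### Gram-Schmidt expansions -/

section GramSchmidt

open InnerProductSpace

variable {K : Type*} [NormedAddCommGroup K] [InnerProductSpace ℂ K]

theorem inner_gramSchmidt_self (h : ℕ → K) (n : ℕ) :
    ⟪gramSchmidt ℂ h n, h n⟫_ℂ = ((‖gramSchmidt ℂ h n‖ ^ 2 : ℝ) : ℂ) := by
  conv_lhs => rw [gramSchmidt_def'' ℂ h n, inner_add_right, inner_sum]
  rw [Finset.sum_eq_zero, add_zero, inner_self_eq_norm_sq_to_K]
  · norm_cast
  · intro i hi
    rw [inner_smul_right, gramSchmidt_orthogonal ℂ h (Finset.mem_Iio.1 hi).ne', mul_zero]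

theorem norm_sq_eq_sum_gramSchmidtNormed (h : ℕ → K) (n : ℕ) :
    ‖h n‖ ^ 2 = ∑ i ∈ Finset.range (n + 1), ‖⟪gramSchmidtNormed ℂ h i, h n⟫_ℂ‖ ^ 2 := by
  have e : ∀ i, ‖⟪gramSchmidtNormed ℂ h i, h n⟫_ℂ‖ ^ 2 =
      ‖⟪gramSchmidt ℂ h i, h n⟫_ℂ‖ ^ 2 / ‖gramSchmidt ℂ h i‖ ^ 2 := by
    intro i
    rw [gramSchmidtNormed, inner_smul_left, norm_mul, mul_pow]
    simp
    ring
  simp_rw [e]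
  rw [Finset.sum_range_succ]
  have h1 : ‖⟪gramSchmidt ℂ h n, h n⟫_ℂ‖ ^ 2 / ‖gramSchmidt ℂ h n‖ ^ 2 =
      ‖gramSchmidt ℂ h n‖ ^ 2 := by
    rw [inner_gramSchmidt_self, Complex.norm_real, Real.norm_eq_abs, abs_of_nonneg (by positivity)]
    by_cases h0 : ‖gramSchmidt ℂ h n‖ = 0
    · simp [h0]
    · field_simp
  rw [h1]
  have h2 : (⟪h n, h n⟫_ℂ) = ((‖gramSchmidt ℂ h n‖ ^ 2 : ℝ) : ℂ) +
      ∑ i ∈ Finset.Iio n, ((‖⟪gramSchmidt ℂ h i, h n⟫_ℂ‖ ^ 2 / ‖gramSchmidt ℂ h i‖ ^ 2 : ℝ) : ℂ) := by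
    conv_lhs => 
      enter [3]
      rw [gramSchmidt_def'' ℂ h n]
    rw [inner_add_right, inner_sum]
    congr 1
    · rw [← inner_conj_symm, inner_gramSchmidt_self, Complex.conj_ofReal]
    · refine Finset.sum_congr rfl fun i _ => ?_
      rw [inner_smul_right, ← inner_conj_symm (h n), div_mul_eq_mul_div, Complex.mul_conj,
        Complex.normSq_eq_norm_sq, Complex.ofReal_div]
      simp
  rw [inner_self_eq_norm_sq_to_K, ← Complex.ofReal_sum, ← Complex.ofReal_add] at h2
  have h3 : ‖h n‖ ^ 2 = ‖gramSchmidt ℂ h n‖ ^ 2 +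
      ∑ i ∈ Finset.Iio n, ‖⟪gramSchmidt ℂ h i, h n⟫_ℂ‖ ^ 2 / ‖gramSchmidt ℂ h i‖ ^ 2 := by
    apply Complex.ofReal_injective
    rw [← h2]
    simp
  rw [h3, Nat.Iio_eq_range, add_comm]

/-- Equality, not just Bessel's inequality: `h n` lies in the span of the first `n + 1` Gram–Schmidt
vectors and is orthogonal to the later ones. -/
theorem tsum_enorm_inner_gramSchmidtNormed (h : ℕ → K) (n : ℕ) :
    ∑' i, ‖⟪gramSchmidtNormed ℂ h i, h n⟫_ℂ‖ₑ ^ 2 = ‖h n‖ₑ ^ 2 := by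
  rw [tsum_eq_sum (s := Finset.range (n + 1)), enorm_sq_eq_ofReal (h n), norm_sq_eq_sum_gramSchmidtNormed,
    ENNReal.ofReal_sum_of_nonneg (fun _ _ => by positivity)]
  · simp_rw [enorm_sq_eq_ofReal]
  · intro i hi
    rw [gramSchmidtNormed, inner_smul_left, gramSchmidt_inv_triangular ℂ h (by simpa using hi)]
    simp

/-- Bessel's inequality. A linearly dependent `h` produces zero vectors, so orthonormality holds
only on the nonzero ones; the others contribute nothing. -/
theorem tsum_enorm_inner_gramSchmidtNormed_le (h : ℕ → K) (x : K) :
    ∑' i, ‖⟪gramSchmidtNormed ℂ h i, x⟫_ℂ‖ₑ ^ 2 ≤ ‖x‖ₑ ^ 2 := by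
  have ho := gramSchmidtNormed_orthonormal' (𝕜 := ℂ) h
  have := ho.tsum_inner_products_le x
  have hs := ho.inner_products_summable x
  rw [← tsum_subtype_eq_of_support_subset (s := {i | gramSchmidtNormed ℂ h i ≠ 0}), enorm_sq_eq_ofReal x]
  · simp_rw [enorm_sq_eq_ofReal]
    rw [← ENNReal.ofReal_tsum_of_nonneg (fun _ => by positivity) hs]
    exact ENNReal.ofReal_le_ofReal this
  · intro i hi h0
    exact hi (by simp [h0])

/-- The Hilbert–Schmidt sum over a possibly incomplete system: expand in the basis, exchange the
sums and apply Bessel to each `R eᵢ`. -/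
theorem tsum_enorm_map_gramSchmidtNormed_le [CompleteSpace K] {R : K →L[ℂ] K}
    (hR : R.adjoint = R) (h : ℕ → K) :
    ∑' j, ‖R (gramSchmidtNormed ℂ h j)‖ₑ ^ 2 ≤ posTrace (R ∘L R) := by
  have e : posTrace (R ∘L R) = ∑' i, ‖R (basis K i)‖ₑ ^ 2 := by
    rw [← posTrace_adjoint_comp, hR]
  simp_rw [e, ← tsum_enorm_inner_sq (basis K) (R (gramSchmidtNormed ℂ h _))]
  rw [ENNReal.tsum_comm]
  refine ENNReal.tsum_le_tsum fun i => ?_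
  refine le_trans (le_of_eq ?_) (tsum_enorm_inner_gramSchmidtNormed_le h (R (basis K i)))
  refine tsum_congr fun j => ?_
  rw [← ContinuousLinearMap.adjoint_inner_left, hR, ← inner_conj_symm, ← ofReal_norm,
    RCLike.norm_conj, ofReal_norm]

end GramSchmidt

/-! ### Norms of wave functions and matrix elements of the time evolution -/

namespace DirectIntegral

variable {H : Type*} [NormedAddCommGroup H] [InnerProductSpace ℂ H]
  {HE : ℝ → Type*} [∀ E, NormedAddCommGroup (HE E)] [∀ E, InnerProductSpace ℂ (HE E)]
  (D : DirectIntegral H HE)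

theorem aemeasurable_enorm_wave_sq (φ : H) : AEMeasurable fun E => ‖D.wave φ E‖ₑ ^ 2 := by
  simp_rw [← ofReal_re_inner_self]
  exact (Complex.measurable_re.comp_aemeasurable (D.integrable_inner φ φ).aemeasurable).ennreal_ofReal

theorem lintegral_enorm_wave_sq (φ : H) : ∫⁻ E, ‖D.wave φ E‖ₑ ^ 2 = ‖φ‖ₑ ^ 2 := by
  simp_rw [← ofReal_re_inner_self]
  rw [← ofReal_integral_eq_lintegral_ofReal (f := fun E => (⟪D.wave φ E, D.wave φ E⟫_ℂ).re)]
  · rw [D.inner_eq φ φ]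
    congr 1
    exact integral_re (D.integrable_inner φ φ)
  · exact (D.integrable_inner φ φ).re
  · exact Eventually.of_forall fun E => inner_self_nonneg (𝕜 := ℂ)

theorem inner_evolution (t : ℝ) (φ ψ : H) :
    ⟪D.evolution t φ, ψ⟫_ℂ =
      ∫ E : ℝ, Complex.exp (Complex.I * (-t : ℝ) * E) * ⟪D.wave φ E, D.wave ψ E⟫_ℂ := by
  rw [D.inner_of_ae (D.wave_evolution t φ)]
  refine integral_congr_ae (Eventually.of_forall fun E => ?_)
  simp only [inner_smul_left, ← Complex.exp_conj, map_mul, Complex.conj_I, Complex.conj_ofReal]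
  congr 2
  push_cast; ring

theorem inner_evolution_left (t : ℝ) (φ ψ : H) :
    ⟪D.evolution t φ, ψ⟫_ℂ = ⟪φ, D.evolution (-t) ψ⟫_ℂ := by
  rw [D.inner_evolution, ← inner_conj_symm φ, D.inner_evolution, ← integral_conj]
  refine integral_congr_ae (Eventually.of_forall fun E => ?_)
  simp only [map_mul, ← Complex.exp_conj, Complex.conj_I, Complex.conj_ofReal, inner_conj_symm]
  congr 2
  push_cast; ring

end DirectIntegral

end Beam

namespace Beam

/-! ### Decomposition of the beam into rank one fields -/

namespace StationaryBeam

open InnerProductSpace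

variable {H : Type*} [NormedAddCommGroup H] [InnerProductSpace ℂ H]
  {HE : ℝ → Type*} [∀ E, NormedAddCommGroup (HE E)] [∀ E, InnerProductSpace ℂ (HE E)]
  {D : DirectIntegral H HE} (σ : StationaryBeam D)

theorem inner_op_ae (φ ψ : H) :
    (fun E => ⟪D.wave φ E, D.wave (σ.op ψ) E⟫_ℂ) =ᵐ[volume]
      fun E => ⟪D.wave φ E, σ.fiber E (D.wave ψ E)⟫_ℂ := by
  filter_upwards [σ.isDecomposition ψ] with E hE
  rw [hE]

theorem isPositive_op [CompleteSpace H] : σ.op.IsPositive := by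
  rw [ContinuousLinearMap.isPositive_iff_complex]
  intro ψ
  have h1 : ⟪σ.op ψ, ψ⟫_ℂ = ∫ E, ⟪σ.fiber E (D.wave ψ E), D.wave ψ E⟫_ℂ :=
    D.inner_of_ae (σ.isDecomposition ψ) ψ
  have h2 : ∀ᵐ E, ⟪σ.fiber E (D.wave ψ E), D.wave ψ E⟫_ℂ =
      ((⟪σ.fiber E (D.wave ψ E), D.wave ψ E⟫_ℂ).re : ℂ) := by
    filter_upwards [σ.fiber_isPositive] with E hE
    exact Complex.eq_re_of_ofReal_le (r := 0) (by simpa using hE.inner_nonneg_left _)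
  rw [integral_congr_ae h2, integral_complex_ofReal] at h1
  rw [h1]
  refine ⟨by simp, ?_⟩
  simp only [RCLike.re_to_complex, Complex.ofReal_re]
  refine integral_nonneg_of_ae ?_
  filter_upwards [σ.fiber_isPositive] with E hE
  exact hE.re_inner_nonneg_left _

variable [∀ E, CompleteSpace (HE E)]

/-- The image of the wave function of `ψ` under the square roots of the fibres of the beam. -/
noncomputable def sqrtWave (ψ : H) (E : ℝ) : HE E := CFC.sqrt (σ.fiber E) (D.wave ψ E)

theorem inner_sqrtWave_ae (φ ψ : H) :
    (fun E => ⟪σ.sqrtWave φ E, σ.sqrtWave ψ E⟫_ℂ) =ᵐ[volume]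
      fun E => ⟪D.wave φ E, D.wave (σ.op ψ) E⟫_ℂ := by
  filter_upwards [σ.inner_op_ae φ ψ, σ.fiber_isPositive] with E hE hp
  rw [hE, sqrtWave, sqrtWave, inner_sqrt_sqrt hp]

theorem integrable_inner_sqrtWave (φ ψ : H) :
    Integrable fun E => ⟪σ.sqrtWave φ E, σ.sqrtWave ψ E⟫_ℂ :=
  (D.integrable_inner φ (σ.op ψ)).congr (σ.inner_sqrtWave_ae φ ψ).symm

theorem lintegral_enorm_sqrtWave_sq (ψ : H) :
    ∫⁻ E, ‖σ.sqrtWave ψ E‖ₑ ^ 2 = ENNReal.ofReal (⟪ψ, σ.op ψ⟫_ℂ).re := by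
  simp_rw [← ofReal_re_inner_self]
  rw [← ofReal_integral_eq_lintegral_ofReal
    (f := fun E => (⟪σ.sqrtWave ψ E, σ.sqrtWave ψ E⟫_ℂ).re)]
  · rw [D.inner_eq ψ, ← integral_congr_ae (σ.inner_sqrtWave_ae ψ ψ)]
    congr 1
    exact integral_re (σ.integrable_inner_sqrtWave ψ ψ)
  · exact (σ.integrable_inner_sqrtWave ψ ψ).re
  · exact Eventually.of_forall fun E => inner_self_nonneg (𝕜 := ℂ)

/-- Fields in `HE` have no measurability of their own; only scalar functions of `E` do. The
Gram–Schmidt recursion expresses each scalar product through earlier ones by field operations, which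
allows strong induction. -/
theorem aemeasurable_inner_gramSchmidt (f : ℕ → H) (n : ℕ) (ψ : H) :
    AEMeasurable fun E =>
      ⟪gramSchmidt ℂ (fun k => σ.sqrtWave (f k) E) n, σ.sqrtWave ψ E⟫_ℂ := by
  induction n using Nat.strong_induction_on generalizing ψ with
  | _ n ih =>
    have e : ∀ E, ⟪gramSchmidt ℂ (fun k => σ.sqrtWave (f k) E) n, σ.sqrtWave ψ E⟫_ℂ =
        ⟪σ.sqrtWave (f n) E, σ.sqrtWave ψ E⟫_ℂ - ∑ i ∈ Finset.range n,
          (starRingEnd ℂ) (⟪gramSchmidt ℂ (fun k => σ.sqrtWave (f k) E) i, σ.sqrtWave (f n) E⟫_ℂ /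
            ⟪gramSchmidt ℂ (fun k => σ.sqrtWave (f k) E) i, σ.sqrtWave (f i) E⟫_ℂ) *
          ⟪gramSchmidt ℂ (fun k => σ.sqrtWave (f k) E) i, σ.sqrtWave ψ E⟫_ℂ := by
      intro E
      conv_rhs =>
        enter [1, 2]
        rw [gramSchmidt_def'' ℂ (fun k => σ.sqrtWave (f k) E) n]
      rw [inner_add_left, sum_inner, Nat.Iio_eq_range, eq_sub_iff_add_eq]
      congr 1
      refine Finset.sum_congr rfl fun i _ => ?_
      rw [inner_smul_left, inner_gramSchmidt_self (fun k => σ.sqrtWave (f k) E) i]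
      simp
    simp_rw [e]
    refine (σ.integrable_inner_sqrtWave _ _).aemeasurable.sub
      (Finset.aemeasurable_fun_sum _ fun i hi => ?_)
    have hi' := Finset.mem_range.1 hi
    exact (Complex.continuous_conj.measurable.comp_aemeasurable
      ((ih i hi' _).div (ih i hi' _))).mul (ih i hi' _)

/-- The normalising factor is itself a function of a scalar product, since `⟨gₙ, hₙ⟩ = ‖gₙ‖²`. -/
theorem aemeasurable_inner_gramSchmidtNormed (f : ℕ → H) (n : ℕ) (ψ : H) :
    AEMeasurable fun E =>
      ⟪gramSchmidtNormed ℂ (fun k => σ.sqrtWave (f k) E) n, σ.sqrtWave ψ E⟫_ℂ := by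
  have e : ∀ E, ⟪gramSchmidtNormed ℂ (fun k => σ.sqrtWave (f k) E) n, σ.sqrtWave ψ E⟫_ℂ =
      ((√(⟪gramSchmidt ℂ (fun k => σ.sqrtWave (f k) E) n, σ.sqrtWave (f n) E⟫_ℂ).re)⁻¹ : ℝ) *
        ⟪gramSchmidt ℂ (fun k => σ.sqrtWave (f k) E) n, σ.sqrtWave ψ E⟫_ℂ := by
    intro E
    rw [gramSchmidtNormed, inner_smul_left, inner_gramSchmidt_self (fun k => σ.sqrtWave (f k) E) n,
      Complex.ofReal_re, Real.sqrt_sq (norm_nonneg _)]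
    simp
  simp_rw [e]
  refine AEMeasurable.mul ?_ (σ.aemeasurable_inner_gramSchmidt f n ψ)
  exact Complex.measurable_ofReal.comp_aemeasurable (Real.continuous_sqrt.measurable.comp_aemeasurable
    (Complex.measurable_re.comp_aemeasurable (σ.aemeasurable_inner_gramSchmidt f n (f n)))).inv

theorem posTrace_fiber_ne_top (hγ : σ.rate < ∞) : ∫⁻ E, posTrace (σ.fiber E) ≠ ∞ := by
  intro h
  rw [rate, h, ENNReal.mul_top] at hγ
  · exact lt_irrefl _ hγ
  · have := Real.pi_pos
    simp only [ne_eq, ENNReal.ofReal_eq_zero, not_le]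
    positivity

/-- A beam of finite rate is, tested on the vectors of a sequence, a sum of rank one fields. -/
theorem exists_rankOne_fields (hσ : ∫⁻ E, posTrace (σ.fiber E) ≠ ∞) (f : ℕ → H) :
    ∃ φ : ℕ → H, ∑' j, ‖φ j‖ₑ ^ 2 ≤ ∫⁻ E, posTrace (σ.fiber E) ∧
      ∀ m, ENNReal.ofReal (⟪f m, σ.op (f m)⟫_ℂ).re =
        ∑' j, ∫⁻ E, ‖⟪D.wave (φ j) E, D.wave (f m) E⟫_ℂ‖ₑ ^ 2 := by
  -- Fibrewise Gram–Schmidt on the vectors `√σ̂(E) fₖ(E)` replaces a measurable choice of eigenbases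
  -- of `σ̂(E)`. It is complete enough for the given sequence `f`.
  let g : ℕ → ∀ E, HE E := fun j E => gramSchmidtNormed ℂ (fun k => σ.sqrtWave (f k) E) j
  let u : ℕ → ∀ E, HE E := fun j E => CFC.sqrt (σ.fiber E) (g j E)
  have hu : ∀ j (ψ : H) E, ⟪u j E, D.wave ψ E⟫_ℂ = ⟪g j E, σ.sqrtWave ψ E⟫_ℂ := by
    intro j ψ E
    rw [sqrtWave, ← ContinuousLinearMap.adjoint_inner_left, sqrt_adjoint]
  have hsum : ∀ᵐ E, ∑' j, ‖u j E‖ₑ ^ 2 ≤ posTrace (σ.fiber E) := by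
    filter_upwards [σ.fiber_isPositive] with E hE
    have := tsum_enorm_map_gramSchmidtNormed_le (sqrt_adjoint (σ.fiber E))
      (fun k => σ.sqrtWave (f k) E)
    rwa [sqrt_comp_sqrt hE] at this
  have hint : ∀ j ψ, Integrable fun E => ⟪u j E, D.wave ψ E⟫_ℂ := by
    intro j ψ
    refine ⟨?_, ?_⟩
    · simp_rw [hu]
      exact (σ.aemeasurable_inner_gramSchmidtNormed f j ψ).aestronglyMeasurable
    · refine lt_of_le_of_lt (lintegral_mono_ae (g := fun E => posTrace (σ.fiber E) +
        ‖D.wave ψ E‖ₑ ^ 2) ?_) ?_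
      · filter_upwards [hsum] with E hE
        have hcs : ‖⟪u j E, D.wave ψ E⟫_ℂ‖ₑ ≤ ‖u j E‖ₑ * ‖D.wave ψ E‖ₑ := by
          rw [← ofReal_norm, ← ofReal_norm, ← ofReal_norm, ← ENNReal.ofReal_mul (norm_nonneg _)]
          exact ENNReal.ofReal_le_ofReal (norm_inner_le_norm _ _)
        calc ‖⟪u j E, D.wave ψ E⟫_ℂ‖ₑ ≤ ‖u j E‖ₑ * ‖D.wave ψ E‖ₑ := hcs
          _ ≤ ‖u j E‖ₑ ^ 2 + ‖D.wave ψ E‖ₑ ^ 2 := by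
            rcases le_total (‖u j E‖ₑ) (‖D.wave ψ E‖ₑ) with h | h
            · refine le_trans ?_ le_add_self
              rw [sq]; gcongr
            · refine le_trans ?_ le_self_add
              rw [sq]; gcongr
          _ ≤ _ := by
            gcongr
            exact (ENNReal.le_tsum j).trans hE
      -- The integral is split by measurability of the second summand alone; none is available for
      -- the fibre traces.
      · rw [lintegral_add_right' _ (D.aemeasurable_enorm_wave_sq ψ), D.lintegral_enorm_wave_sq]
        exact ENNReal.add_lt_top.2 ⟨hσ.lt_top, by simp⟩
  -- The completeness axiom of the direct integral turns each field `uⱼ` into a vector of `H`.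
  choose φ hφ using fun j => D.exists_of_integrable (u j) (hint j)
  refine ⟨φ, ?_, fun m => ?_⟩
  · simp_rw [← D.lintegral_enorm_wave_sq]
    rw [← lintegral_tsum fun j => D.aemeasurable_enorm_wave_sq (φ j)]
    refine lintegral_mono_ae ?_
    filter_upwards [hsum, ae_all_iff.2 hφ] with E hE h2
    simp_rw [h2]
    exact hE
  · rw [← lintegral_tsum, ← σ.lintegral_enorm_sqrtWave_sq]
    · refine lintegral_congr_ae ?_
      filter_upwards [ae_all_iff.2 hφ] with E h2
      simp_rw [h2, hu]
      exact (tsum_enorm_inner_gramSchmidtNormed (fun k => σ.sqrtWave (f k) E) m).symm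
    · intro j
      exact (D.integrable_inner _ _).aemeasurable.enorm.pow_const 2

end StationaryBeam
end Beam

namespace Beam

/-! ### Time covariance and the time integral of the arrival probability -/

section TimeCovariant

variable {H : Type*} [NormedAddCommGroup H] [InnerProductSpace ℂ H] [CompleteSpace H]
  {HE : ℝ → Type*} [∀ E, NormedAddCommGroup (HE E)] [∀ E, InnerProductSpace ℂ (HE E)]
  {D : DirectIntegral H HE} {X : Type*} [MeasurableSpace X] {F : POVM (ℝ × X) H}

theorem measurableSet_timeWindow (t₁ t₂ : ℝ) :
    MeasurableSet (Set.Icc t₁ t₂ ×ˢ (Set.univ : Set X)) :=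
  measurableSet_Icc.prod MeasurableSet.univ

/-- Evolving the state shifts the window. Writing the result as an integral against the fixed
measure `F.diag φ` prepares the exchange with the integral over `t`. -/
theorem DirectIntegral.IsTimeCovariant.inner_op_evolution (hF : D.IsTimeCovariant F)
    {A : Set (ℝ × X)} (hA : MeasurableSet A) (t : ℝ) (φ : H) :
    ENNReal.ofReal (⟪D.evolution (-t) φ, F.op A (D.evolution (-t) φ)⟫_ℂ).re =
      ∫⁻ y, A.indicator 1 (y.1 - t, y.2) ∂(F.diag φ) := by
  have hm : Measurable fun y : ℝ × X => (y.1 - t, y.2) := by fun_prop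
  have h1 := hF t (A.indicator fun _ => 1) (measurable_const.indicator hA)
    ⟨1, fun y => by by_cases h : y ∈ A <;> simp [h]⟩
  rw [F.expect_indicator hA] at h1
  have h2 : (fun y : ℝ × X => A.indicator (fun _ => (1 : ℂ)) (y.1 - t, y.2)) =
      ((fun y : ℝ × X => (y.1 - t, y.2)) ⁻¹' A).indicator fun _ => 1 := by
    rfl
  have h3 : (fun y : ℝ × X => A.indicator (1 : ℝ × X → ℝ≥0∞) (y.1 - t, y.2)) =
      ((fun y : ℝ × X => (y.1 - t, y.2)) ⁻¹' A).indicator 1 := by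
    rfl
  rw [h2, F.expect_indicator (hm hA)] at h1
  rw [h3, lintegral_indicator_one (hm hA), F.diag_apply _ (hm hA), ← h1, D.inner_evolution_left,
    neg_neg]
  rfl

/-- Tonelli: for each outcome `y` the times `t` with `y.1 - t` in the window form an interval of
length `t₂ - t₁`, and the total mass of `F.diag φ` is at most `‖φ‖²`. For `t₁ > t₂` both sides
vanish. -/
theorem DirectIntegral.IsTimeCovariant.lintegral_inner_op_evolution (hF : D.IsTimeCovariant F)
    (t₁ t₂ : ℝ) (φ : H) :
    ∫⁻ t : ℝ, ENNReal.ofReal (⟪D.evolution (-t) φ,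
      F.op (Set.Icc t₁ t₂ ×ˢ Set.univ) (D.evolution (-t) φ)⟫_ℂ).re ≤
      ENNReal.ofReal (t₂ - t₁) * ‖φ‖ₑ ^ 2 := by
  simp_rw [hF.inner_op_evolution (measurableSet_timeWindow t₁ t₂)]
  have hm : Measurable fun p : ℝ × (ℝ × X) =>
      (Set.Icc t₁ t₂ ×ˢ (Set.univ : Set X)).indicator (1 : ℝ × X → ℝ≥0∞)
        (p.2.1 - p.1, p.2.2) := by
    have h1 : Measurable fun p : ℝ × (ℝ × X) => (p.2.1 - p.1, p.2.2) := by fun_prop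
    exact (measurable_one.indicator (measurableSet_timeWindow t₁ t₂)).comp h1
  rw [lintegral_lintegral_swap hm.aemeasurable]
  have h2 : ∀ y : ℝ × X, ∫⁻ t : ℝ, (Set.Icc t₁ t₂ ×ˢ (Set.univ : Set X)).indicator
      (1 : ℝ × X → ℝ≥0∞) (y.1 - t, y.2) = ENNReal.ofReal (t₂ - t₁) := by
    intro y
    have : ∀ t : ℝ, (Set.Icc t₁ t₂ ×ˢ (Set.univ : Set X)).indicator
        (1 : ℝ × X → ℝ≥0∞) (y.1 - t, y.2) = (Set.Icc (y.1 - t₂) (y.1 - t₁)).indicator 1 t := by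
      intro t
      simp only [Set.indicator, Set.mem_prod, Set.mem_univ, and_true, Set.mem_Icc, Pi.one_apply]
      congr 1
      refine propext ⟨fun h => ⟨by linarith [h.2], by linarith [h.1]⟩,
        fun h => ⟨by linarith [h.2], by linarith [h.1]⟩⟩
    simp_rw [this]
    rw [lintegral_indicator_one measurableSet_Icc, Real.volume_Icc]
    congr 1; ring
  simp_rw [h2]
  rw [lintegral_const]
  gcongr
  rw [F.diag_apply φ MeasurableSet.univ, ← ofReal_re_inner_self]
  refine ENNReal.ofReal_le_ofReal ?_
  have := (ContinuousLinearMap.le_def _ _).1 F.le_one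
  have := this.re_inner_nonneg_right φ
  simpa [inner_sub_right] using this

end TimeCovariant

/-! ### The trace of the time window -/

namespace StationaryBeam

variable {H : Type*} [NormedAddCommGroup H] [InnerProductSpace ℂ H] [CompleteSpace H]
  {HE : ℝ → Type*} [∀ E, NormedAddCommGroup (HE E)] [∀ E, InnerProductSpace ℂ (HE E)]
  {D : DirectIntegral H HE} (σ : StationaryBeam D)
  {X : Type*} [MeasurableSpace X] {F : POVM (ℝ × X) H}

/-- The operator `√σ̂ F(A) √σ̂` for the time window `A = [t₁, t₂] × X`. -/
noncomputable def window (F : POVM (ℝ × X) H) (t₁ t₂ : ℝ) : H →L[ℂ] H :=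
  CFC.sqrt σ.op ∘L F.op (Set.Icc t₁ t₂ ×ˢ Set.univ) ∘L CFC.sqrt σ.op

theorem isPositive_window (F : POVM (ℝ × X) H) (t₁ t₂ : ℝ) : (σ.window F t₁ t₂).IsPositive := by
  have := (F.isPositive _ (measurableSet_timeWindow t₁ t₂)).adjoint_conj (CFC.sqrt σ.op)
  rwa [sqrt_adjoint] at this

variable [∀ E, CompleteSpace (HE E)] [TopologicalSpace.SeparableSpace H]

/-- Energy and time are exchanged here: the trace over energies of the beam becomes, through
Plancherel, a time integral of arrival probabilities, evaluated by covariance. -/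
theorem posTrace_window_le (hγ : σ.rate < ∞) (hF : D.IsTimeCovariant F) (t₁ t₂ : ℝ) :
    posTrace (σ.window F t₁ t₂) ≤ σ.rate * ENNReal.ofReal (t₂ - t₁) := by
  have hpi := Real.pi_pos
  set G := F.op (Set.Icc t₁ t₂ ×ˢ Set.univ) with hG
  have hGp : G.IsPositive := F.isPositive _ (measurableSet_timeWindow t₁ t₂)
  set R := CFC.sqrt σ.op with hR
  set Q := CFC.sqrt G with hQ
  have hfin := σ.posTrace_fiber_ne_top hγ
  obtain ⟨φ, hφ1, hφ2⟩ := σ.exists_rankOne_fields hfin fun m => Q (basisSeq H m)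
  -- Cyclicity: `R Q Q R` and `Q R R Q` have the same trace, and in the second form `σ̂` stands
  -- between the vectors `Q eₘ`.
  have e1 : posTrace (σ.window F t₁ t₂) =
      ∑' m, ENNReal.ofReal (⟪Q (basisSeq H m), σ.op (Q (basisSeq H m))⟫_ℂ).re := by
    have h1 : σ.window F t₁ t₂ = (Q ∘L R).adjoint ∘L (Q ∘L R) := by
      rw [ContinuousLinearMap.adjoint_comp, sqrt_adjoint, sqrt_adjoint, window,
        ContinuousLinearMap.comp_assoc, ← ContinuousLinearMap.comp_assoc Q Q, sqrt_comp_sqrt hGp]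
    rw [h1, posTrace_adjoint_comp, tsum_enorm_sq_adjoint (basis H) (basis H),
      ← tsum_basisSeq (fun x => ‖(Q ∘L R).adjoint x‖ₑ ^ 2) (by simp)]
    refine tsum_congr fun m => ?_
    rw [← inner_sqrt_sqrt σ.isPositive_op, ofReal_re_inner_self,
      ContinuousLinearMap.adjoint_comp, sqrt_adjoint, sqrt_adjoint]
    rfl
  have e2 : ∀ m j, ∫⁻ E, ‖⟪D.wave (φ j) E, D.wave (Q (basisSeq H m)) E⟫_ℂ‖ₑ ^ 2 =
      ENNReal.ofReal (1 / (2 * Real.pi)) *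
        ∫⁻ t : ℝ, ‖⟪D.evolution (-t) (φ j), Q (basisSeq H m)⟫_ℂ‖ₑ ^ 2 := by
    intro m j
    have hi := D.integrable_inner (φ j) (Q (basisSeq H m))
    -- Square integrability, needed for Plancherel, comes from the expansion itself: this integral
    -- is one term of a series with finite sum.
    have hl : ∫⁻ E, ‖⟪D.wave (φ j) E, D.wave (Q (basisSeq H m)) E⟫_ℂ‖ₑ ^ 2 ≠ ∞ := by
      refine ne_top_of_le_ne_top ENNReal.ofReal_ne_top ((ENNReal.le_tsum j).trans (hφ2 m).ge)
    have hL2 : MemLp (fun E => ⟪D.wave (φ j) E, D.wave (Q (basisSeq H m)) E⟫_ℂ) 2 := by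
      refine ⟨hi.aestronglyMeasurable, ?_⟩
      rw [eLpNorm_lt_top_iff_lintegral_rpow_enorm_lt_top (by norm_num) (by norm_num)]
      simpa using hl.lt_top
    have := lintegral_enorm_integral_exp_sq hi hL2
    simp_rw [D.inner_evolution, neg_neg]
    rw [this, ← mul_assoc, ← ENNReal.ofReal_mul (by positivity), one_div,
      inv_mul_cancel₀ (by positivity), ENNReal.ofReal_one, one_mul]
  -- Parseval in `m` reassembles `⟨φⱼ(t), F(A) φⱼ(t)⟩` for the evolved vector `φⱼ(t)`.
  have e3 : ∀ j, ∑' m, ∫⁻ t : ℝ, ‖⟪D.evolution (-t) (φ j), Q (basisSeq H m)⟫_ℂ‖ₑ ^ 2 ≤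
      ENNReal.ofReal (t₂ - t₁) * ‖φ j‖ₑ ^ 2 := by
    intro j
    rw [← lintegral_tsum]
    · refine le_trans (le_of_eq ?_) (hF.lintegral_inner_op_evolution t₁ t₂ (φ j))
      refine lintegral_congr fun t => ?_
      rw [← inner_sqrt_sqrt hGp, ofReal_re_inner_self, ← tsum_enorm_inner_basisSeq_sq]
      refine tsum_congr fun m => ?_
      rw [← ContinuousLinearMap.adjoint_inner_left, sqrt_adjoint, ← inner_conj_symm, ← ofReal_norm,
        RCLike.norm_conj, ofReal_norm]
    · intro m
      simp_rw [D.inner_evolution, neg_neg]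
      have hc : Continuous fun t : ℝ => ∫ E : ℝ, Complex.exp (Complex.I * t * E) *
          ⟪D.wave (φ j) E, D.wave (Q (basisSeq H m)) E⟫_ℂ := by
        refine continuous_of_dominated
          (bound := fun E => ‖⟪D.wave (φ j) E, D.wave (Q (basisSeq H m)) E⟫_ℂ‖) ?_ ?_ ?_ ?_
        · intro t
          exact AEStronglyMeasurable.mul (Continuous.aestronglyMeasurable (by fun_prop))
            (D.integrable_inner _ _).aestronglyMeasurable
        · intro t
          refine Eventually.of_forall fun E => ?_
          rw [norm_mul, DirectIntegral.norm_phase, one_mul]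
        · exact (D.integrable_inner _ _).norm
        · exact Eventually.of_forall fun E => by fun_prop
      exact (hc.enorm.measurable.pow_const 2).aemeasurable
  rw [e1]
  simp_rw [hφ2, e2]
  rw [ENNReal.tsum_comm]
  simp_rw [ENNReal.tsum_mul_left]
  calc _ ≤ ENNReal.ofReal (1 / (2 * Real.pi)) *
        ∑' j, ENNReal.ofReal (t₂ - t₁) * ‖φ j‖ₑ ^ 2 := by
        gcongr with j
        exact e3 j
    _ ≤ ENNReal.ofReal (1 / (2 * Real.pi)) *
        (ENNReal.ofReal (t₂ - t₁) * ∫⁻ E, posTrace (σ.fiber E)) := by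
        rw [ENNReal.tsum_mul_left]; gcongr
    _ = _ := by rw [rate]; ring

end StationaryBeam

/-! ### Trace norm bounds from quadratic forms -/

section TraceNorm

variable {H : Type*} [NormedAddCommGroup H] [InnerProductSpace ℂ H] [CompleteSpace H]

/-- An approximate polar decomposition. -/
theorem exists_contraction_inner_abs_le (A : H →L[ℂ] H) {ε : ℝ} (hε : 0 < ε) :
    ∃ W : H →L[ℂ] H, ‖W‖ ≤ 1 ∧ ∀ x,
      (⟪x, CFC.abs A x⟫_ℂ).re ≤ ‖⟪W x, A x⟫_ℂ‖ + ε * ‖x‖ ^ 2 := by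
  set R := CFC.abs A with hR
  have hR0 : 0 ≤ R := CFC.abs_nonneg A
  have hRp : R.IsPositive := (ContinuousLinearMap.nonneg_iff_isPositive R).1 hR0
  have hRa : R.adjoint = R := hRp.isSelfAdjoint.adjoint_eq
  have hRR : R ∘L R = A.adjoint ∘L A := CFC.abs_mul_abs A
  have hu : IsUnit (R + algebraMap ℝ (H →L[ℂ] H) ε) := by
    have h1 : (-ε) ∉ spectrum ℝ R := fun h => by
      have := spectrum_nonneg_of_nonneg hR0 h
      linarith
    rw [spectrum.notMem_iff] at h1
    have := h1.neg
    rwa [map_neg, neg_sub, sub_neg_eq_add] at this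
  obtain ⟨u, hu⟩ := hu
  set T : H →L[ℂ] H := ↑u⁻¹ with hT
  have hTx : ∀ x, R (T x) + (ε : ℂ) • T x = x := by
    intro x
    have h1 : (↑u : H →L[ℂ] H) * ↑u⁻¹ = 1 := u.mul_inv
    rw [hu] at h1
    have h2 := congrArg (fun S : H →L[ℂ] H => S x) h1
    simpa [Algebra.algebraMap_eq_smul_one] using h2
  have hnorm : ∀ x, ‖A x‖ ^ 2 = ‖R x‖ ^ 2 := by
    intro x
    have h1 : ⟪A x, A x⟫_ℂ = ⟪R x, R x⟫_ℂ := by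
      rw [← ContinuousLinearMap.adjoint_inner_right, ← ContinuousLinearMap.comp_apply, ← hRR,
        ContinuousLinearMap.comp_apply, ← ContinuousLinearMap.adjoint_inner_left, hRa]
    rw [inner_self_eq_norm_sq_to_K, inner_self_eq_norm_sq_to_K] at h1
    exact_mod_cast h1
  have hexp : ∀ y, ‖R y + (ε : ℂ) • y‖ ^ 2 =
      ‖R y‖ ^ 2 + 2 * ε * (⟪y, R y⟫_ℂ).re + ε ^ 2 * ‖y‖ ^ 2 := by
    intro y
    have hsym : (⟪R y, y⟫_ℂ).re = (⟪y, R y⟫_ℂ).re := inner_re_symm (𝕜 := ℂ) _ _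
    rw [@norm_add_sq ℂ, inner_smul_right, norm_smul, ← hsym]
    simp [mul_pow]
    ring
  have hpos : ∀ y, 0 ≤ (⟪y, R y⟫_ℂ).re := fun y => hRp.re_inner_nonneg_right y
  -- `W = A (|A| + ε)⁻¹` is a contraction because `‖A y‖ = ‖|A| y‖ ≤ ‖(|A| + ε) y‖`. Compared with
  -- the exact polar decomposition the loss is `ε ⟨y, |A| x⟩` with `y = (|A| + ε)⁻¹ x`, at most `ε
  -- ‖x‖²`.
  refine ⟨A ∘L T, ContinuousLinearMap.opNorm_le_bound _ zero_le_one fun x => ?_, fun x => ?_⟩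
  · rw [one_mul, ContinuousLinearMap.comp_apply]
    refine le_of_sq_le_sq ?_ (norm_nonneg _)
    rw [hnorm]
    conv_rhs => rw [← hTx x]
    rw [hexp]
    have := hpos (T x)
    nlinarith [sq_nonneg (ε * ‖T x‖), mul_nonneg hε.le this]
  · set y := T x with hy
    have h1 : ⟪(A ∘L T) x, A x⟫_ℂ = ⟪R y, R x⟫_ℂ := by
      rw [ContinuousLinearMap.comp_apply, ← ContinuousLinearMap.adjoint_inner_right,
        ← ContinuousLinearMap.comp_apply A.adjoint, ← hRR,
        ContinuousLinearMap.comp_apply, ← ContinuousLinearMap.adjoint_inner_left, hRa]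
    have h2 : ⟪x, R x⟫_ℂ = ⟪R y, R x⟫_ℂ + ε * ⟪y, R x⟫_ℂ := by
      conv_lhs => enter [2]; rw [← hTx x]
      rw [inner_add_left, inner_smul_left, Complex.conj_ofReal]
    have h3 : (⟪y, R x⟫_ℂ).re = ‖R y‖ ^ 2 + ε * (⟪y, R y⟫_ℂ).re := by
      conv_lhs => rw [← hTx x]
      rw [map_add, inner_add_right, map_smul, inner_smul_right,
        ← ContinuousLinearMap.adjoint_inner_left, hRa, inner_self_eq_norm_sq_to_K]
      simp [← Complex.ofReal_pow]
      exact Or.inl rfl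
    have h4 : (⟪y, R x⟫_ℂ).re ≤ ‖x‖ ^ 2 := by
      rw [h3]
      conv_rhs => rw [← hTx x]
      rw [hexp]
      nlinarith [sq_nonneg (ε * ‖y‖), mul_nonneg hε.le (hpos y)]
    rw [h1, h2, Complex.add_re, Complex.re_ofReal_mul]
    have := Complex.re_le_norm ⟪R y, R x⟫_ℂ
    nlinarith

/-- The form bound is applied to `W eᵢ` and `eᵢ`, with `W` an approximate polar contraction. Both
resulting sums are at most `tr B`, since conjugation by `W` does not increase the trace, so the mean
costs no constant. -/
theorem traceNorm_le_of_norm_inner_le {A B : H →L[ℂ] H} (hB : B.IsPositive) {C : ℝ} (hC : 0 ≤ C)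
    (h : ∀ φ ψ : H, ‖⟪φ, A ψ⟫_ℂ‖ ≤ C * (((⟪φ, B φ⟫_ℂ).re + (⟪ψ, B ψ⟫_ℂ).re) / 2)) :
    traceNorm A ≤ ENNReal.ofReal C * posTrace B := by
  rw [traceNorm, posTrace, ENNReal.tsum_eq_iSup_sum]
  refine iSup_le fun s => ?_
  refine ENNReal.le_of_forall_pos_le_add fun δ hδ _ => ?_
  -- The error `ε` occurs once per basis vector of the finite partial sum; the `+ 1` covers the
  -- empty one.
  have hε : (0 : ℝ) < δ / (s.card + 1) := by positivity
  obtain ⟨W, hW, hWA⟩ := exists_contraction_inner_abs_le A hε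
  have hre : ∀ ψ, 0 ≤ (⟪ψ, B ψ⟫_ℂ).re := fun ψ => hB.re_inner_nonneg_right ψ
  calc ∑ i ∈ s, ENNReal.ofReal (⟪basis H i, CFC.abs A (basis H i)⟫_ℂ).re
      ≤ ∑ i ∈ s, (ENNReal.ofReal (C / 2) *
          (ENNReal.ofReal (⟪W (basis H i), B (W (basis H i))⟫_ℂ).re +
            ENNReal.ofReal (⟪basis H i, B (basis H i)⟫_ℂ).re) +
          ENNReal.ofReal (δ / (s.card + 1))) := by
        refine Finset.sum_le_sum fun i _ => ?_
        rw [← ENNReal.ofReal_add (hre _) (hre _), ← ENNReal.ofReal_mul (by positivity),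
          ← ENNReal.ofReal_add (mul_nonneg (by positivity) (add_nonneg (hre _) (hre _))) hε.le]
        refine ENNReal.ofReal_le_ofReal ?_
        have h1 := hWA (basis H i)
        rw [(basis H).orthonormal.1, one_pow, mul_one] at h1
        have h2 := h (W (basis H i)) (basis H i)
        linarith
    _ ≤ ENNReal.ofReal (C / 2) * (posTrace B + posTrace B) + δ := by
        rw [Finset.sum_add_distrib, ← Finset.mul_sum, Finset.sum_add_distrib]
        gcongr
        · exact (ENNReal.sum_le_tsum s).trans (tsum_re_inner_contraction_le hB hW)
        · exact ENNReal.sum_le_tsum s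
        · rw [Finset.sum_const, nsmul_eq_mul, ← ENNReal.ofReal_natCast,
            ← ENNReal.ofReal_mul (by positivity), ← ENNReal.ofReal_coe_nnreal]
          refine ENNReal.ofReal_le_ofReal ?_
          rw [mul_div_assoc', div_le_iff₀ (by positivity)]
          nlinarith [δ.2]
    _ = ENNReal.ofReal C * posTrace B + δ := by
        rw [← two_mul, ← mul_assoc, ← ENNReal.ofReal_ofNat, ← ENNReal.ofReal_mul (by positivity),
          div_mul_cancel₀ _ (by norm_num)]

end TraceNorm

namespace StationaryBeam

variable {H : Type*} [NormedAddCommGroup H] [InnerProductSpace ℂ H] [CompleteSpace H]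
  {HE : ℝ → Type*} [∀ E, NormedAddCommGroup (HE E)] [∀ E, InnerProductSpace ℂ (HE E)]
  {D : DirectIntegral H HE} (σ : StationaryBeam D)
  {X : Type*} [MeasurableSpace X] {F : POVM (ℝ × X) H}
  [∀ E, CompleteSpace (HE E)] [TopologicalSpace.SeparableSpace H]

theorem traceNorm_sandwich_le (hγ : σ.rate < ∞) (hF : D.IsTimeCovariant F) {t₁ t₂ : ℝ}
    {f : ℝ × X → ℂ} (hf : Measurable f) (hb : ∃ C : ℝ, ∀ y, ‖f y‖ ≤ C)
    (h0 : ∀ y : ℝ × X, y.1 ∉ Set.Icc t₁ t₂ → f y = 0) :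
    traceNorm (σ.sandwich F f) ≤ (⨆ y, ‖f y‖ₑ) * σ.rate * ENNReal.ofReal |t₂ - t₁| := by
  obtain ⟨C, hC⟩ := hb
  have htop : (⨆ y, ‖f y‖ₑ) ≠ ∞ := by
    refine ne_top_of_le_ne_top (b := ENNReal.ofReal C) ENNReal.ofReal_ne_top (iSup_le fun y => ?_)
    rw [← ofReal_norm]
    exact ENNReal.ofReal_le_ofReal (hC y)
  have hle : ∀ y, ‖f y‖ ≤ (⨆ y, ‖f y‖ₑ).toReal := fun y => by
    rw [← toReal_enorm]
    exact ENNReal.toReal_mono htop (le_iSup (fun y => ‖f y‖ₑ) y)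
  refine (traceNorm_le_of_norm_inner_le (σ.isPositive_window F t₁ t₂)
    (C := (⨆ y, ‖f y‖ₑ).toReal) ENNReal.toReal_nonneg fun φ ψ => ?_).trans ?_
  · have key : ∀ (T : H →L[ℂ] H) (φ ψ : H), ⟪φ, (CFC.sqrt σ.op ∘L T ∘L CFC.sqrt σ.op) ψ⟫_ℂ =
        ⟪CFC.sqrt σ.op φ, T (CFC.sqrt σ.op ψ)⟫_ℂ := by
      intro T φ ψ
      rw [ContinuousLinearMap.comp_apply, ← ContinuousLinearMap.adjoint_inner_left, sqrt_adjoint]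
      rfl
    rw [sandwich, window, key, key, key]
    exact F.norm_inner_expect_le_of_support hf hle (measurableSet_timeWindow t₁ t₂)
      (fun y hy => h0 y fun h => hy ⟨h, trivial⟩) _ _
  · rw [ENNReal.ofReal_toReal htop, mul_assoc]
    gcongr
    refine (σ.posTrace_window_le hγ hF t₁ t₂).trans ?_
    gcongr
    exact le_abs_self _

end StationaryBeam
end Beam

namespace Beam

/-! ### Positive semidefinite matrices and mixed discriminants -/

section Matrices

open Matrix
open scoped ComplexOrder

/-- Multilinearity in the rows: choosing rows of `M` on `s` and unit rows elsewhere leaves the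
principal minor of `s`. -/
theorem det_one_add_eq_sum {n : Type*} [Fintype n] [DecidableEq n] (M : Matrix n n ℂ) :
    (1 + M).det = ∑ s : Finset n, (M.submatrix (Subtype.val : s → n) Subtype.val).det := by
  have h := (Matrix.detRowAlternating (R := ℂ) (n := n)).map_add_univ M.row
    (1 : Matrix n n ℂ).row
  have h1 : (1 + M).det = Matrix.detRowAlternating (M.row + (1 : Matrix n n ℂ).row) := by
    rw [add_comm]; rfl
  rw [h1, h]
  refine Finset.sum_congr rfl fun s _ => ?_
  rw [← det_piecewise_one_eq_submatrix_det]
  rfl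

/-- The upper left corner of an infinite matrix. -/
def corner (A : Matrix ℕ ℕ ℂ) (N : ℕ) : Matrix (Fin N) (Fin N) ℂ :=
  A.submatrix Fin.val Fin.val

theorem det_one_add_corner (A : Matrix ℕ ℕ ℂ) (N : ℕ) :
    (1 + corner A N).det = ∑ S ∈ (Finset.range N).powerset, minor A S := by
  rw [det_one_add_eq_sum]
  refine Finset.sum_bij' (fun s _ => s.map Fin.valEmbedding)
    (fun S _ => Finset.univ.filter fun i : Fin N => (i : ℕ) ∈ S) ?_ ?_ ?_ ?_ ?_
  · intro s _
    rw [Finset.mem_powerset]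
    intro k hk
    obtain ⟨i, _, rfl⟩ := Finset.mem_map.1 hk
    exact Finset.mem_range.2 i.2
  · intro S _; exact Finset.mem_univ _
  · intro s _
    ext i
    simp [Fin.val_inj]
  · intro S hS
    ext k
    simp only [Finset.mem_map, Finset.mem_filter, Finset.mem_univ, true_and, Fin.valEmbedding_apply]
    constructor
    · rintro ⟨i, hi, rfl⟩; exact hi
    · intro hk
      exact ⟨⟨k, Finset.mem_range.1 (Finset.mem_powerset.1 hS hk)⟩, hk, rfl⟩
  · intro s _
    let e : s ≃ (s.map Fin.valEmbedding : Finset ℕ) :=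
      Equiv.ofBijective (fun i => ⟨(i : Fin N), Finset.mem_map.2 ⟨i, i.2, rfl⟩⟩)
        ⟨fun i j hij => Subtype.ext (Fin.ext (congrArg Subtype.val hij)), by
          rintro ⟨n, hn⟩
          obtain ⟨i, hi, rfl⟩ := Finset.mem_map.1 hn
          exact ⟨⟨i, hi⟩, rfl⟩⟩
    rw [minor, ← Matrix.det_submatrix_equiv_self e]
    rfl

/-- The product over the eigenvalues of `λ ≤ exp (λ - 1)`. -/
theorem det_le_exp_trace_sub {n : Type*} [Fintype n] [DecidableEq n] {A : Matrix n n ℂ}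
    (hA : A.PosSemidef) : A.det.re ≤ Real.exp (A.trace.re - Fintype.card n) := by
  rw [hA.1.det_eq_prod_eigenvalues, hA.1.trace_eq_sum_eigenvalues]
  simp only [Complex.coe_algebraMap]
  rw [← Complex.ofReal_prod, ← Complex.ofReal_sum, Complex.ofReal_re, Complex.ofReal_re]
  have : ∑ i, hA.1.eigenvalues i - (Fintype.card n : ℝ) = ∑ i, (hA.1.eigenvalues i - 1) := by
    simp
  rw [this, Real.exp_sum]
  refine Finset.prod_le_prod (fun i _ => hA.eigenvalues_nonneg i) fun i _ => ?_
  have := Real.add_one_le_exp (hA.1.eigenvalues i - 1)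
  linarith

theorem det_one_add_smul_le {n : Type*} [Fintype n] [DecidableEq n] {B : Matrix n n ℂ}
    (hB : B.PosSemidef) {r : ℝ} (hr : 0 ≤ r) :
    (1 + (r : ℂ) • B).det.re ≤ Real.exp (r * B.trace.re) := by
  have h : (1 + (r : ℂ) • B).PosSemidef := PosSemidef.one.add (hB.smul (by exact_mod_cast hr))
  refine (det_le_exp_trace_sub h).trans (le_of_eq ?_)
  simp

/-- Each eigenvalue `μ` of `1 - B` satisfies `1 - β ≤ μ ≤ 1`, hence `1/μ ≤ exp ((1 - μ)/μ) ≤ exp ((1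
- μ)/(1 - β))`. The bound involves only the trace and the gap, so it is uniform over corners. -/
theorem exp_le_det_one_sub {n : Type*} [Fintype n] [DecidableEq n] {B : Matrix n n ℂ}
    (hB : B.PosSemidef) {β : ℝ} (hβ : β < 1) (hB1 : ((β : ℂ) • 1 - B).PosSemidef) :
    Real.exp (-(B.trace.re / (1 - β))) ≤ (1 - B).det.re := by
  have hd : 0 < 1 - β := by linarith
  have hA : (1 - B).IsHermitian := isHermitian_one.sub hB.1
  have hnorm : ∀ i, star (⇑(hA.eigenvectorBasis i)) ⬝ᵥ ⇑(hA.eigenvectorBasis i) = 1 := by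
    intro i
    rw [dotProduct_comm, ← EuclideanSpace.inner_eq_star_dotProduct, inner_self_eq_norm_sq_to_K,
      hA.eigenvectorBasis.orthonormal.1 i]
    norm_num
  have h1 : ∀ i, hA.eigenvalues i ≤ 1 := by
    intro i
    rw [hA.eigenvalues_eq, sub_mulVec, one_mulVec, dotProduct_sub, hnorm]
    have := hB.re_dotProduct_nonneg (⇑(hA.eigenvectorBasis i))
    simp only [RCLike.re_to_complex, map_sub, Complex.one_re] at this ⊢
    simpa using this
  have h2 : ∀ i, 1 - β ≤ hA.eigenvalues i := by
    intro i
    rw [hA.eigenvalues_eq, sub_mulVec, one_mulVec, dotProduct_sub, hnorm]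
    have := hB1.re_dotProduct_nonneg (⇑(hA.eigenvectorBasis i))
    rw [sub_mulVec, smul_mulVec, one_mulVec, dotProduct_sub, dotProduct_smul, hnorm] at this
    simp at this ⊢
    linarith
  have h3 : B.trace.re = ∑ i, (1 - hA.eigenvalues i) := by
    have : B.trace = Fintype.card n - (1 - B).trace := by simp
    rw [this, hA.trace_eq_sum_eigenvalues]
    simp
  rw [h3, hA.det_eq_prod_eigenvalues]
  simp only [Complex.coe_algebraMap]
  rw [← Complex.ofReal_prod, Complex.ofReal_re, Finset.sum_div, ← Finset.sum_neg_distrib,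
    Real.exp_sum]
  refine Finset.prod_le_prod (fun i _ => (Real.exp_pos _).le) fun i _ => ?_
  set μ := hA.eigenvalues i
  have hμ : 0 < μ := hd.trans_le (h2 i)
  rw [Real.exp_neg, inv_le_comm₀ (Real.exp_pos _) hμ]
  refine le_trans ?_ (Real.add_one_le_exp _)
  have e : μ⁻¹ = (1 - μ) / μ + 1 := by field_simp; ring
  rw [e]
  have hh : 0 ≤ 1 - μ := by linarith [h1 i]
  have := h2 i
  gcongr

/-- The mixed discriminant of a family of matrices. -/
noncomputable def mixedDisc {ι : Type*} [Fintype ι] [DecidableEq ι] (B : ι → Matrix ι ι ℂ) : ℂ :=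
  ∑ π : Equiv.Perm ι, ∑ ρ : Equiv.Perm ι,
    ((Equiv.Perm.sign π : ℤ) : ℂ) * ((Equiv.Perm.sign ρ : ℤ) : ℂ) * ∏ k, B k (π k) (ρ k)

open scoped MatrixOrder in
theorem exists_conjTranspose_mul_self {n : Type*} [Fintype n] {B : Matrix n n ℂ}
    (hB : B.PosSemidef) : ∃ R : Matrix n n ℂ, B = Rᴴ * R := by
  classical
  refine ⟨CFC.sqrt B, ?_⟩
  have h0 : 0 ≤ B := nonneg_iff_posSemidef.2 hB
  have h1 : (CFC.sqrt B)ᴴ = CFC.sqrt B := (nonneg_iff_posSemidef.1 (CFC.sqrt_nonneg B)).1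
  rw [h1]
  exact (CFC.sqrt_mul_sqrt_self B h0).symm

/-- With `Bₖ = Rₖ* Rₖ`, expanding the product over the inner indices `a` writes the mixed
discriminant as a sum of `|det|²`, the determinant having as row `k` the row `a k` of `Rₖ`. -/
theorem mixedDisc_nonneg {ι : Type*} [Fintype ι] [DecidableEq ι] {B : ι → Matrix ι ι ℂ}
    (hB : ∀ k, (B k).PosSemidef) : 0 ≤ mixedDisc B := by
  choose R hR using fun k => exists_conjTranspose_mul_self (hB k)
  have e : mixedDisc B = ∑ a : ι → ι,
      star (∑ π : Equiv.Perm ι, ((Equiv.Perm.sign π : ℤ) : ℂ) * ∏ k, R k (a k) (π k)) *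
        ∑ ρ : Equiv.Perm ι, ((Equiv.Perm.sign ρ : ℤ) : ℂ) * ∏ k, R k (a k) (ρ k) := by
    simp_rw [mixedDisc, star_sum, Finset.sum_mul_sum]
    symm
    rw [Finset.sum_comm]
    refine Finset.sum_congr rfl fun π _ => ?_
    rw [Finset.sum_comm]
    refine Finset.sum_congr rfl fun ρ _ => ?_
    symm
    simp_rw [hR, mul_apply, conjTranspose_apply]
    rw [Finset.prod_univ_sum, Fintype.piFinset_univ, Finset.mul_sum]
    refine Finset.sum_congr rfl fun a _ => ?_
    rw [Finset.prod_mul_distrib, star_mul', star_prod]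
    simp
    ring
  rw [e]
  exact Finset.sum_nonneg fun a _ => star_mul_self_nonneg _

/-- For fixed `π` the substitution `ρ ↦ ρπ` removes `π` from both the product and the sign. -/
theorem sum_mixedDisc {ι : Type*} [Fintype ι] [DecidableEq ι] (K : Matrix ι ι ℂ) :
    mixedDisc (fun _ => K) = (Fintype.card ι).factorial * K.det := by
  have : ∀ π : Equiv.Perm ι, ∑ ρ : Equiv.Perm ι,
      ((Equiv.Perm.sign π : ℤ) : ℂ) * ((Equiv.Perm.sign ρ : ℤ) : ℂ) * ∏ k, K (π k) (ρ k) =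
        K.det := by
    intro π
    rw [← Matrix.det_transpose, Matrix.det_apply']
    rw [← Equiv.sum_comp (Equiv.mulRight π)]
    refine Finset.sum_congr rfl fun ρ _ => ?_
    simp only [Equiv.coe_mulRight, Equiv.Perm.sign_mul, Equiv.Perm.coe_mul, Function.comp_apply,
      transpose_apply]
    rw [Equiv.prod_comp π (fun k => K k (ρ k))]
    have : ((Equiv.Perm.sign π : ℤ) : ℂ) * ((Equiv.Perm.sign π : ℤ) : ℂ) = 1 := by
      rw [← Int.cast_mul]
      simp
    push_cast
    linear_combination (((Equiv.Perm.sign ρ : ℤ) : ℂ) * ∏ k, K k (ρ k)) * this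
  rw [mixedDisc, Finset.sum_congr rfl fun π _ => this π]
  simp [Fintype.card_perm]

end Matrices

end Beam

namespace Beam

/-! ### Matrix valued densities -/

section Density

open Matrix
open scoped ComplexOrder

variable {Y : Type*} [MeasurableSpace Y]

/-- An integrable density `κ` with respect to `ν` of a positive semidefinite infinite matrix of
complex measures. -/
structure IsMatrixDensity (ν : Measure Y) (κ : Y → Matrix ℕ ℕ ℂ) : Prop where
  measurable : ∀ i j, Measurable fun y => κ y i j
  integrable : ∀ i j, Integrable (fun y => κ y i j) ν
  posSemidef : ∀ y N, (corner (κ y) N).PosSemidef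

/-- The matrix of integrals of a function against a matrix valued density. -/
noncomputable def integralMatrix (ν : Measure Y) (κ : Y → Matrix ℕ ℕ ℂ) (z : Y → ℂ) :
    Matrix ℕ ℕ ℂ :=
  Matrix.of fun i j => ∫ y, z y * κ y i j ∂ν

namespace IsMatrixDensity

variable {ν : Measure Y} {κ : Y → Matrix ℕ ℕ ℂ} (hκ : IsMatrixDensity ν κ)
include hκ

/-- The map `e` need not be injective: repeated modes occur for Bosons. -/
theorem posSemidef_submatrix (y : Y) {ι : Type*} [Fintype ι] (e : ι → ℕ) :
    ((κ y).submatrix e e).PosSemidef := by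
  have hN : ∀ i, e i < (∑ j, e j) + 1 := fun i =>
    Nat.lt_succ_of_le (Finset.single_le_sum (f := e) (fun _ _ => Nat.zero_le _) (Finset.mem_univ i))
  exact (hκ.posSemidef y ((∑ j, e j) + 1)).submatrix (fun i => ⟨e i, hN i⟩)

theorem integrable_mul {z : Y → ℂ} (hz : Measurable z) {r : ℝ} (hr : ∀ y, ‖z y‖ ≤ r) (i j : ℕ) :
    Integrable (fun y => z y * κ y i j) ν :=
  (hκ.integrable i j).bdd_mul hz.aestronglyMeasurable (Eventually.of_forall hr)

theorem star_apply (y : Y) (i j : ℕ) : star (κ y i j) = κ y j i := by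
  have h := (hκ.posSemidef_submatrix y ![i, j]).1
  have := congrFun (congrFun h 1) 0
  exact this

/-- The quadratic form of the matrix of integrals. -/
theorem star_dotProduct_integralMatrix {z : Y → ℂ} (hz : Measurable z) {r : ℝ}
    (hr : ∀ y, ‖z y‖ ≤ r) (N : ℕ) (x : Fin N → ℂ) :
    star x ⬝ᵥ (corner (integralMatrix ν κ z) N *ᵥ x) =
      ∫ y, z y * (star x ⬝ᵥ (corner (κ y) N *ᵥ x)) ∂ν := by
  have hi : ∀ i j : Fin N, Integrable (fun y => z y * (star x i * (κ y i j * x j))) ν := by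
    intro i j
    refine (((hκ.integrable_mul hz hr i j).const_mul (star x i)).mul_const (x j)).congr
      (Eventually.of_forall fun y => ?_)
    simp only
    ring
  simp only [dotProduct, mulVec, corner, submatrix_apply, integralMatrix, of_apply, Finset.mul_sum]
  rw [integral_finsetSum _ fun i _ => integrable_finsetSum _ fun j _ => hi i j]
  refine Finset.sum_congr rfl fun i _ => ?_
  rw [integral_finsetSum _ fun j _ => hi i j]
  refine Finset.sum_congr rfl fun j _ => ?_
  rw [← integral_mul_const, ← integral_const_mul]
  congr 1
  ext y
  ring

theorem posSemidef_integralMatrix_one (N : ℕ) :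
    (corner (integralMatrix ν κ fun _ => 1) N).PosSemidef := by
  refine PosSemidef.of_dotProduct_mulVec_nonneg ?_ fun x => ?_
  · ext i j
    simp only [corner, conjTranspose_apply, submatrix_apply, integralMatrix, of_apply, one_mul]
    rw [← starRingEnd_apply, ← integral_conj]
    congr 1
    ext y
    exact hκ.star_apply y _ _
  · rw [hκ.star_dotProduct_integralMatrix measurable_const (r := 1) (by simp) N x]
    refine integral_nonneg fun y => ?_
    rw [Pi.zero_apply, one_mul]
    exact (hκ.posSemidef y N).dotProduct_mulVec_nonneg x

end IsMatrixDensity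

theorem minor_eq_det_orderEmb (A : Matrix ℕ ℕ ℂ) (S : Finset ℕ) :
    minor A S = (A.submatrix (S.orderEmbOfFin rfl) (S.orderEmbOfFin rfl)).det := by
  rw [minor, ← Matrix.det_submatrix_equiv_self (S.orderIsoOfFin rfl).toEquiv]
  rfl

/-- The density of the points belonging to a finite set of modes. -/
noncomputable def sectorDensity (κ : Y → Matrix ℕ ℕ ℂ) (S : Finset ℕ) (y : Fin S.card → Y) : ℂ :=
  mixedDisc (fun k => (κ (y k)).submatrix (S.orderEmbOfFin rfl) (S.orderEmbOfFin rfl)) /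
    (S.card.factorial : ℂ)

/-- The distribution of the points belonging to a finite set of modes. -/
noncomputable def sectorMeasure (ν : Measure Y) (κ : Y → Matrix ℕ ℕ ℂ) (S : Finset ℕ) :
    Measure (Fin S.card → Y) :=
  (Measure.pi fun _ => ν).withDensity fun y => ENNReal.ofReal (sectorDensity κ S y).re

namespace IsMatrixDensity

variable {ν : Measure Y} [IsFiniteMeasure ν] {κ : Y → Matrix ℕ ℕ ℂ} (hκ : IsMatrixDensity ν κ)
include hκ

omit [IsFiniteMeasure ν] in
theorem sectorDensity_nonneg (S : Finset ℕ) (y : Fin S.card → Y) : 0 ≤ sectorDensity κ S y :=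
  div_nonneg (mixedDisc_nonneg fun k => hκ.posSemidef_submatrix (y k) _) (by positivity)

omit [IsFiniteMeasure ν] in
theorem ofReal_re_sectorDensity (S : Finset ℕ) (y : Fin S.card → Y) :
    (((sectorDensity κ S y).re : ℝ) : ℂ) = sectorDensity κ S y :=
  (Complex.eq_re_of_ofReal_le (r := 0) (by simpa using hκ.sectorDensity_nonneg S y)).symm

omit [IsFiniteMeasure ν] in
theorem re_sectorDensity_nonneg (S : Finset ℕ) (y : Fin S.card → Y) :
    0 ≤ (sectorDensity κ S y).re :=
  (Complex.nonneg_iff.1 (hκ.sectorDensity_nonneg S y)).1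

omit [IsFiniteMeasure ν] in
theorem measurable_sectorDensity (S : Finset ℕ) : Measurable (sectorDensity κ S) := by
  unfold sectorDensity mixedDisc
  refine Measurable.div_const ?_ _
  refine Finset.measurable_fun_sum _ fun π _ => Finset.measurable_fun_sum _ fun ρ _ => ?_
  refine Measurable.const_mul ?_ _
  refine Finset.measurable_fun_prod _ fun k _ => ?_
  exact (hκ.measurable _ _).comp (measurable_pi_apply k)

/-- The density is a finite signed sum of products of functions of one variable. Fubini replaces
every `κ (y k)` by the same matrix of integrals, and the mixed discriminant collapses to a factorial
times a determinant. -/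
theorem integrable_prod_mul_sectorDensity {z : Y → ℂ} (hz : Measurable z) {r : ℝ}
    (hr : ∀ y, ‖z y‖ ≤ r) (S : Finset ℕ) :
    Integrable (fun y : Fin S.card → Y => (∏ k, z (y k)) * sectorDensity κ S y)
      (Measure.pi fun _ => ν) ∧
    ∫ y, (∏ k, z (y k)) * sectorDensity κ S y ∂(Measure.pi fun _ => ν) =
      minor (integralMatrix ν κ z) S := by
  set e := S.orderEmbOfFin rfl with he
  have h1 : ∀ y : Fin S.card → Y, (∏ k, z (y k)) * sectorDensity κ S y =
      ∑ π : Equiv.Perm (Fin S.card), ∑ ρ : Equiv.Perm (Fin S.card),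
        (((Equiv.Perm.sign π : ℤ) : ℂ) * ((Equiv.Perm.sign ρ : ℤ) : ℂ) /
          (S.card.factorial : ℂ)) * ∏ k, (z (y k) * κ (y k) (e (π k)) (e (ρ k))) := by
    intro y
    rw [sectorDensity, mixedDisc, mul_div_assoc', Finset.mul_sum, Finset.sum_div]
    refine Finset.sum_congr rfl fun π _ => ?_
    rw [Finset.mul_sum, Finset.sum_div]
    refine Finset.sum_congr rfl fun ρ _ => ?_
    rw [Finset.prod_mul_distrib]
    simp only [submatrix_apply]
    ring
  have hi : ∀ π ρ : Equiv.Perm (Fin S.card), Integrable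
      (fun y : Fin S.card → Y => ∏ k, (z (y k) * κ (y k) (e (π k)) (e (ρ k))))
      (Measure.pi fun _ => ν) := fun π ρ =>
    Integrable.fintype_prod (f := fun k y => z y * κ y (e (π k)) (e (ρ k)))
      fun k => hκ.integrable_mul hz hr _ _
  simp_rw [h1]
  refine ⟨integrable_finsetSum _ fun π _ => integrable_finsetSum _ fun ρ _ =>
    (hi π ρ).const_mul _, ?_⟩
  rw [integral_finsetSum _ fun π _ => integrable_finsetSum _ fun ρ _ => (hi π ρ).const_mul _]
  have h2 : ∀ π : Equiv.Perm (Fin S.card), ∫ y, ∑ ρ : Equiv.Perm (Fin S.card),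
        (((Equiv.Perm.sign π : ℤ) : ℂ) * ((Equiv.Perm.sign ρ : ℤ) : ℂ) /
          (S.card.factorial : ℂ)) * ∏ k, (z (y k) * κ (y k) (e (π k)) (e (ρ k)))
          ∂(Measure.pi fun _ => ν) =
      ∑ ρ : Equiv.Perm (Fin S.card),
        (((Equiv.Perm.sign π : ℤ) : ℂ) * ((Equiv.Perm.sign ρ : ℤ) : ℂ) /
          (S.card.factorial : ℂ)) * ∏ k, (integralMatrix ν κ z).submatrix e e (π k) (ρ k) := by
    intro π
    rw [integral_finsetSum _ fun ρ _ => (hi π ρ).const_mul _]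
    refine Finset.sum_congr rfl fun ρ _ => ?_
    rw [integral_const_mul,
      integral_fintype_prod_eq_prod (fun k y => z y * κ y (e (π k)) (e (ρ k)))]
    rfl
  rw [Finset.sum_congr rfl fun π _ => h2 π, minor_eq_det_orderEmb]
  have h3 := sum_mixedDisc ((integralMatrix ν κ z).submatrix e e)
  rw [mixedDisc, Fintype.card_fin] at h3
  have hf : (S.card.factorial : ℂ) ≠ 0 := by exact_mod_cast S.card.factorial_ne_zero
  rw [← mul_right_inj' hf, ← h3, Finset.mul_sum]
  refine Finset.sum_congr rfl fun π _ => ?_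
  rw [Finset.mul_sum]
  refine Finset.sum_congr rfl fun ρ _ => ?_
  field_simp

theorem integral_sectorMeasure {z : Y → ℂ} (hz : Measurable z) {r : ℝ}
    (hr : ∀ y, ‖z y‖ ≤ r) (S : Finset ℕ) :
    ∫ y, ∏ k, z (y k) ∂(sectorMeasure ν κ S) = minor (integralMatrix ν κ z) S := by
  have hm : Measurable fun y => ENNReal.ofReal (sectorDensity κ S y).re :=
    (Complex.measurable_re.comp (hκ.measurable_sectorDensity S)).ennreal_ofReal
  rw [sectorMeasure, integral_withDensity_eq_integral_toReal_smul hm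
    (Eventually.of_forall fun y => ENNReal.ofReal_lt_top),
    ← (hκ.integrable_prod_mul_sectorDensity hz hr S).2]
  congr 1
  ext y
  rw [ENNReal.toReal_ofReal (hκ.re_sectorDensity_nonneg S y), Complex.real_smul,
    hκ.ofReal_re_sectorDensity, mul_comm]

theorem integrable_sectorDensity (S : Finset ℕ) :
    Integrable (sectorDensity κ S) (Measure.pi fun _ => ν) := by
  simpa using (hκ.integrable_prod_mul_sectorDensity (z := fun _ => 1) measurable_const
    (r := 1) (by simp) S).1

theorem integral_re_sectorDensity (S : Finset ℕ) :
    ∫ y, (sectorDensity κ S y).re ∂(Measure.pi fun _ => ν) =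
      (minor (integralMatrix ν κ fun _ => 1) S).re := by
  have h := (hκ.integrable_prod_mul_sectorDensity (z := fun _ => 1) measurable_const
    (r := 1) (by simp) S)
  rw [← h.2]
  simp only [Finset.prod_const_one, one_mul]
  exact integral_re (hκ.integrable_sectorDensity S)

theorem sectorMeasure_univ (S : Finset ℕ) :
    sectorMeasure ν κ S Set.univ =
      ENNReal.ofReal (minor (integralMatrix ν κ fun _ => 1) S).re := by
  rw [sectorMeasure, withDensity_apply _ MeasurableSet.univ, Measure.restrict_univ,
    ← hκ.integral_re_sectorDensity, ofReal_integral_eq_lintegral_ofReal]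
  · exact (hκ.integrable_sectorDensity S).re
  · exact Eventually.of_forall (hκ.re_sectorDensity_nonneg S)

/-- Positivity of the density lets the case `z = 1` dominate all bounded `z`; summability is only
ever checked for `z = 1`. -/
theorem norm_minor_integralMatrix_le {z : Y → ℂ} (hz : Measurable z) {r : ℝ}
    (hr : ∀ y, ‖z y‖ ≤ r) (S : Finset ℕ) :
    ‖minor (integralMatrix ν κ z) S‖ ≤
      r ^ S.card * (minor (integralMatrix ν κ fun _ => 1) S).re := by
  rw [← (hκ.integrable_prod_mul_sectorDensity hz hr S).2, ← hκ.integral_re_sectorDensity,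
    ← integral_const_mul]
  refine norm_integral_le_of_norm_le ((hκ.integrable_sectorDensity S).re.const_mul _)
    (Eventually.of_forall fun y => ?_)
  rw [norm_mul, norm_prod]
  have h1 : ‖sectorDensity κ S y‖ = (sectorDensity κ S y).re := by
    rw [← hκ.ofReal_re_sectorDensity, Complex.norm_real, Complex.ofReal_re, Real.norm_eq_abs,
      abs_of_nonneg (hκ.re_sectorDensity_nonneg S y)]
  rw [h1]
  refine mul_le_mul_of_nonneg_right ?_ (hκ.re_sectorDensity_nonneg S y)
  calc ∏ k, ‖z (y k)‖ ≤ ∏ _k : Fin S.card, r :=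
        Finset.prod_le_prod (fun _ _ => norm_nonneg _) fun k _ => hr _
    _ = r ^ S.card := by simp

theorem minor_integralMatrix_one_nonneg (S : Finset ℕ) :
    0 ≤ (minor (integralMatrix ν κ fun _ => 1) S).re := by
  rw [← hκ.integral_re_sectorDensity]
  exact integral_nonneg (hκ.re_sectorDensity_nonneg S)

end IsMatrixDensity

end Density

end Beam

namespace Beam

/-! ### Fredholm determinants of matrices of integrals -/

section Fredholm

open Matrix
open scoped ComplexOrder

theorem tendsto_sum_powerset_range {f : Finset ℕ → ℂ} (hf : Summable f) :
    Tendsto (fun N => ∑ S ∈ (Finset.range N).powerset, f S) atTop (𝓝 (∑' S, f S)) := by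
  refine hf.hasSum.comp (tendsto_atTop_finset_of_monotone (fun M N hMN =>
    Finset.powerset_mono.2 (Finset.range_mono hMN)) fun S => ?_)
  exact ⟨S.sup id + 1, Finset.mem_powerset.2 fun i hi =>
    Finset.mem_range.2 (Nat.lt_succ_of_le (Finset.le_sup (f := id) hi))⟩

theorem tendsto_det_one_add_corner {A : Matrix ℕ ℕ ℂ} (hA : Summable (minor A)) :
    Tendsto (fun N => (1 + corner A N).det) atTop (𝓝 (∑' S, minor A S)) := by
  simp_rw [det_one_add_corner]
  exact tendsto_sum_powerset_range hA

theorem minor_smul (c : ℂ) (A : Matrix ℕ ℕ ℂ) (S : Finset ℕ) :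
    minor (c • A) S = c ^ S.card * minor A S := by
  rw [minor, submatrix_smul, Pi.smul_apply, Pi.smul_apply, det_smul, Fintype.card_coe, minor]

theorem summable_of_sum_powerset_le {f : Finset ℕ → ℝ} (h0 : ∀ S, 0 ≤ f S) {c : ℝ}
    (hc : ∀ N, ∑ S ∈ (Finset.range N).powerset, f S ≤ c) : Summable f := by
  refine summable_of_sum_le (c := c) h0 fun u => ?_
  refine le_trans ?_ (hc ((u.sup id).sup id + 1))
  refine Finset.sum_le_sum_of_subset_of_nonneg (fun S hS => Finset.mem_powerset.2 fun i hi => ?_)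
    fun S _ _ => h0 S
  refine Finset.mem_range.2 (Nat.lt_succ_of_le ?_)
  exact Finset.le_sup (f := id) (Finset.le_sup (f := id) hS hi)

theorem tsum_minor_zero : ∑' S, minor 0 S = 1 := by
  rw [tsum_eq_single ∅]
  · rw [minor, det_isEmpty]
  · intro S hS
    obtain ⟨i, hi⟩ := Finset.nonempty_iff_ne_empty.2 hS
    exact det_eq_zero_of_row_eq_zero ⟨i, hi⟩ fun j => rfl

variable {Y : Type*} [MeasurableSpace Y] {ν : Measure Y} [IsFiniteMeasure ν]
  {κ : Y → Matrix ℕ ℕ ℂ}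

namespace IsMatrixDensity

variable (hκ : IsMatrixDensity ν κ)
include hκ

omit [IsFiniteMeasure ν] in
theorem integralMatrix_one_diag_nonneg (i : ℕ) :
    0 ≤ (integralMatrix ν κ (fun _ => 1) i i).re := by
  have := (hκ.posSemidef_integralMatrix_one (i + 1)).diag_nonneg (i := Fin.last i)
  exact (Complex.nonneg_iff.1 this).1

omit hκ [IsFiniteMeasure ν] in
theorem trace_corner_re (A : Matrix ℕ ℕ ℂ) (N : ℕ) :
    (corner A N).trace.re = ∑ i ∈ Finset.range N, (A i i).re := by
  rw [trace, Complex.re_sum, Finset.sum_range]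
  rfl

omit [IsFiniteMeasure ν] in
theorem trace_corner_re_le (htr : Summable fun i => (integralMatrix ν κ (fun _ => 1) i i).re)
    (N : ℕ) : (corner (integralMatrix ν κ fun _ => 1) N).trace.re ≤
      ∑' i, (integralMatrix ν κ (fun _ => 1) i i).re := by
  rw [trace_corner_re]
  exact htr.sum_le_tsum _ fun i _ => hκ.integralMatrix_one_diag_nonneg i

/-- The partial sum over subsets of `{0, …, N - 1}` is `det(1 + rB)` of a corner, bounded by `exp (r
tr B)`. -/
theorem summable_pow_mul_minor (htr : Summable fun i => (integralMatrix ν κ (fun _ => 1) i i).re)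
    {r : ℝ} (hr : 0 ≤ r) :
    Summable fun S => r ^ S.card * (minor (integralMatrix ν κ fun _ => 1) S).re := by
  refine summable_of_sum_powerset_le
    (fun S => mul_nonneg (by positivity) (hκ.minor_integralMatrix_one_nonneg S))
    (c := Real.exp (r * ∑' i, (integralMatrix ν κ (fun _ => 1) i i).re)) fun N => ?_
  have h1 := det_one_add_smul_le (hκ.posSemidef_integralMatrix_one N) hr
  have h2 : 1 + (r : ℂ) • corner (integralMatrix ν κ fun _ => 1) N =
      1 + corner ((r : ℂ) • integralMatrix ν κ fun _ => 1) N := rfl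
  rw [h2, det_one_add_corner, Complex.re_sum] at h1
  refine le_trans (le_of_eq ?_) (h1.trans ?_)
  · refine Finset.sum_congr rfl fun S _ => ?_
    rw [minor_smul, ← Complex.ofReal_pow, Complex.re_ofReal_mul]
  · gcongr
    exact hκ.trace_corner_re_le htr N

theorem summable_minor (htr : Summable fun i => (integralMatrix ν κ (fun _ => 1) i i).re)
    {z : Y → ℂ} (hz : Measurable z) {r : ℝ} (hr : ∀ y, ‖z y‖ ≤ r) :
    Summable (minor (integralMatrix ν κ z)) := by
  refine (hκ.summable_pow_mul_minor htr (r := |r|) (abs_nonneg r)).of_norm_bounded fun S => ?_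
  exact hκ.norm_minor_integralMatrix_le hz (fun y => (hr y).trans (le_abs_self r)) S

omit [IsFiniteMeasure ν] in
theorem integralMatrix_sub_one {z : Y → ℂ} (hz : Measurable z) {r : ℝ} (hr : ∀ y, ‖z y‖ ≤ r) :
    integralMatrix ν κ (fun y => z y - 1) =
      integralMatrix ν κ z - integralMatrix ν κ fun _ => 1 := by
  ext i j
  simp only [integralMatrix, of_apply, Matrix.sub_apply]
  rw [← integral_sub (hκ.integrable_mul hz hr i j)
    (hκ.integrable_mul measurable_const (r := 1) (by simp) i j)]
  congr 1
  ext y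
  ring

end IsMatrixDensity

end Fredholm

/-! ### Triangular change of basis -/

section Triangular

open Matrix
open scoped ComplexOrder

/-- Congruence of an infinite matrix by an upper triangular matrix, given by its columns. -/
def triangularConj (a : ℕ → ℕ → ℂ) (A : Matrix ℕ ℕ ℂ) : Matrix ℕ ℕ ℂ :=
  Matrix.of fun m n => ∑ j ∈ Finset.range (m + 1), ∑ k ∈ Finset.range (n + 1),
    star (a m j) * A j k * a n k

/-- The upper left corner of an upper triangular matrix, given by its columns. -/
def triangularCorner (a : ℕ → ℕ → ℂ) (N : ℕ) : Matrix (Fin N) (Fin N) ℂ :=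
  Matrix.of fun j n => a n j

theorem sum_range_eq_sum_fin {a : ℕ → ℕ → ℂ} (ha : ∀ n j, n < j → a n j = 0) {N : ℕ} (n : Fin N)
    {V : Type*} [AddCommMonoid V] [Module ℂ V] (f : ℕ → V) (g : ℂ → V → V)
    (hg : ∀ v, g 0 v = 0) :
    ∑ j ∈ Finset.range (n + 1), g (a n j) (f j) = ∑ j : Fin N, g (a n j) (f j) := by
  rw [Fin.sum_univ_eq_sum_range (fun j => g (a n j) (f j))]
  refine Finset.sum_subset (Finset.range_mono n.2) fun j _ hj => ?_
  rw [ha n j (by simpa using hj), hg]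

/-- Triangularity is what makes congruence commute with truncation; for `(1 - B)^(-1/2)` this would
fail. -/
theorem corner_triangularConj {a : ℕ → ℕ → ℂ} (ha : ∀ n j, n < j → a n j = 0)
    (A : Matrix ℕ ℕ ℂ) (N : ℕ) :
    corner (triangularConj a A) N =
      (triangularCorner a N)ᴴ * corner A N * triangularCorner a N := by
  ext m n
  simp only [corner, triangularConj, triangularCorner, submatrix_apply, of_apply, mul_apply,
    conjTranspose_apply, Finset.sum_mul]
  have h1 : ∀ j : ℕ, ∑ k ∈ Finset.range (n + 1), star (a m j) * A j k * a n k =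
      ∑ k : Fin N, star (a m j) * A j k * a n k := fun j =>
    sum_range_eq_sum_fin ha n (fun k => star (a m j) * A j k) (fun c v => v * c) (by simp)
  simp_rw [h1]
  have h2 := sum_range_eq_sum_fin ha m (V := ℂ) (fun j => ∑ k : Fin N, A j k * a n k)
    (fun c v => star c * v) (by simp)
  simp only [Finset.mul_sum, ← mul_assoc] at h2
  rw [h2, Finset.sum_comm]

/-- The coefficients of Gram–Schmidt on `h` are triangular, and orthonormality of the result is the
stated congruence: an inverse Cholesky factor, the same for all `N`. -/
theorem exists_triangular_of_gram {V : Type*} [NormedAddCommGroup V] [InnerProductSpace ℂ V]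
    (h : ℕ → V) (hli : LinearIndependent ℂ h) (G : Matrix ℕ ℕ ℂ)
    (hG : ∀ i j, ⟪h i, h j⟫_ℂ = G i j) :
    ∃ a : ℕ → ℕ → ℂ, (∀ n j, n < j → a n j = 0) ∧
      ∀ N, (triangularCorner a N)ᴴ * corner G N * triangularCorner a N = 1 := by
  have h1 : ∀ n, ∃ c : ℕ → ℂ, ∑ j ∈ Finset.range (n + 1), c j • h j =
      InnerProductSpace.gramSchmidtNormed ℂ h n := by
    intro n
    have h2 : InnerProductSpace.gramSchmidtNormed ℂ h n ∈
        Submodule.span ℂ (h '' (Finset.range (n + 1) : Set ℕ)) := by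
      refine Submodule.smul_mem _ _ ?_
      have := InnerProductSpace.gramSchmidt_mem_span ℂ h (le_refl n)
      have hs : ((Finset.range (n + 1) : Finset ℕ) : Set ℕ) = Set.Iic n := by
        ext k
        simp
      rwa [hs]
    obtain ⟨c, hc⟩ := (Submodule.mem_span_image_finset_iff_exists_fun' ℂ).1 h2
    exact ⟨c, hc⟩
  choose c hc using h1
  let a : ℕ → ℕ → ℂ := fun n j => if n < j then 0 else c n j
  have ha : ∀ n j, n < j → a n j = 0 := fun n j hj => if_pos hj
  have hac : ∀ n, ∑ j ∈ Finset.range (n + 1), a n j • h j =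
      InnerProductSpace.gramSchmidtNormed ℂ h n := by
    intro n
    rw [← hc n]
    refine Finset.sum_congr rfl fun j hj => ?_
    have : ¬ n < j := by simpa [Nat.lt_succ_iff] using hj
    simp only [a, if_neg this]
  refine ⟨a, ha, fun N => ?_⟩
  rw [← corner_triangularConj ha]
  have ho := InnerProductSpace.gramSchmidtNormed_orthonormal (𝕜 := ℂ) hli
  ext m n
  have h3 := orthonormal_iff_ite.1 ho (m : ℕ) (n : ℕ)
  rw [← hac, ← hac, sum_inner] at h3
  simp only [inner_sum, inner_smul_left, inner_smul_right, hG] at h3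
  rw [Matrix.one_apply]
  simp only [Fin.ext_iff]
  rw [← h3]
  simp only [corner, triangularConj, submatrix_apply, of_apply]
  refine Finset.sum_congr rfl fun j _ => Finset.sum_congr rfl fun k _ => ?_
  simp only [RCLike.star_def]
  ring

/-- Finite Gram matrices are `(1 - β) + (β - B)`, a positive definite plus a positive semidefinite
matrix. -/
theorem linearIndependent_of_gram_sub {V : Type*} [NormedAddCommGroup V] [InnerProductSpace ℂ V]
    (h : ℕ → V) {B : Matrix ℕ ℕ ℂ} (hh : ∀ i j, ⟪h i, h j⟫_ℂ = (1 - B) i j) {β : ℝ} (hβ : β < 1)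
    (hB : ∀ N, ((β : ℂ) • 1 - corner B N).PosSemidef) : LinearIndependent ℂ h := by
  rw [linearIndependent_iff_finset_linearIndependent]
  intro s
  refine linearIndependent_of_posDef_gram ?_
  let e : s → Fin (s.sup id + 1) := fun i =>
    ⟨i, Nat.lt_succ_of_le (Finset.le_sup (f := id) i.2)⟩
  have h1 := (hB (s.sup id + 1)).submatrix e
  have h2 : gram ℂ (h ∘ (Subtype.val : s → ℕ)) = ((1 - β : ℝ) : ℂ) • (1 : Matrix s s ℂ) +
      ((β : ℂ) • 1 - corner B (s.sup id + 1)).submatrix e e := by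
    ext i j
    simp only [gram_apply, Function.comp_apply, hh, Matrix.sub_apply, Matrix.add_apply,
      Matrix.smul_apply, submatrix_apply, corner, Matrix.one_apply, e, Fin.mk.injEq, smul_eq_mul,
      Subtype.ext_iff]
    push_cast
    ring
  rw [h2]
  refine (PosDef.one.smul ?_).add_posSemidef h1
  exact_mod_cast sub_pos.2 hβ

end Triangular

end Beam

namespace Beam

/-! ### The Fermionic expansion -/

section Fermi

open Matrix
open scoped ComplexOrder

variable {Y : Type*} [MeasurableSpace Y] {ν : Measure Y} {κ : Y → Matrix ℕ ℕ ℂ}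

theorem IsMatrixDensity.triangularConj (hκ : IsMatrixDensity ν κ) {a : ℕ → ℕ → ℂ}
    (ha : ∀ n j, n < j → a n j = 0) : IsMatrixDensity ν fun y => triangularConj a (κ y) where
  measurable m n := by
    simp only [Beam.triangularConj, of_apply]
    exact Finset.measurable_fun_sum _ fun j _ => Finset.measurable_fun_sum _ fun k _ =>
      ((hκ.measurable j k).const_mul _).mul_const _
  integrable m n := by
    simp only [Beam.triangularConj, of_apply]
    exact integrable_finsetSum _ fun j _ => integrable_finsetSum _ fun k _ =>
      ((hκ.integrable j k).const_mul _).mul_const _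
  posSemidef y N := by
    rw [corner_triangularConj ha]
    exact (hκ.posSemidef y N).conjTranspose_mul_mul_same _

theorem IsMatrixDensity.integralMatrix_triangularConj (hκ : IsMatrixDensity ν κ) (a : ℕ → ℕ → ℂ)
    {z : Y → ℂ} (hz : Measurable z) {r : ℝ} (hr : ∀ y, ‖z y‖ ≤ r) :
    integralMatrix ν (fun y => Beam.triangularConj a (κ y)) z =
      Beam.triangularConj a (integralMatrix ν κ z) := by
  ext m n
  simp only [integralMatrix, Beam.triangularConj, of_apply, Finset.mul_sum]
  have hi : ∀ j k, Integrable (fun y => z y * (star (a m j) * κ y j k * a n k)) ν := by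
    intro j k
    refine (((hκ.integrable_mul hz hr j k).const_mul (star (a m j))).mul_const (a n k)).congr
      (Eventually.of_forall fun y => ?_)
    simp only
    ring
  rw [integral_finsetSum _ fun j _ => integrable_finsetSum _ fun k _ => hi j k]
  refine Finset.sum_congr rfl fun j _ => ?_
  rw [integral_finsetSum _ fun k _ => hi j k]
  refine Finset.sum_congr rfl fun k _ => ?_
  rw [← integral_const_mul, ← integral_mul_const]
  congr 1
  ext y
  ring

variable [IsFiniteMeasure ν]

theorem IsMatrixDensity.ofReal_re_minor_one (hκ : IsMatrixDensity ν κ) (S : Finset ℕ) :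
    ((minor (integralMatrix ν κ fun _ => 1) S).re : ℂ) =
      minor (integralMatrix ν κ fun _ => 1) S := by
  rw [← (hκ.integrable_prod_mul_sectorDensity (z := fun _ => 1) measurable_const
    (r := 1) (by simp) S).2]
  simp only [Finset.prod_const_one, one_mul]
  rw [← integral_congr_ae (Eventually.of_forall (hκ.ofReal_re_sectorDensity S)),
    integral_complex_ofReal, Complex.ofReal_re]

theorem corner_one_sub (A : Matrix ℕ ℕ ℂ) (N : ℕ) : corner (1 - A) N = 1 - corner A N := by
  rw [corner, submatrix_sub, Pi.sub_apply, Pi.sub_apply, submatrix_one _ Fin.val_injective]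
  rfl

/-- The Fredholm determinant `det (1 + K[z - 1])` has an expansion with positive coefficients. -/
theorem IsMatrixDensity.exists_fermi_expansion (hκ : IsMatrixDensity ν κ)
    (htr : Summable fun i => (integralMatrix ν κ (fun _ => 1) i i).re) {β : ℝ} (hβ : β < 1)
    (hB : ∀ N, ((β : ℂ) • 1 - corner (integralMatrix ν κ fun _ => 1) N).PosSemidef)
    {V : Type*} [NormedAddCommGroup V] [InnerProductSpace ℂ V] (h : ℕ → V)
    (hh : ∀ i j, ⟪h i, h j⟫_ℂ = (1 - integralMatrix ν κ fun _ => 1) i j) :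
    ∃ κ' : Y → Matrix ℕ ℕ ℂ, IsMatrixDensity ν κ' ∧
      (Summable fun S => (minor (integralMatrix ν κ' fun _ => 1) S).re) ∧
      ∃ Z : ℝ, 0 ≤ Z ∧ ∀ z : Y → ℂ, Measurable z → (∀ y, ‖z y‖ ≤ 1) →
        ∑' S, minor (integralMatrix ν κ fun y => z y - 1) S =
          Z * ∑' S, minor (integralMatrix ν κ' z) S := by
  set B := integralMatrix ν κ fun _ => 1 with hBdef
  -- The columns `a` play the part of `(1 - B)^(-1/2)`.
  obtain ⟨a, ha, haN⟩ := exists_triangular_of_gram h (linearIndependent_of_gram_sub h hh hβ hB)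
    (1 - B) hh
  have hκ' := hκ.triangularConj ha
  set κ' : Y → Matrix ℕ ℕ ℂ := fun y => Beam.triangularConj a (κ y) with hκ'def
  have hdet : ∀ N, (1 - corner B N).det *
      ((triangularCorner a N)ᴴ.det * (triangularCorner a N).det) = 1 := by
    intro N
    have h1 := congrArg Matrix.det (haN N)
    have h2 := corner_one_sub B N
    rw [det_mul, det_mul, det_one, h2] at h1
    rw [← h1]; ring
  -- `1 + K[z - 1] = (1 - B) + K[z]`, which the congruence carries to `1 + K'[z]`.
  have hfin : ∀ (z : Y → ℂ), Measurable z → (∀ y, ‖z y‖ ≤ 1) → ∀ N,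
      (1 + corner (integralMatrix ν κ fun y => z y - 1) N).det =
        (1 - corner B N).det * (1 + corner (integralMatrix ν κ' z) N).det := by
    intro z hz hz1 N
    have h2 := corner_one_sub B N
    have h3 : 1 + corner (integralMatrix ν κ' z) N = (triangularCorner a N)ᴴ *
        (1 + corner (integralMatrix ν κ fun y => z y - 1) N) * triangularCorner a N := by
      have h4 : 1 + corner (integralMatrix ν κ fun y => z y - 1) N =
          corner (1 - B) N + corner (integralMatrix ν κ z) N := by
        rw [hκ.integralMatrix_sub_one hz hz1, h2, hBdef]
        simp only [corner, submatrix_sub, Pi.sub_apply]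
        abel
      rw [h4, mul_add, add_mul, haN N, hκ'def, hκ.integralMatrix_triangularConj a hz hz1,
        corner_triangularConj ha]
    rw [h3, det_mul, det_mul]
    linear_combination (-(1 + corner (integralMatrix ν κ fun y => z y - 1) N).det) * hdet N
  have hZ : ∀ N, Real.exp (-((∑' i, (B i i).re) / (1 - β))) ≤ (1 - corner B N).det.re := by
    intro N
    refine le_trans ?_ (exp_le_det_one_sub (hκ.posSemidef_integralMatrix_one N) hβ (hB N))
    have := hκ.trace_corner_re_le htr N
    have hd : 0 < 1 - β := by linarith
    gcongr
  -- At `z = 1` the left side of `hfin` is `det 1`, so the sums of minors of `K'` are the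
  -- reciprocals of `det(1 - B)` of the corners; `hZ` then bounds them uniformly.
  have hone : ∀ N, (1 - corner B N).det *
      ∑ S ∈ (Finset.range N).powerset, minor (integralMatrix ν κ' fun _ => 1) S = 1 := by
    intro N
    rw [← det_one_add_corner, ← hfin (fun _ => 1) measurable_const (by simp)]
    have : (integralMatrix ν κ fun _ => 1 - 1) = 0 := by
      ext i j; simp [integralMatrix]
    rw [this]
    have h0 : corner 0 N = 0 := rfl
    rw [h0, add_zero, det_one]
  have hreal := hκ'.ofReal_re_minor_one
  have hone' : ∀ N, (1 - corner B N).det.re *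
      ∑ S ∈ (Finset.range N).powerset, (minor (integralMatrix ν κ' fun _ => 1) S).re = 1 := by
    intro N
    have h1 := hone N
    rw [← Finset.sum_congr rfl fun S _ => hreal S, ← Complex.ofReal_sum] at h1
    have h2 := congrArg Complex.re h1
    rwa [Complex.re_mul_ofReal] at h2
  have hsum : Summable fun S => (minor (integralMatrix ν κ' fun _ => 1) S).re := by
    refine summable_of_sum_powerset_le hκ'.minor_integralMatrix_one_nonneg
      (c := (Real.exp (-((∑' i, (B i i).re) / (1 - β))))⁻¹) fun N => ?_
    have h1 := hone' N
    have h2 := hZ N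
    have h3 := Real.exp_pos (-((∑' i, (B i i).re) / (1 - β)))
    have h4 : ∑ S ∈ (Finset.range N).powerset, (minor (integralMatrix ν κ' fun _ => 1) S).re =
        ((1 - corner B N).det.re)⁻¹ := eq_inv_of_mul_eq_one_right h1
    rw [h4]
    gcongr
  have hsumz : ∀ z : Y → ℂ, Measurable z → (∀ y, ‖z y‖ ≤ 1) →
      Summable (minor (integralMatrix ν κ' z)) := fun z hz hz1 =>
    hsum.of_norm_bounded fun S => by
      simpa using hκ'.norm_minor_integralMatrix_le hz hz1 S
  have hlim1 := tendsto_sum_powerset_range (hsumz (fun _ => 1) measurable_const (by simp))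
  set c₁ := ∑' S, minor (integralMatrix ν κ' fun _ => 1) S with hc
  have hcre : c₁ = ((∑' S, (minor (integralMatrix ν κ' fun _ => 1) S).re : ℝ) : ℂ) := by
    rw [hc, Complex.ofReal_tsum]
    simp_rw [hreal]
  have hpos : 0 < ∑' S, (minor (integralMatrix ν κ' fun _ => 1) S).re := by
    refine lt_of_lt_of_le ?_ (hsum.le_tsum ∅ fun S _ => hκ'.minor_integralMatrix_one_nonneg S)
    rw [minor, det_isEmpty]
    norm_num
  have hc0 : c₁ ≠ 0 := by
    rw [hcre]
    exact_mod_cast hpos.ne'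
  have hZlim : Tendsto (fun N => (1 - corner B N).det) atTop (𝓝 c₁⁻¹) := by
    refine (hlim1.inv₀ hc0).congr fun N => ?_
    exact (eq_inv_of_mul_eq_one_left (hone N)).symm
  refine ⟨κ', hκ', hsum, (∑' S, (minor (integralMatrix ν κ' fun _ => 1) S).re)⁻¹,
    inv_nonneg.2 hpos.le, fun z hz hz1 => ?_⟩
  have hzs : ∀ y, ‖z y - 1‖ ≤ 2 := fun y => by
    refine (norm_sub_le _ _).trans ?_
    rw [norm_one]
    linarith [hz1 y]
  refine tendsto_nhds_unique (tendsto_det_one_add_corner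
    (hκ.summable_minor htr (hz.sub_const 1) hzs)) ?_
  simp_rw [hfin z hz hz1]
  rw [Complex.ofReal_inv, ← hcre]
  exact hZlim.mul (tendsto_det_one_add_corner (hsumz z hz hz1))

end Fermi

end Beam

namespace Beam

/-! ### Point processes and their characteristic functions -/

section PointProcess

variable {Y : Type*} [MeasurableSpace Y]

/-- The Bochner integral is zero by default where `f` is not integrable, so it is glued along the
measurable set of those `ξ` for which `f` is integrable. -/
theorem measurable_integral_measure {f : Y → ℝ} (hf : Measurable f) :
    Measurable fun ξ : Measure Y => ∫ y, f y ∂ξ := by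
  have hi : MeasurableSet {ξ : Measure Y | Integrable f ξ} := by
    have : {ξ : Measure Y | Integrable f ξ} = {ξ | ∫⁻ y, ‖f y‖ₑ ∂ξ < ∞} := by
      ext ξ
      exact ⟨fun h => h.2, fun h => ⟨hf.aestronglyMeasurable, h⟩⟩
    rw [this]
    exact measurableSet_lt (Measure.measurable_lintegral hf.enorm) measurable_const
  classical
  have he : (fun ξ : Measure Y => ∫ y, f y ∂ξ) = {ξ : Measure Y | Integrable f ξ}.piecewise
      (fun ξ => (∫⁻ y, ENNReal.ofReal (f y) ∂ξ).toReal -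
        (∫⁻ y, ENNReal.ofReal (-f y) ∂ξ).toReal) 0 := by
    ext ξ
    by_cases h : Integrable f ξ
    · rw [Set.piecewise_eq_of_mem _ _ _ (show ξ ∈ {ξ : Measure Y | Integrable f ξ} from h),
        integral_eq_lintegral_pos_part_sub_lintegral_neg_part h]
    · rw [Set.piecewise_eq_of_notMem _ _ _
        (show ξ ∉ {ξ : Measure Y | Integrable f ξ} from h), integral_undef h, Pi.zero_apply]
  rw [he]
  exact Measurable.piecewise hi
    ((Measure.measurable_lintegral hf.ennreal_ofReal).ennreal_toReal.sub
      (Measure.measurable_lintegral hf.neg.ennreal_ofReal).ennreal_toReal) measurable_zero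

theorem integral_empirical {f : Y → ℝ} (hf : Measurable f) (ω : Σ n : ℕ, Fin n → Y) :
    ∫ y, f y ∂(empirical ω) = ∑ i, f (ω.2 i) := by
  rw [empirical, integral_finsetSum_measure]
  · exact Finset.sum_congr rfl fun i _ => integral_dirac' _ _ hf.stronglyMeasurable
  · exact fun i _ => integrable_dirac' hf.stronglyMeasurable (by simp)

theorem measurable_exp_integral_measure {f : Y → ℝ} (hf : Measurable f) :
    Measurable fun ξ : Measure Y => Complex.exp (Complex.I * ((∫ y, f y ∂ξ : ℝ) : ℂ)) :=
  Complex.measurable_exp.comp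
    ((Complex.measurable_ofReal.comp (measurable_integral_measure hf)).const_mul _)

theorem norm_exp_I_mul (x : ℝ) : ‖Complex.exp (Complex.I * x)‖ = 1 := by
  rw [mul_comm, Complex.norm_exp_ofReal_mul_I]

theorem measurableSet_forall_mem {Y₀ : Set Y} (hY₀ : MeasurableSet Y₀) :
    MeasurableSet {ω : Σ n : ℕ, Fin n → Y | ∀ i, ω.2 i ∈ Y₀} := by
  refine MeasurableSpace.measurableSet_iInf.2 fun n => ?_
  change MeasurableSet {y : Fin n → Y | ∀ i, y i ∈ Y₀}
  simp only [Set.ofPred_forall]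
  exact MeasurableSet.iInter fun i => measurable_pi_apply i hY₀

theorem measurable_sigma_mk (n : ℕ) :
    Measurable (fun y => ⟨n, y⟩ : (Fin n → Y) → Σ n : ℕ, Fin n → Y) := fun _ hB =>
  MeasurableSpace.measurableSet_iInf.1 hB n

/-- A summable family of distributions of finite configurations defines a point process. -/
theorem exists_isPointProcessIn {I : Type*} [Countable I] (n : I → ℕ)
    (μ : ∀ i, Measure (Fin (n i) → Y)) {Y₀ : Set Y} (hY₀ : MeasurableSet Y₀)
    (hμ : ∀ i, ∀ᵐ y ∂μ i, ∀ k, y k ∈ Y₀) (hsum : ∑' i, μ i Set.univ = 1) :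
    ∃ P, IsPointProcessIn Y₀ P ∧ ∀ f : Y → ℝ, Measurable f →
      HasSum (fun i => ∫ y, ∏ k, Complex.exp (Complex.I * f (y k)) ∂μ i)
        (characteristicFunction P f) := by
  -- A mixture: the component `i` places lists of length `n i` with distribution `μ i`, and
  -- different `i` may share a length.
  set Q : Measure (Σ n : ℕ, Fin n → Y) :=
    Measure.sum fun i => (μ i).map fun y => ⟨n i, y⟩ with hQ
  have hQ1 : IsProbabilityMeasure Q := by
    constructor
    rw [hQ, Measure.sum_apply _ MeasurableSet.univ, ← hsum]
    refine tsum_congr fun i => ?_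
    rw [Measure.map_apply (measurable_sigma_mk _) MeasurableSet.univ, Set.preimage_univ]
  refine ⟨Q.map empirical, ⟨Q, hQ1, ?_, rfl⟩, fun f hf => ?_⟩
  · rw [hQ, Measure.ae_sum_iff' (measurableSet_forall_mem hY₀)]
    intro i
    rw [ae_map_iff (measurable_sigma_mk _).aemeasurable (measurableSet_forall_mem hY₀)]
    exact hμ i
  · have hm := measurable_exp_integral_measure hf
    rw [characteristicFunction, integral_map measurable_empirical.aemeasurable
      hm.aestronglyMeasurable]
    have hint : Integrable (fun ω => Complex.exp
        (Complex.I * ((∫ y, f y ∂(empirical ω) : ℝ) : ℂ))) Q :=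
      Integrable.of_bound (hm.comp measurable_empirical).aestronglyMeasurable 1
        (Eventually.of_forall fun ω => (norm_exp_I_mul _).le)
    have he : ∀ i, ∫ ω, Complex.exp (Complex.I * ((∫ y, f y ∂(empirical ω) : ℝ) : ℂ))
        ∂((μ i).map fun y => (⟨n i, y⟩ : Σ n : ℕ, Fin n → Y)) =
        ∫ y, ∏ k, Complex.exp (Complex.I * f (y k)) ∂μ i := by
      intro i
      refine (integral_map (measurable_sigma_mk _).aemeasurable
        (hm.comp measurable_empirical).aestronglyMeasurable).trans ?_
      refine integral_congr_ae (Eventually.of_forall fun y => ?_)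
      simp only [Function.comp_apply, integral_empirical hf]
      rw [Complex.ofReal_sum, Finset.mul_sum, Complex.exp_sum]
    have h := hasSum_integral_measure hint
    rw [funext he] at h
    exact h

theorem IsPointProcessIn.isProbabilityMeasure {Y₀ : Set Y} {P : Measure (Measure Y)}
    (hP : IsPointProcessIn Y₀ P) : IsProbabilityMeasure P := by
  obtain ⟨Q, hQ, -, rfl⟩ := hP
  exact Measure.isProbabilityMeasure_map measurable_empirical.aemeasurable

theorem empirical_toReal (ω : Σ n : ℕ, Fin n → Y) {A : Set Y} (hA : MeasurableSet A) :
    (empirical ω A).toReal = ∑ i, A.indicator 1 (ω.2 i) := by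
  rw [empirical, Measure.finsetSum_apply, ENNReal.toReal_sum]
  · refine Finset.sum_congr rfl fun i _ => ?_
    rw [Measure.dirac_apply' _ hA]
    by_cases h : ω.2 i ∈ A <;> simp [h]
  · intro i _
    exact measure_ne_top _ _

/-- The joint law of the numbers of points in finitely many sets. -/
noncomputable def countVector (t : Finset (Set Y)) (ξ : Measure Y) : EuclideanSpace ℝ t :=
  WithLp.toLp 2 fun A => (ξ (A : Set Y)).toReal

theorem measurable_countVector {t : Finset (Set Y)} (ht : ∀ A ∈ t, MeasurableSet A) :
    Measurable (countVector t) := by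
  refine (PiLp.continuous_toLp 2 _).measurable.comp (measurable_pi_lambda _ fun A => ?_)
  exact (Measure.measurable_coe (ht A A.2)).ennreal_toReal

/-- Cutting the indicators down to `Y₀` changes nothing almost surely, and yields a test function
vanishing off `Y₀`. -/
theorem IsPointProcessIn.charFun_countVector {Y₀ : Set Y} (hY₀ : MeasurableSet Y₀)
    {P : Measure (Measure Y)} (hP : IsPointProcessIn Y₀ P) {t : Finset (Set Y)}
    (ht : ∀ A ∈ t, MeasurableSet A) (θ : EuclideanSpace ℝ t) :
    charFun (P.map (countVector t)) θ = characteristicFunction P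
      (fun y => ∑ A : t, θ A * (Y₀ ∩ A).indicator 1 y) := by
  have hf : Measurable fun y => ∑ A : t, θ A * (Y₀ ∩ A).indicator (1 : Y → ℝ) y :=
    Finset.measurable_fun_sum _ fun A _ =>
      (measurable_one.indicator (hY₀.inter (ht A A.2))).const_mul _
  rw [charFun_apply, integral_map (measurable_countVector ht).aemeasurable
    (Continuous.aestronglyMeasurable (by fun_prop)), characteristicFunction]
  obtain ⟨Q, hQ, hQ0, rfl⟩ := hP
  rw [integral_map measurable_empirical.aemeasurable, integral_map measurable_empirical.aemeasurable
    (measurable_exp_integral_measure hf).aestronglyMeasurable]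
  · refine integral_congr_ae ?_
    filter_upwards [hQ0] with ω hω
    have he : ⟪countVector t (empirical ω), θ⟫_ℝ = ∫ y, ∑ A : t, θ A *
        (Y₀ ∩ A).indicator (1 : Y → ℝ) y ∂(empirical ω) := by
      rw [integral_empirical hf, PiLp.inner_apply, Finset.sum_comm]
      refine Finset.sum_congr rfl fun A _ => ?_
      rw [← Finset.mul_sum, countVector]
      simp only [RCLike.inner_apply, conj_trivial]
      rw [empirical_toReal ω (ht A A.2)]
      congr 1
      refine Finset.sum_congr rfl fun i _ => ?_
      by_cases h : ω.2 i ∈ (A : Set Y) <;> simp [h, hω i]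
    rw [he, mul_comm]
  · refine Measurable.aestronglyMeasurable ?_
    exact (Continuous.measurable (by fun_prop : Continuous fun x : EuclideanSpace ℝ t =>
      Complex.exp ((⟪x, θ⟫_ℝ : ℂ) * Complex.I))).comp (measurable_countVector ht)

theorem IsPointProcessIn.ae_ne_top {Y₀ : Set Y} {P : Measure (Measure Y)}
    (hP : IsPointProcessIn Y₀ P) {A : Set Y} (hA : MeasurableSet A) : ∀ᵐ ξ ∂P, ξ A ≠ ∞ := by
  obtain ⟨Q, hQ, hQ0, rfl⟩ := hP
  rw [ae_map_iff measurable_empirical.aemeasurable]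
  · refine Eventually.of_forall fun ω => ?_
    rw [empirical, Measure.finsetSum_apply]
    exact ENNReal.sum_ne_top.2 fun i _ => measure_ne_top _ _
  · exact (Measure.measurable_coe hA (measurableSet_singleton ∞)).compl

/-- A point process is determined by its characteristic function. -/
theorem IsPointProcessIn.ext {Y₀ : Set Y} (hY₀ : MeasurableSet Y₀) {P P' : Measure (Measure Y)}
    (hP : IsPointProcessIn Y₀ P) (hP' : IsPointProcessIn Y₀ P')
    (h : ∀ f : Y → ℝ, Measurable f → (∀ y ∉ Y₀, f y = 0) →
      characteristicFunction P f = characteristicFunction P' f) : P = P' := by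
  have := hP.isProbabilityMeasure
  have := hP'.isProbabilityMeasure
  -- The evaluations on measurable sets generate the σ-algebra, so finite intersections of events
  -- about single counts form a generating π-system.
  refine ext_of_generate_finite _
    (generateFrom_piiUnionInter_measurableSet
      (fun A : Set Y => (borel ℝ≥0∞).comap fun ξ : Measure Y => ξ A)
      {A | MeasurableSet A}).symm
    (isPiSystem_piiUnionInter _ (fun A => @MeasurableSpace.isPiSystem_measurableSet _ (_)) _) ?_ (by simp)
  rintro _ ⟨t, ht, g, hg, rfl⟩
  replace ht : ∀ A ∈ t, MeasurableSet A := fun A hA => ht hA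
  choose! B hBm hB using hg
  have hmap : P.map (countVector t) = P'.map (countVector t) := by
    have := Measure.isProbabilityMeasure_map (μ := P) (measurable_countVector ht).aemeasurable
    have := Measure.isProbabilityMeasure_map (μ := P') (measurable_countVector ht).aemeasurable
    refine Measure.ext_of_charFun (funext fun θ => ?_)
    rw [hP.charFun_countVector hY₀ ht, hP'.charFun_countVector hY₀ ht]
    refine h _ ?_ fun y hy => ?_
    · exact Finset.measurable_fun_sum _ fun A _ =>
        (measurable_one.indicator (hY₀.inter (ht A A.2))).const_mul _
    · simp [hy]
  -- The counts are recorded as real numbers; `ENNReal.ofReal` recovers them almost surely because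
  -- the configurations are finite.
  set E : Set (EuclideanSpace ℝ t) := {x | ∀ A : t, ENNReal.ofReal (x A) ∈ B A} with hE
  have hEm : MeasurableSet E := by
    simp only [hE, Set.ofPred_forall]
    refine MeasurableSet.iInter fun A => ?_
    refine measurableSet_preimage (t := B A) (ENNReal.measurable_ofReal.comp
      (Continuous.measurable (by fun_prop : Continuous fun x : EuclideanSpace ℝ t => x A))) ?_
    exact hBm A A.2
  have key : ∀ R : Measure (Measure Y), IsPointProcessIn Y₀ R →
      R (⋂ A ∈ t, g A) = R.map (countVector t) E := by
    intro R hR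
    rw [Measure.map_apply (measurable_countVector ht) hEm]
    refine measure_congr ?_
    have hfin : ∀ᵐ ξ ∂(R), ∀ A ∈ t, ξ A ≠ ∞ :=
      (Finset.eventually_all t).2 fun A hA => hR.ae_ne_top (ht A hA)
    filter_upwards [hfin] with ξ hξ
    refine propext ?_
    change ξ ∈ (⋂ A ∈ t, g A) ↔ countVector t ξ ∈ E
    simp only [Set.mem_iInter, hE, Set.mem_ofPred_eq, countVector, Subtype.forall]
    refine forall₂_congr fun A hA => ?_
    rw [ENNReal.ofReal_toReal (hξ A hA), ← hB A hA]
    rfl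
  rw [key P hP, key P' hP', hmap]

end PointProcess

end Beam

namespace Beam

/-! ### Permanents and the reciprocal of a determinant -/

section Permanents

open Matrix PowerSeries

variable {ι : Type*} [Fintype ι] [DecidableEq ι]

theorem derivation_prod {R S κ : Type*} [CommRing R] [CommRing S] [Algebra R S] [DecidableEq κ]
    (D : Derivation R S S) (s : Finset κ) (f : κ → S) :
    D (∏ i ∈ s, f i) = ∑ i ∈ s, (∏ j ∈ s.erase i, f j) * D (f i) := by
  induction s using Finset.induction_on with
  | empty => simp
  | insert a s ha ih =>
    rw [Finset.prod_insert ha, Derivation.leibniz, ih, Finset.sum_insert ha,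
      Finset.erase_insert ha, smul_eq_mul, smul_eq_mul, Finset.mul_sum, add_comm]
    congr 1
    refine Finset.sum_congr rfl fun i hi => ?_
    have : a ≠ i := fun h => ha (h ▸ hi)
    rw [Finset.erase_insert_of_ne this, Finset.prod_insert (by simp [ha]), mul_assoc]

/-- Jacobi's formula for the derivative of a determinant. -/
theorem derivation_det {R S : Type*} [CommRing R] [CommRing S] [Algebra R S]
    (D : Derivation R S S) (A : Matrix ι ι S) :
    D A.det = (A.adjugate * A.map D).trace := by
  have h1 : ∀ j, (A.adjugate * A.map D) j j = (A.updateCol j fun i => D (A i j)).det := by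
    intro j
    rw [← cramer_apply, cramer_eq_adjugate_mulVec]
    rfl
  rw [trace]
  simp only [diag_apply, h1, det_apply]
  rw [map_sum, Finset.sum_comm]
  refine Finset.sum_congr rfl fun σ _ => ?_
  rw [← Finset.smul_sum, Units.smul_def, Units.smul_def, map_zsmul]
  congr 1
  rw [derivation_prod]
  refine Finset.sum_congr rfl fun j _ => ?_
  rw [← Finset.mul_prod_erase _ _ (Finset.mem_univ j), mul_comm]
  congr 1
  · simp
  · refine Finset.prod_congr rfl fun k hk => ?_
    rw [updateCol_ne (Finset.ne_of_mem_erase hk)]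

/-- The permanent of the matrix with rows and columns repeated according to `i`, divided by the
number of permutations. -/
noncomputable def permTerm {ι : Type*} (A : Matrix ι ι ℂ) {n : ℕ} (i : Fin n → ι) : ℂ :=
  (∑ π : Equiv.Perm (Fin n), ∏ k, A (i k) (i (π k))) / (n.factorial : ℂ)

/-- Like `permTerm`, with an extra row `a` and an extra column `b`. -/
noncomputable def openTerm {ι : Type*} (A : Matrix ι ι ℂ) {n : ℕ} (a b : ι) (i : Fin n → ι) : ℂ :=
  (∑ π : Equiv.Perm (Fin (n + 1)), ∏ k, A (Fin.cons (α := fun _ => ι) a i k)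
    (Fin.cons (α := fun _ => ι) b i (π k))) / (n.factorial : ℂ)

omit [Fintype ι] [DecidableEq ι] in
theorem sum_perm_prod_comp {n : ℕ} (A : Matrix ι ι ℂ) (u v : Fin n → ι)
    (τ : Equiv.Perm (Fin n)) :
    ∑ π : Equiv.Perm (Fin n), ∏ k, A (u k) (v (π k)) =
      ∑ π : Equiv.Perm (Fin n), ∏ k, A (u (τ k)) (v (τ (π k))) := by
  rw [← Equiv.sum_comp (MulAut.conj τ).toEquiv]
  refine Finset.sum_congr rfl fun π _ => ?_
  rw [← Equiv.prod_comp τ]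
  simp

omit [DecidableEq ι] in
theorem sum_openTerm_zero (A : Matrix ι ι ℂ) (a b : ι) :
    ∑ i : Fin 0 → ι, openTerm A a b i = A a b * ∑ i : Fin 0 → ι, permTerm A i := by
  simp [openTerm, permTerm, Finset.univ_unique]

omit [DecidableEq ι] in
theorem sum_permTerm_succ (A : Matrix ι ι ℂ) (n : ℕ) :
    (n + 1 : ℂ) * ∑ i : Fin (n + 1) → ι, permTerm A i =
      ∑ a, ∑ i : Fin n → ι, openTerm A a a i := by
  rw [← Equiv.sum_comp (Fin.consEquiv fun _ => ι), Fintype.sum_prod_type, Finset.mul_sum]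
  refine Finset.sum_congr rfl fun a _ => ?_
  rw [Finset.mul_sum]
  refine Finset.sum_congr rfl fun i _ => ?_
  have h1 : (n.factorial : ℂ) ≠ 0 := by exact_mod_cast n.factorial_ne_zero
  have h2 : (n + 1 : ℂ) ≠ 0 := by exact_mod_cast n.succ_ne_zero
  simp only [permTerm, openTerm, Fin.consEquiv, Equiv.coe_fn_mk, Nat.factorial_succ]
  push_cast
  field_simp

omit [DecidableEq ι] in
theorem sum_openTerm_succ (A : Matrix ι ι ℂ) (a b : ι) (n : ℕ) :
    ∑ i : Fin (n + 1) → ι, openTerm A a b i =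
      A a b * ∑ i : Fin (n + 1) → ι, permTerm A i +
        ∑ c, A a c * ∑ i : Fin n → ι, openTerm A c b i := by
  have h1 : (n.factorial : ℂ) ≠ 0 := by exact_mod_cast n.factorial_ne_zero
  have h2 : (n + 1 : ℂ) ≠ 0 := by exact_mod_cast n.succ_ne_zero
  have key : ∀ i : Fin (n + 1) → ι, ∑ π : Equiv.Perm (Fin (n + 1 + 1)),
      ∏ k, A (Fin.cons (α := fun _ => ι) a i k) (Fin.cons (α := fun _ => ι) b i (π k)) =
      A a b * (∑ π : Equiv.Perm (Fin (n + 1)), ∏ k, A (i k) (i (π k))) +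
        ∑ j, A a (i j) * ∑ π : Equiv.Perm (Fin (n + 1)), ∏ k, A (i k)
          (Function.update i j b (π k)) := by
    intro i
    -- Permutations are sorted by the image of `0`. If `0` is fixed, the entry `A a b` splits off.
    -- Otherwise row `a` meets the column `i j`, and the column `b` takes the place of `i j` in the
    -- remaining permanent.
    rw [← Equiv.sum_comp Equiv.Perm.decomposeFin.symm, Fintype.sum_prod_type, Fin.sum_univ_succ]
    congr 1
    · rw [Finset.mul_sum]
      refine Finset.sum_congr rfl fun e _ => ?_
      rw [Fin.prod_univ_succ]
      simp
    · refine Finset.sum_congr rfl fun j _ => ?_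
      rw [Finset.mul_sum]
      refine Finset.sum_congr rfl fun e _ => ?_
      rw [Fin.prod_univ_succ]
      simp only [Equiv.Perm.decomposeFin_symm_apply_zero, Fin.cons_zero, Fin.cons_succ,
        Equiv.Perm.decomposeFin_symm_apply_succ]
      congr 1
      refine Finset.prod_congr rfl fun x _ => ?_
      congr 1
      by_cases hx : e x = j
      · rw [hx, Equiv.swap_apply_right, Fin.cons_zero, Function.update_self]
      · rw [Equiv.swap_apply_of_ne_of_ne (Fin.succ_ne_zero _) (by simpa using hx), Fin.cons_succ,
          Function.update_of_ne hx]
  -- Summing over `i j = c` separately, and moving the row `j` to the front by a cycle, gives an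
  -- open term from `c` to `b`. It does not depend on `j`, whence the factor `n + 1` below.
  have hj : ∀ j : Fin (n + 1), ∑ i : Fin (n + 1) → ι, A a (i j) *
      ∑ π : Equiv.Perm (Fin (n + 1)), ∏ k, A (i k) (Function.update i j b (π k)) =
      (n.factorial : ℂ) * ∑ c, A a c * ∑ i : Fin n → ι, openTerm A c b i := by
    intro j
    rw [← Equiv.sum_comp (Fin.insertNthEquiv (fun _ => ι) j), Fintype.sum_prod_type,
      Finset.mul_sum]
    refine Finset.sum_congr rfl fun c _ => ?_
    rw [Finset.mul_sum, Finset.mul_sum]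
    refine Finset.sum_congr rfl fun i _ => ?_
    simp only [Fin.insertNthEquiv, Equiv.coe_fn_mk, Fin.insertNth_apply_same,
      Fin.update_insertNth]
    rw [sum_perm_prod_comp _ _ _ j.cycleRange.symm, openTerm]
    simp only [Fin.insertNth_apply_cycleRange_symm]
    field_simp
  have hsum : ∑ i : Fin (n + 1) → ι, ∑ j, A a (i j) *
      ∑ π : Equiv.Perm (Fin (n + 1)), ∏ k, A (i k) (Function.update i j b (π k)) =
      (n + 1) * ((n.factorial : ℂ) * ∑ c, A a c * ∑ i : Fin n → ι, openTerm A c b i) := by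
    rw [Finset.sum_comm, Finset.sum_congr rfl fun j _ => hj j]
    simp
  have hl : ∀ i : Fin (n + 1) → ι, openTerm A a b i = A a b * permTerm A i +
      (∑ j, A a (i j) * ∑ π : Equiv.Perm (Fin (n + 1)), ∏ k, A (i k)
          (Function.update i j b (π k))) / ((n + 1).factorial : ℂ) := by
    intro i
    rw [openTerm, key, permTerm, add_div, mul_div_assoc]
  rw [Finset.sum_congr rfl fun i _ => hl i, Finset.sum_add_distrib, ← Finset.mul_sum,
    ← Finset.sum_div, hsum, Nat.factorial_succ]
  push_cast
  field_simp

/-- The power series `∑ₙ Xⁿ ∑ᵢ permTerm A i`. -/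
noncomputable def permSeries (A : Matrix ι ι ℂ) : ℂ⟦X⟧ :=
  PowerSeries.mk fun n => ∑ i : Fin n → ι, permTerm A i

/-- The matrix `1 - X A` of power series. -/
noncomputable def oneSubX (A : Matrix ι ι ℂ) : Matrix ι ι ℂ⟦X⟧ :=
  1 - (X : ℂ⟦X⟧) • A.map (C : ℂ →+* ℂ⟦X⟧)

/-- MacMahon's master theorem. -/
theorem det_oneSubX_mul_permSeries (A : Matrix ι ι ℂ) :
    (oneSubX A).det * permSeries A = 1 := by
  -- The series `q = permSeries A` is coupled to the matrix `M` of permanents with one open row and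
  -- column: `(1 - XA) M = q A` and `q' = tr M`. Jacobi's formula gives `det(1 - XA)' = -tr(adj(1 -
  -- XA) A)`. The product `det(1 - XA) q` therefore has derivative zero, and its constant term is
  -- one.
  set M : Matrix ι ι ℂ⟦X⟧ := Matrix.of fun a b =>
    PowerSeries.mk fun n => ∑ i : Fin n → ι, openTerm A a b i with hM
  have hrec : oneSubX A * M = permSeries A • A.map (C : ℂ →+* ℂ⟦X⟧) := by
    rw [oneSubX, sub_mul, one_mul, sub_eq_iff_eq_add]
    ext a b n
    simp only [hM, of_apply, coeff_mk, Matrix.add_apply, Matrix.smul_apply, smul_eq_mul,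
      Matrix.mul_apply, Matrix.map_apply, map_add, permSeries, coeff_mul_C]
    rcases n with _ | n
    · rw [sum_openTerm_zero]
      simp [mul_comm]
    · rw [sum_openTerm_succ]
      simp only [map_sum, mul_assoc, coeff_succ_X_mul, coeff_C_mul, coeff_mk]
      ring
  have hq : derivative ℂ (permSeries A) = M.trace := by
    ext n
    rw [coeff_derivative, trace, map_sum]
    simp only [hM, diag_apply, of_apply, coeff_mk, permSeries]
    rw [mul_comm, sum_permTerm_succ]
  have hE : derivative ℂ (oneSubX A).det =
      -((oneSubX A).adjugate * A.map (C : ℂ →+* ℂ⟦X⟧)).trace := by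
    rw [derivation_det, ← trace_neg, ← mul_neg]
    congr 2
    ext a b : 2
    simp only [oneSubX, map_apply, Matrix.sub_apply, Matrix.smul_apply, map_sub, smul_eq_mul,
      Derivation.leibniz, Matrix.neg_apply]
    by_cases hab : a = b <;> simp [hab, Matrix.one_apply]
  have hder : derivative ℂ ((oneSubX A).det * permSeries A) = derivative ℂ 1 := by
    rw [Derivation.leibniz, hq, hE, Derivation.map_one_eq_zero]
    have h1 : (oneSubX A).det • M =
        permSeries A • ((oneSubX A).adjugate * A.map (C : ℂ →+* ℂ⟦X⟧)) := by
      rw [← Matrix.mul_smul, ← hrec, ← Matrix.mul_assoc, adjugate_mul, Matrix.smul_mul,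
        Matrix.one_mul]
    have h2 := congrArg trace h1
    rw [trace_smul, trace_smul] at h2
    rw [h2]
    simp
  refine derivative.ext hder ?_
  rw [map_mul, map_one]
  have h1 : constantCoeff (permSeries A) = 1 := by
    rw [← coeff_zero_eq_constantCoeff_apply, permSeries, coeff_mk]
    simp [permTerm, Finset.univ_unique]
  have h2 : constantCoeff (oneSubX A).det = 1 := by
    rw [RingHom.map_det]
    have : (constantCoeff (R := ℂ)).mapMatrix (oneSubX A) = 1 := by
      ext a b
      simp [oneSubX, Matrix.one_apply, apply_ite]
    rw [this, det_one]
  rw [h1, h2, one_mul]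

/-! Absolutely summable power series. -/

theorem summable_norm_coeff_mul {f g : ℂ⟦X⟧} (hf : Summable fun n => ‖coeff n f‖)
    (hg : Summable fun n => ‖coeff n g‖) : Summable fun n => ‖coeff n (f * g)‖ := by
  simp only [coeff_mul]
  exact summable_norm_sum_mul_antidiagonal_of_summable_norm (f := fun n => coeff n f)
    (g := fun n => coeff n g) hf hg

theorem tsum_coeff_mul {f g : ℂ⟦X⟧} (hf : Summable fun n => ‖coeff n f‖)
    (hg : Summable fun n => ‖coeff n g‖) :
    ∑' n, coeff n (f * g) = (∑' n, coeff n f) * ∑' n, coeff n g := by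
  simp only [coeff_mul]
  exact (tsum_mul_tsum_eq_tsum_sum_antidiagonal_of_summable_norm (f := fun n => coeff n f)
    (g := fun n => coeff n g) hf hg).symm

theorem tsum_coeff_polynomial (p : Polynomial ℂ) :
    (Summable fun n => ‖coeff n (p : ℂ⟦X⟧)‖) ∧ ∑' n, coeff n (p : ℂ⟦X⟧) = p.eval 1 := by
  have h0 : ∀ n ∉ Finset.range (p.natDegree + 1), coeff n (p : ℂ⟦X⟧) = 0 := fun n hn => by
    rw [Polynomial.coeff_coe]
    exact Polynomial.coeff_eq_zero_of_natDegree_lt (by simpa using hn)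
  constructor
  · exact summable_of_ne_finset_zero (s := Finset.range (p.natDegree + 1))
      fun n hn => by rw [h0 n hn, norm_zero]
  · rw [tsum_eq_sum h0, Polynomial.eval_eq_sum_range]
    simp

theorem det_oneSubX_eq (A : Matrix ι ι ℂ) :
    (oneSubX A).det =
      (((1 - (Polynomial.X : Polynomial ℂ) • A.map Polynomial.C).det : Polynomial ℂ) : ℂ⟦X⟧) := by
  rw [← Polynomial.coeToPowerSeries.ringHom_apply, RingHom.map_det]
  congr 1
  ext a b : 2
  simp only [oneSubX, RingHom.mapMatrix_apply, Matrix.map_apply, Matrix.sub_apply,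
    Matrix.smul_apply, smul_eq_mul, Matrix.one_apply, apply_ite, map_sub, map_mul, map_one,
    map_zero, Polynomial.coeToPowerSeries.ringHom_apply, Polynomial.coe_X, Polynomial.coe_C]

/-- The master theorem evaluated at `X = 1`: one factor is a polynomial, the other absolutely
summable, so the Cauchy product applies. -/
theorem det_one_sub_mul_tsum {A : Matrix ι ι ℂ}
    (hA : Summable fun n => ‖∑ i : Fin n → ι, permTerm A i‖) :
    (1 - A).det * ∑' n, ∑ i : Fin n → ι, permTerm A i = 1 := by
  have h := det_oneSubX_mul_permSeries A
  rw [det_oneSubX_eq] at h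
  set p := (1 - (Polynomial.X : Polynomial ℂ) • A.map Polynomial.C).det with hp
  have h1 : p.eval 1 = (1 - A).det := by
    rw [hp, ← Polynomial.coe_evalRingHom, RingHom.map_det]
    congr 1
    ext a b
    simp [Matrix.one_apply, apply_ite]
  have h2 : (fun n => coeff n (permSeries A)) = fun n => ∑ i : Fin n → ι, permTerm A i := by
    ext n
    rw [permSeries, coeff_mk]
  have h3 := tsum_coeff_mul (tsum_coeff_polynomial p).1 (g := permSeries A)
    (by simpa only [congrFun h2] using hA)
  rw [h, (tsum_coeff_polynomial p).2, h1, h2] at h3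
  rw [← h3, tsum_eq_single 0]
  · simp
  · intro n hn
    simp [coeff_one, hn]

open scoped ComplexOrder in
theorem summable_norm_sum_permTerm {A : Matrix ι ι ℂ} (hA : A.PosSemidef) (hA1 : (1 - A).PosDef) :
    Summable fun n => ‖∑ i : Fin n → ι, permTerm A i‖ := by
  set l := hA.1.eigenvalues with hl
  have hl0 : ∀ j, 0 ≤ l j := hA.eigenvalues_nonneg
  have hl1 : ∀ j, l j < 1 := by
    intro j
    have h1 := hA.1.mulVec_eigenvectorBasis j
    have hne : (hA.1.eigenvectorBasis j : EuclideanSpace ℂ ι).ofLp ≠ 0 := by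
      intro h0
      have := hA.1.eigenvectorBasis.orthonormal.ne_zero j
      exact this (by ext i; exact congrFun h0 i)
    have h2 := hA1.dotProduct_mulVec_pos hne
    rw [sub_mulVec, one_mulVec, h1, dotProduct_sub, dotProduct_smul] at h2
    have h3 : star (⇑(hA.1.eigenvectorBasis j)) ⬝ᵥ ⇑(hA.1.eigenvectorBasis j) = 1 := by
      rw [dotProduct_comm, ← EuclideanSpace.inner_eq_star_dotProduct, inner_self_eq_norm_sq_to_K,
        hA.1.eigenvectorBasis.orthonormal.1 j]
      norm_num
    rw [h3] at h2
    have h4 := (Complex.pos_iff.1 h2).1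
    simp at h4
    exact h4
  have hdet : (oneSubX A).det = ∏ j, (1 - (C (l j : ℂ)) * X) := by
    have hp : (1 - (Polynomial.X : Polynomial ℂ) • A.map Polynomial.C).det =
        ∏ j, (1 - Polynomial.C (l j : ℂ) * Polynomial.X) := by
      -- Evaluation at complex `t` reduces to matrices over `ℂ`, where the spectral theorem
      -- diagonalises `1 - tA`.
      refine Polynomial.funext fun t => ?_
      rw [← Polynomial.coe_evalRingHom, RingHom.map_det, map_prod]
      set U : Matrix ι ι ℂ := (hA.1.eigenvectorUnitary : Matrix ι ι ℂ) with hU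
      have hU1 : U * star U = 1 := Unitary.coe_mul_star_self _
      have h1 : (Polynomial.evalRingHom t).mapMatrix
          (1 - (Polynomial.X : Polynomial ℂ) • A.map Polynomial.C) =
          U * diagonal (fun j => 1 - (l j : ℂ) * t) * star U := by
        have h2 : (Polynomial.evalRingHom t).mapMatrix
          (1 - (Polynomial.X : Polynomial ℂ) • A.map Polynomial.C) = 1 - t • A := by
          ext a b
          simp [Matrix.one_apply, apply_ite, mul_comm (A a b)]
        have h3 : A = U * diagonal (fun j => (l j : ℂ)) * star U := by
          have := hA.1.spectral_theorem
          rw [Unitary.conjStarAlgAut_apply] at this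
          exact this
        have h4 : diagonal (fun j => 1 - (l j : ℂ) * t) =
            1 - t • diagonal (fun j => (l j : ℂ)) := by
          ext a b
          by_cases hab : a = b <;> simp [hab, mul_comm]
        rw [h2, h4, Matrix.mul_sub, Matrix.sub_mul, Matrix.mul_one, hU1, Matrix.mul_smul,
          Matrix.smul_mul, ← h3]
      rw [h1, det_mul, det_mul, mul_right_comm, ← det_mul, hU1, det_one, one_mul, det_diagonal]
      simp
    rw [det_oneSubX_eq, hp, ← Polynomial.coeToPowerSeries.ringHom_apply, map_prod]
    simp
  -- By uniqueness of inverses `permSeries A` is a product of geometric series; these are summable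
  -- at `X = 1` because `0 ≤ l j < 1`.
  have hinv : permSeries A = ∏ j, PowerSeries.mk fun n => (l j : ℂ) ^ n := by
    have h1 : (∏ j, (1 - (C (l j : ℂ)) * X)) * ∏ j, PowerSeries.mk (fun n => (l j : ℂ) ^ n) = 1 := by
      rw [← Finset.prod_mul_distrib]
      refine Finset.prod_eq_one fun j _ => ?_
      ext n
      rw [sub_mul, one_mul, mul_assoc, map_sub, coeff_C_mul, coeff_mk]
      rcases n with _ | n
      · simp
      · rw [coeff_succ_X_mul, coeff_mk, coeff_one, if_neg n.succ_ne_zero]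
        ring
    have h2 := det_oneSubX_mul_permSeries A
    rw [hdet] at h2
    rw [mul_comm] at h2
    exact left_inv_eq_right_inv h2 h1
  have hs : ∀ s : Finset ι, Summable fun n =>
      ‖coeff n (∏ j ∈ s, PowerSeries.mk fun n => (l j : ℂ) ^ n)‖ := by
    intro s
    induction s using Finset.induction_on with
    | empty =>
      simp only [Finset.prod_empty]
      exact_mod_cast (tsum_coeff_polynomial 1).1
    | insert j s hj ih =>
      rw [Finset.prod_insert hj]
      refine summable_norm_coeff_mul ?_ ih
      simp only [coeff_mk, norm_pow]
      refine summable_geometric_of_lt_one (norm_nonneg _) ?_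
      rw [Complex.norm_real, Real.norm_eq_abs, abs_of_nonneg (hl0 j)]
      exact hl1 j
  have h2 := hs Finset.univ
  rw [← hinv] at h2
  simpa only [permSeries, coeff_mk] using h2

end Permanents

end Beam

namespace Beam

/-! ### The Bosonic expansion -/

section Bose

open Matrix
open scoped ComplexOrder

/-- The mixed permanent of a family of matrices, with rows and columns repeated
according to `i`. -/
noncomputable def mixedPerm {n : ℕ} (B : Fin n → Matrix ℕ ℕ ℂ) (i : Fin n → ℕ) : ℂ :=
  ∑ π : Equiv.Perm (Fin n), ∑ ρ : Equiv.Perm (Fin n), ∏ k, B k (i (π k)) (i (ρ k))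

/-- As for mixed discriminants, without signs: a sum of squared absolute values of permanents. -/
theorem mixedPerm_nonneg {n : ℕ} {B : Fin n → Matrix ℕ ℕ ℂ} {i : Fin n → ℕ}
    (hB : ∀ k, ((B k).submatrix i i).PosSemidef) : 0 ≤ mixedPerm B i := by
  choose R hR using fun k => exists_conjTranspose_mul_self (hB k)
  have hR' : ∀ k a b, B k (i a) (i b) = ∑ c, star (R k c a) * R k c b := by
    intro k a b
    have := congrFun (congrFun (hR k) a) b
    rw [mul_apply] at this
    exact this
  have e : mixedPerm B i = ∑ a : Fin n → Fin n,
      star (∑ π : Equiv.Perm (Fin n), ∏ k, R k (a k) (π k)) *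
        ∑ ρ : Equiv.Perm (Fin n), ∏ k, R k (a k) (ρ k) := by
    simp_rw [mixedPerm, star_sum, Finset.sum_mul_sum]
    symm
    rw [Finset.sum_comm]
    refine Finset.sum_congr rfl fun π _ => ?_
    rw [Finset.sum_comm]
    refine Finset.sum_congr rfl fun ρ _ => ?_
    symm
    simp_rw [hR']
    rw [Finset.prod_univ_sum, Fintype.piFinset_univ]
    refine Finset.sum_congr rfl fun a _ => ?_
    rw [Finset.prod_mul_distrib, star_prod]
  rw [e]
  exact Finset.sum_nonneg fun a _ => star_mul_self_nonneg _

theorem mixedPerm_const {n : ℕ} (K : Matrix ℕ ℕ ℂ) (i : Fin n → ℕ) :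
    mixedPerm (fun _ => K) i = (n.factorial : ℂ) ^ 2 * permTerm K i := by
  have hf : (n.factorial : ℂ) ≠ 0 := by exact_mod_cast n.factorial_ne_zero
  have : ∀ π : Equiv.Perm (Fin n), ∑ ρ : Equiv.Perm (Fin n), ∏ k, K (i (π k)) (i (ρ k)) =
      ∑ ρ : Equiv.Perm (Fin n), ∏ k, K (i k) (i (ρ k)) := by
    intro π
    rw [← Equiv.sum_comp (Equiv.mulRight π)]
    refine Finset.sum_congr rfl fun ρ _ => ?_
    simp only [Equiv.coe_mulRight, Equiv.Perm.coe_mul, Function.comp_apply]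
    rw [Equiv.prod_comp π (fun k => K (i k) (i (ρ k)))]
  rw [mixedPerm, Finset.sum_congr rfl fun π _ => this π, permTerm, Finset.sum_const,
    Finset.card_univ, Fintype.card_perm, Fintype.card_fin, nsmul_eq_mul]
  field_simp

variable {Y : Type*} [MeasurableSpace Y]

/-- The density of the points in a sequence of modes. -/
noncomputable def modeDensity (κ : Y → Matrix ℕ ℕ ℂ) {n : ℕ} (i : Fin n → ℕ) (y : Fin n → Y) : ℂ :=
  mixedPerm (fun k => κ (y k)) i / (n.factorial : ℂ) ^ 2

/-- The distribution of the points in a sequence of modes. -/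
noncomputable def modeMeasure (ν : Measure Y) (κ : Y → Matrix ℕ ℕ ℂ) {n : ℕ} (i : Fin n → ℕ) :
    Measure (Fin n → Y) :=
  (Measure.pi fun _ => ν).withDensity fun y => ENNReal.ofReal (modeDensity κ i y).re

namespace IsMatrixDensity

variable {ν : Measure Y} [IsFiniteMeasure ν] {κ : Y → Matrix ℕ ℕ ℂ} (hκ : IsMatrixDensity ν κ)
include hκ

omit [IsFiniteMeasure ν] in
theorem modeDensity_nonneg {n : ℕ} (i : Fin n → ℕ) (y : Fin n → Y) : 0 ≤ modeDensity κ i y :=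
  div_nonneg (mixedPerm_nonneg fun k => hκ.posSemidef_submatrix (y k) _) (by positivity)

omit [IsFiniteMeasure ν] in
theorem ofReal_re_modeDensity {n : ℕ} (i : Fin n → ℕ) (y : Fin n → Y) :
    (((modeDensity κ i y).re : ℝ) : ℂ) = modeDensity κ i y :=
  (Complex.eq_re_of_ofReal_le (r := 0) (by simpa using hκ.modeDensity_nonneg i y)).symm

omit [IsFiniteMeasure ν] in
theorem re_modeDensity_nonneg {n : ℕ} (i : Fin n → ℕ) (y : Fin n → Y) :
    0 ≤ (modeDensity κ i y).re :=
  (Complex.nonneg_iff.1 (hκ.modeDensity_nonneg i y)).1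

omit [IsFiniteMeasure ν] in
theorem measurable_modeDensity {n : ℕ} (i : Fin n → ℕ) : Measurable (modeDensity κ i) := by
  unfold modeDensity mixedPerm
  refine Measurable.div_const ?_ _
  refine Finset.measurable_fun_sum _ fun π _ => Finset.measurable_fun_sum _ fun ρ _ => ?_
  refine Finset.measurable_fun_prod _ fun k _ => ?_
  exact (hκ.measurable _ _).comp (measurable_pi_apply k)

theorem integrable_prod_mul_modeDensity {z : Y → ℂ} (hz : Measurable z) {r : ℝ}
    (hr : ∀ y, ‖z y‖ ≤ r) {n : ℕ} (i : Fin n → ℕ) :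
    Integrable (fun y : Fin n → Y => (∏ k, z (y k)) * modeDensity κ i y)
      (Measure.pi fun _ => ν) ∧
    ∫ y, (∏ k, z (y k)) * modeDensity κ i y ∂(Measure.pi fun _ => ν) =
      permTerm (integralMatrix ν κ z) i := by
  have hf : (n.factorial : ℂ) ≠ 0 := by exact_mod_cast n.factorial_ne_zero
  have h1 : ∀ y : Fin n → Y, (∏ k, z (y k)) * modeDensity κ i y =
      (∑ π : Equiv.Perm (Fin n), ∑ ρ : Equiv.Perm (Fin n),
        ∏ k, (z (y k) * κ (y k) (i (π k)) (i (ρ k)))) / (n.factorial : ℂ) ^ 2 := by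
    intro y
    simp only [modeDensity, mixedPerm, mul_div_assoc', Finset.mul_sum, Finset.prod_mul_distrib]
  have hi : ∀ π ρ : Equiv.Perm (Fin n), Integrable
      (fun y : Fin n → Y => ∏ k, (z (y k) * κ (y k) (i (π k)) (i (ρ k))))
      (Measure.pi fun _ => ν) := fun π ρ =>
    Integrable.fintype_prod (f := fun k y => z y * κ y (i (π k)) (i (ρ k)))
      fun k => hκ.integrable_mul hz hr _ _
  simp_rw [h1]
  refine ⟨(integrable_finsetSum _ fun π _ => integrable_finsetSum _ fun ρ _ =>
    hi π ρ).div_const _, ?_⟩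
  rw [integral_div, integral_finsetSum _ fun π _ => integrable_finsetSum _ fun ρ _ => hi π ρ,
    div_eq_iff (pow_ne_zero 2 hf), mul_comm, ← mixedPerm_const, mixedPerm]
  refine Finset.sum_congr rfl fun π _ => ?_
  rw [integral_finsetSum _ fun ρ _ => hi π ρ]
  refine Finset.sum_congr rfl fun ρ _ => ?_
  rw [integral_fintype_prod_eq_prod (fun k y => z y * κ y (i (π k)) (i (ρ k)))]
  rfl

theorem integral_modeMeasure {z : Y → ℂ} (hz : Measurable z) {r : ℝ}
    (hr : ∀ y, ‖z y‖ ≤ r) {n : ℕ} (i : Fin n → ℕ) :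
    ∫ y, ∏ k, z (y k) ∂(modeMeasure ν κ i) = permTerm (integralMatrix ν κ z) i := by
  have hm : Measurable fun y => ENNReal.ofReal (modeDensity κ i y).re :=
    (Complex.measurable_re.comp (hκ.measurable_modeDensity i)).ennreal_ofReal
  rw [modeMeasure, integral_withDensity_eq_integral_toReal_smul hm
    (Eventually.of_forall fun y => ENNReal.ofReal_lt_top),
    ← (hκ.integrable_prod_mul_modeDensity hz hr i).2]
  congr 1
  ext y
  rw [ENNReal.toReal_ofReal (hκ.re_modeDensity_nonneg i y), Complex.real_smul,
    hκ.ofReal_re_modeDensity, mul_comm]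

theorem integrable_modeDensity {n : ℕ} (i : Fin n → ℕ) :
    Integrable (modeDensity κ i) (Measure.pi fun _ => ν) := by
  simpa using (hκ.integrable_prod_mul_modeDensity (z := fun _ => 1) measurable_const
    (r := 1) (by simp) i).1

theorem ofReal_integral_re_modeDensity {n : ℕ} (i : Fin n → ℕ) :
    ((∫ y, (modeDensity κ i y).re ∂(Measure.pi fun _ => ν) : ℝ) : ℂ) =
      permTerm (integralMatrix ν κ fun _ => 1) i := by
  rw [← (hκ.integrable_prod_mul_modeDensity (z := fun _ => 1) measurable_const
    (r := 1) (by simp) i).2, ← integral_complex_ofReal]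
  simp only [Finset.prod_const_one, one_mul, hκ.ofReal_re_modeDensity]

theorem integral_re_modeDensity {n : ℕ} (i : Fin n → ℕ) :
    ∫ y, (modeDensity κ i y).re ∂(Measure.pi fun _ => ν) =
      (permTerm (integralMatrix ν κ fun _ => 1) i).re := by
  rw [← hκ.ofReal_integral_re_modeDensity, Complex.ofReal_re]

theorem ofReal_re_permTerm_one {n : ℕ} (i : Fin n → ℕ) :
    ((permTerm (integralMatrix ν κ fun _ => 1) i).re : ℂ) =
      permTerm (integralMatrix ν κ fun _ => 1) i := by
  rw [← hκ.integral_re_modeDensity, hκ.ofReal_integral_re_modeDensity]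

theorem modeMeasure_univ {n : ℕ} (i : Fin n → ℕ) :
    modeMeasure ν κ i Set.univ =
      ENNReal.ofReal (permTerm (integralMatrix ν κ fun _ => 1) i).re := by
  rw [modeMeasure, withDensity_apply _ MeasurableSet.univ, Measure.restrict_univ,
    ← hκ.integral_re_modeDensity, ofReal_integral_eq_lintegral_ofReal]
  · exact (hκ.integrable_modeDensity i).re
  · exact Eventually.of_forall (hκ.re_modeDensity_nonneg i)

theorem norm_permTerm_integralMatrix_le {z : Y → ℂ} (hz : Measurable z)
    (hr : ∀ y, ‖z y‖ ≤ 1) {n : ℕ} (i : Fin n → ℕ) :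
    ‖permTerm (integralMatrix ν κ z) i‖ ≤ (permTerm (integralMatrix ν κ fun _ => 1) i).re := by
  rw [← (hκ.integrable_prod_mul_modeDensity hz hr i).2, ← hκ.integral_re_modeDensity]
  refine norm_integral_le_of_norm_le (hκ.integrable_modeDensity i).re
    (Eventually.of_forall fun y => ?_)
  rw [norm_mul, norm_prod]
  have h1 : ‖modeDensity κ i y‖ = (modeDensity κ i y).re := by
    rw [← hκ.ofReal_re_modeDensity, Complex.norm_real, Complex.ofReal_re, Real.norm_eq_abs,
      abs_of_nonneg (hκ.re_modeDensity_nonneg i y)]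
  rw [h1]
  exact mul_le_of_le_one_left (hκ.re_modeDensity_nonneg i y)
    (Finset.prod_le_one (fun _ _ => norm_nonneg _) fun k _ => hr _)

theorem permTerm_integralMatrix_one_nonneg {n : ℕ} (i : Fin n → ℕ) :
    0 ≤ (permTerm (integralMatrix ν κ fun _ => 1) i).re := by
  rw [← hκ.integral_re_modeDensity]
  exact integral_nonneg (hκ.re_modeDensity_nonneg i)

end IsMatrixDensity

/-! Sums over finite sequences of modes. -/

/-- Dominated convergence: the sums over modes below `N` are sums of `f` restricted to sequences
with all entries below `N`, and each finite sequence is eventually included. -/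
theorem tendsto_tsum_sum_fin {f : (Σ n : ℕ, Fin n → ℕ) → ℂ} (hf : Summable fun x => ‖f x‖) :
    Tendsto (fun N : ℕ => ∑' n, ∑ i : Fin n → Fin N, f ⟨n, fun k => i k⟩) atTop
      (𝓝 (∑' x, f x)) := by
  classical
  have h1 : ∀ N : ℕ, ∑' n, ∑ i : Fin n → Fin N, f ⟨n, fun k => i k⟩ =
      ∑' x, if ∀ k, x.2 k < N then f x else 0 := by
    intro N
    have hs : Summable fun x : Σ n : ℕ, Fin n → ℕ => if ∀ k, x.2 k < N then f x else 0 := by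
      refine hf.of_norm_bounded fun x => ?_
      split_ifs
      · rfl
      · simp
    rw [hs.tsum_sigma]
    refine tsum_congr fun n => ?_
    have hinj : Function.Injective fun (i : Fin n → Fin N) (k : Fin n) => (i k : ℕ) :=
      fun i j hij => funext fun k => Fin.ext (congrFun hij k)
    rw [← hinj.tsum_eq, tsum_fintype]
    · refine Finset.sum_congr rfl fun i _ => ?_
      rw [if_pos fun k => (i k).2]
    · intro i hi
      by_contra hc
      refine hi (if_neg fun h => hc ⟨fun k => ⟨i k, h k⟩, rfl⟩)
  simp_rw [h1]
  refine tendsto_tsum_of_dominated_convergence hf (fun x => ?_)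
    (Eventually.of_forall fun N x => ?_)
  · refine tendsto_const_nhds.congr' ?_
    filter_upwards [eventually_gt_atTop (∑ k, x.2 k)] with N hN
    rw [if_pos fun k => lt_of_le_of_lt (Finset.single_le_sum (f := x.2)
      (fun _ _ => Nat.zero_le _) (Finset.mem_univ k)) hN]
  · split_ifs
    · rfl
    · simp

theorem summable_of_tsum_sum_fin_le {f : (Σ n : ℕ, Fin n → ℕ) → ℝ} (h0 : ∀ x, 0 ≤ f x) {c : ℝ}
    (hs : ∀ N : ℕ, Summable fun n => ∑ i : Fin n → Fin N, f ⟨n, fun k => i k⟩)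
    (hc : ∀ N : ℕ, ∑' n, ∑ i : Fin n → Fin N, f ⟨n, fun k => i k⟩ ≤ c) : Summable f := by
  classical
  refine summable_of_sum_le (c := c) h0 fun u => ?_
  set N := ∑ x ∈ u, ∑ k, x.2 k + 1 with hN
  have hlt : ∀ x ∈ u, ∀ k, x.2 k < N := by
    intro x hx k
    have h1 := Finset.single_le_sum (f := x.2) (fun _ _ => Nat.zero_le _) (Finset.mem_univ k)
    have h2 := Finset.single_le_sum (f := fun x : Σ n : ℕ, Fin n → ℕ => ∑ k, x.2 k)
      (fun _ _ => Nat.zero_le _) hx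
    omega
  let e : (Σ n : ℕ, Fin n → Fin N) → Σ n : ℕ, Fin n → ℕ := fun x => ⟨x.1, fun k => x.2 k⟩
  have he : Function.Injective e := by
    rintro ⟨n, i⟩ ⟨m, j⟩ hij
    obtain rfl : n = m := congrArg Sigma.fst hij
    have h1 := eq_of_heq (Sigma.mk.inj hij).2
    exact congrArg (Sigma.mk n) (funext fun k => Fin.ext (congrFun h1 k))
  have hsum : Summable (f ∘ e) := by
    refine (summable_sigma_of_nonneg fun x => h0 _).2 ⟨fun n => ?_, ?_⟩
    · exact Summable.of_finite
    · simpa only [tsum_fintype] using hs N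
  calc ∑ x ∈ u, f x = ∑ x ∈ u.preimage e he.injOn, f (e x) := by
        symm
        refine Finset.sum_preimage _ _ _ _ fun x hx hx' => absurd ?_ hx'
        exact ⟨⟨x.1, fun k => ⟨x.2 k, hlt x hx k⟩⟩, rfl⟩
    _ ≤ ∑' x, (f ∘ e) x := hsum.sum_le_tsum _ fun x _ => h0 _
    _ = ∑' n, ∑ i : Fin n → Fin N, f ⟨n, fun k => i k⟩ := by
        rw [hsum.tsum_sigma]
        simp only [tsum_fintype]
        rfl
    _ ≤ c := hc N

end Bose

end Beam

namespace Beam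

section BoseExpansion

open Matrix
open scoped ComplexOrder

variable {Y : Type*} [MeasurableSpace Y] {ν : Measure Y} {κ : Y → Matrix ℕ ℕ ℂ}
  [IsFiniteMeasure ν]

/-- The reciprocal of the Fredholm determinant `det (1 - K[z - 1])` has an expansion with positive
coefficients. -/
theorem IsMatrixDensity.exists_bose_expansion (hκ : IsMatrixDensity ν κ)
    (htr : Summable fun i => (integralMatrix ν κ (fun _ => 1) i i).re)
    {V : Type*} [NormedAddCommGroup V] [InnerProductSpace ℂ V] (h : ℕ → V)
    (hh : ∀ i j, ⟪h i, h j⟫_ℂ = (1 + integralMatrix ν κ fun _ => 1) i j) :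
    ∃ κ' : Y → Matrix ℕ ℕ ℂ, IsMatrixDensity ν κ' ∧
      (Summable fun x : Σ n : ℕ, Fin n → ℕ =>
        (permTerm (integralMatrix ν κ' fun _ => 1) x.2).re) ∧
      ∃ Z : ℝ, 0 ≤ Z ∧ ∀ z : Y → ℂ, Measurable z → (∀ y, ‖z y‖ ≤ 1) →
        (∑' S, minor (-integralMatrix ν κ fun y => z y - 1) S) *
          (Z * ∑' x : Σ n : ℕ, Fin n → ℕ, permTerm (integralMatrix ν κ' z) x.2) = 1 := by
  set B := integralMatrix ν κ fun _ => 1 with hBdef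
  have hli : LinearIndependent ℂ h := by
    -- `1 + B = 1 - (-B)` and `-B ≤ 0`, so the gap is at least one.
    refine linearIndependent_of_gram_sub (B := -B) (β := 0) h (fun i j => ?_) one_pos fun N => ?_
    · rw [hh, sub_neg_eq_add]
    · have h1 : ((0 : ℝ) : ℂ) • (1 : Matrix (Fin N) (Fin N) ℂ) - corner (-B) N = corner B N := by
        ext i j
        simp [corner]
      rw [h1]
      exact hκ.posSemidef_integralMatrix_one N
  obtain ⟨a, ha, haN⟩ := exists_triangular_of_gram h hli (1 + B) hh
  have hκ' := hκ.triangularConj ha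
  set κ' : Y → Matrix ℕ ℕ ℂ := fun y => Beam.triangularConj a (κ y) with hκ'def
  set W : ∀ N, Matrix (Fin N) (Fin N) ℂ := triangularCorner a with hW
  have hcB : ∀ N, corner (1 + B) N = 1 + corner B N := by
    intro N
    rw [corner, submatrix_add, Pi.add_apply, Pi.add_apply, submatrix_one _ Fin.val_injective]
    rfl
  have hdet : ∀ N, (1 + corner B N).det * ((W N)ᴴ.det * (W N).det) = 1 := by
    intro N
    have h1 := congrArg Matrix.det (haN N)
    rw [det_mul, det_mul, det_one, hcB] at h1
    rw [← h1]; ring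
  have hconj : ∀ (z : Y → ℂ), Measurable z → (∀ y, ‖z y‖ ≤ 1) → ∀ N,
      1 - corner (integralMatrix ν κ' z) N =
        (W N)ᴴ * (1 - corner (integralMatrix ν κ fun y => z y - 1) N) * W N := by
    intro z hz hz1 N
    have h4 : 1 - corner (integralMatrix ν κ fun y => z y - 1) N =
        corner (1 + B) N - corner (integralMatrix ν κ z) N := by
      rw [hκ.integralMatrix_sub_one hz hz1, hcB, hBdef]
      simp only [corner, submatrix_sub, Pi.sub_apply]
      abel
    rw [h4, Matrix.mul_sub, Matrix.sub_mul, haN N, hκ'def,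
      hκ.integralMatrix_triangularConj a hz hz1, corner_triangularConj ha]
  have hzero : ∀ N, corner (integralMatrix ν κ fun _ => 1 - 1) N = 0 := by
    intro N
    ext i j
    simp [corner, integralMatrix]
  -- At `z = 1` the congruence reads `1 - K'[1] = W* W` with `W` invertible, so the corners of
  -- `K'[1]` have eigenvalues below one and the permanent series converges.
  have hposdef : ∀ N, (1 - corner (integralMatrix ν κ' fun _ => 1) N).PosDef := by
    intro N
    rw [hconj (fun _ => 1) measurable_const (by simp), hzero, sub_zero, Matrix.mul_one]
    refine PosDef.conjTranspose_mul_self _ ?_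
    refine mulVec_injective_of_isUnit ((isUnit_iff_isUnit_det _).2 ?_)
    refine isUnit_iff_ne_zero.2 fun h0 => ?_
    have := hdet N
    rw [h0, mul_zero, mul_zero] at this
    exact zero_ne_one this
  have hdom : ∀ (z : Y → ℂ), Measurable z → (∀ y, ‖z y‖ ≤ 1) → ∀ N,
      Summable fun n => ‖∑ i : Fin n → Fin N, permTerm (corner (integralMatrix ν κ' z) N) i‖ := by
    intro z hz hz1 N
    refine (summable_norm_sum_permTerm (hκ'.posSemidef_integralMatrix_one N)
      (hposdef N)).of_nonneg_of_le (fun n => norm_nonneg _) fun n => ?_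
    refine (norm_sum_le _ _).trans ?_
    calc ∑ i : Fin n → Fin N, ‖permTerm (corner (integralMatrix ν κ' z) N) i‖
        ≤ ∑ i : Fin n → Fin N, (permTerm (corner (integralMatrix ν κ' fun _ => 1) N) i).re :=
          Finset.sum_le_sum fun i _ => hκ'.norm_permTerm_integralMatrix_le hz hz1 fun k => i k
      _ = (∑ i : Fin n → Fin N, permTerm (corner (integralMatrix ν κ' fun _ => 1) N) i).re :=
          (Complex.re_sum _ _).symm
      _ ≤ _ := Complex.re_le_norm _
  -- MacMahon for the corner of `K'[z]`, with the determinants of `W` eliminated by `hdet`.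
  have hfin : ∀ (z : Y → ℂ), Measurable z → (∀ y, ‖z y‖ ≤ 1) → ∀ N,
      (1 - corner (integralMatrix ν κ fun y => z y - 1) N).det *
        ∑' n, ∑ i : Fin n → Fin N, permTerm (integralMatrix ν κ' z) (fun k => (i k : ℕ)) =
          (1 + corner B N).det := by
    intro z hz hz1 N
    have h1 := det_one_sub_mul_tsum (hdom z hz hz1 N)
    rw [hconj z hz hz1, det_mul, det_mul] at h1
    have h2 : ∀ n, ∑ i : Fin n → Fin N, permTerm (integralMatrix ν κ' z) (fun k => (i k : ℕ)) =
        ∑ i : Fin n → Fin N, permTerm (corner (integralMatrix ν κ' z) N) i := fun n => rfl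
    simp_rw [h2]
    set T := ∑' n, ∑ i : Fin n → Fin N, permTerm (corner (integralMatrix ν κ' z) N) i
    linear_combination (1 + corner B N).det * h1 -
      (1 - corner (integralMatrix ν κ fun y => z y - 1) N).det * T * hdet N
  have hre : ∀ N, ∑' n, ∑ i : Fin n → Fin N,
      (permTerm (integralMatrix ν κ' fun _ => 1) (fun k => (i k : ℕ))).re =
        (1 + corner B N).det.re := by
    intro N
    have h1 := hfin (fun _ => 1) measurable_const (by simp) N
    rw [hzero, sub_zero, det_one, one_mul] at h1
    rw [← h1]
    refine Eq.trans (tsum_congr fun n => (Complex.re_sum _ _).symm)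
      (Complex.re_tsum (hdom (fun _ => 1) measurable_const (by simp) N).of_norm).symm
  have hsum : Summable fun x : Σ n : ℕ, Fin n → ℕ =>
      (permTerm (integralMatrix ν κ' fun _ => 1) x.2).re := by
    refine summable_of_tsum_sum_fin_le (fun x => hκ'.permTerm_integralMatrix_one_nonneg x.2)
      (c := Real.exp (∑' i, (B i i).re)) (fun N => ?_) fun N => ?_
    · refine (Complex.hasSum_re
        (hdom (fun _ => 1) measurable_const (by simp) N).of_norm.hasSum).summable.congr fun n => ?_
      exact Complex.re_sum _ _
    · rw [hre N]
      have h1 := det_one_add_smul_le (hκ.posSemidef_integralMatrix_one N) zero_le_one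
      rw [Complex.ofReal_one, one_smul, one_mul] at h1
      refine h1.trans ?_
      gcongr
      exact hκ.trace_corner_re_le htr N
  have hminor := hκ.summable_minor htr (z := fun _ => 1) measurable_const (r := 1) (by simp)
  set c := ∑' S, (minor B S).re with hc
  have hcc : ∑' S, minor B S = (c : ℂ) := by
    rw [hc, Complex.ofReal_tsum]
    exact tsum_congr fun S => (hκ.ofReal_re_minor_one S).symm
  have hcpos : 0 < c := by
    refine lt_of_lt_of_le ?_ ((Complex.hasSum_re hminor.hasSum).summable.le_tsum ∅
      fun S _ => hκ.minor_integralMatrix_one_nonneg S)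
    rw [minor, det_isEmpty]
    norm_num
  refine ⟨κ', hκ', hsum, c⁻¹, inv_nonneg.2 hcpos.le, fun z hz hz1 => ?_⟩
  have hzs : ∀ y, ‖z y - 1‖ ≤ 2 := fun y => by
    refine (norm_sub_le _ _).trans ?_
    rw [norm_one]
    linarith [hz1 y]
  have hneg : Summable (minor (-integralMatrix ν κ fun y => z y - 1)) := by
    refine (hκ.summable_minor htr (hz.sub_const 1) hzs).norm.of_norm_bounded fun S => ?_
    rw [← neg_one_smul ℂ, minor_smul, norm_mul, norm_pow, norm_neg, norm_one, one_pow, one_mul]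
  have hlim1 := tendsto_det_one_add_corner hneg
  have hlim2 := tendsto_tsum_sum_fin
    (f := fun x : Σ n : ℕ, Fin n → ℕ => permTerm (integralMatrix ν κ' z) x.2)
    (hsum.of_nonneg_of_le (fun x => norm_nonneg _)
      fun x => hκ'.norm_permTerm_integralMatrix_le hz hz1 x.2)
  have hlim3 := tendsto_det_one_add_corner hminor
  rw [hcc] at hlim3
  have hprod := hlim1.mul hlim2
  have h5 : ∀ N, 1 + corner (-integralMatrix ν κ fun y => z y - 1) N =
      1 - corner (integralMatrix ν κ fun y => z y - 1) N := fun N => by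
    rw [sub_eq_add_neg]
    rfl
  simp only [h5, hfin z hz hz1] at hprod
  -- In the limit, the determinant times the permanent series is `c = det(1 + B)` for every `z`;
  -- hence `Z = c⁻¹`.
  have := tendsto_nhds_unique hprod hlim3
  have hc0 : (c : ℂ) ≠ 0 := by exact_mod_cast hcpos.ne'
  rw [mul_left_comm, this, Complex.ofReal_inv, inv_mul_cancel₀ hc0]

end BoseExpansion

end Beam

namespace Beam

/-! ### Determinantal and permanental point processes -/

section Determinantal

open scoped ComplexOrder

variable {Y : Type*} [MeasurableSpace Y] {ν : Measure Y} {κ : Y → Matrix ℕ ℕ ℂ}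
  [IsFiniteMeasure ν]

theorem ae_withDensity_pi_mem {Y₀ : Set Y} (hν : ∀ᵐ y ∂ν, y ∈ Y₀) {n : ℕ}
    (g : (Fin n → Y) → ℝ≥0∞) :
    ∀ᵐ y ∂((Measure.pi fun _ => ν).withDensity g), ∀ k, y k ∈ Y₀ := by
  have h : ∀ᵐ y ∂(Measure.pi fun _ : Fin n => ν), ∀ k, y k ∈ Y₀ :=
    ae_all_iff.2 fun k => (Measure.quasiMeasurePreserving_eval (fun _ => ν) k).ae hν
  exact (withDensity_absolutelyContinuous _ _).ae_le h

omit [MeasurableSpace Y] in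
theorem norm_exp_I_mul_le {f : Y → ℝ} (y : Y) : ‖Complex.exp (Complex.I * f y)‖ ≤ 1 :=
  (norm_exp_I_mul _).le

theorem measurable_exp_I_mul {f : Y → ℝ} (hf : Measurable f) :
    Measurable fun y => Complex.exp (Complex.I * f y) :=
  Complex.measurable_exp.comp ((Complex.measurable_ofReal.comp hf).const_mul _)

/-- A family of finite measures with summable masses, weighted to have total mass one, defines a
point process. -/
theorem exists_isPointProcessIn_smul {I : Type*} [Countable I] (n : I → ℕ)
    (μ : ∀ i, Measure (Fin (n i) → Y)) {Y₀ : Set Y} (hY₀ : MeasurableSet Y₀)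
    (hμ : ∀ i, ∀ᵐ y ∂μ i, ∀ k, y k ∈ Y₀) {m : I → ℝ} (hm0 : ∀ i, 0 ≤ m i)
    (hm : ∀ i, μ i Set.univ = ENNReal.ofReal (m i)) (hs : Summable m) {Z : ℝ} (hZ : 0 ≤ Z)
    (hZ1 : Z * ∑' i, m i = 1) :
    ∃ P, IsPointProcessIn Y₀ P ∧ ∀ f : Y → ℝ, Measurable f →
      characteristicFunction P f =
        Z * ∑' i, ∫ y, ∏ k, Complex.exp (Complex.I * f (y k)) ∂μ i := by
  obtain ⟨P, hP, hPf⟩ := exists_isPointProcessIn n (fun i => ENNReal.ofReal Z • μ i) hY₀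
    (fun i => Measure.ae_smul_measure (hμ i) _) (by
      simp only [Measure.smul_apply, hm, smul_eq_mul]
      rw [ENNReal.tsum_mul_left, ← ENNReal.ofReal_tsum_of_nonneg hm0 hs,
        ← ENNReal.ofReal_mul hZ, hZ1, ENNReal.ofReal_one])
  refine ⟨P, hP, fun f hf => ?_⟩
  rw [← (hPf f hf).tsum_eq, ← tsum_mul_left]
  refine tsum_congr fun i => ?_
  rw [integral_smul_measure, ENNReal.toReal_ofReal hZ, Complex.real_smul]

/-- The expansion is used twice: at `z = 1` it shows that the weighted sector measures have total
mass one, at `z = e^{if}` it identifies the characteristic function. -/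
theorem IsMatrixDensity.exists_fermi_process (hκ : IsMatrixDensity ν κ)
    (htr : Summable fun i => (integralMatrix ν κ (fun _ => 1) i i).re) {β : ℝ} (hβ : β < 1)
    (hB : ∀ N, ((β : ℂ) • 1 - corner (integralMatrix ν κ fun _ => 1) N).PosSemidef)
    {V : Type*} [NormedAddCommGroup V] [InnerProductSpace ℂ V] (h : ℕ → V)
    (hh : ∀ i j, ⟪h i, h j⟫_ℂ = (1 - integralMatrix ν κ fun _ => 1) i j)
    {Y₀ : Set Y} (hY₀ : MeasurableSet Y₀) (hν : ∀ᵐ y ∂ν, y ∈ Y₀) :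
    ∃ P, IsPointProcessIn Y₀ P ∧ ∀ f : Y → ℝ, Measurable f →
      characteristicFunction P f =
        ∑' S, minor (integralMatrix ν κ fun y => Complex.exp (Complex.I * f y) - 1) S := by
  obtain ⟨κ', hκ', hs, Z, hZ, hexp⟩ := hκ.exists_fermi_expansion htr hβ hB h hh
  obtain ⟨P, hP, hPf⟩ := exists_isPointProcessIn_smul (fun S : Finset ℕ => S.card)
    (fun S => sectorMeasure ν κ' S) hY₀ (fun S => ae_withDensity_pi_mem hν _)
    hκ'.minor_integralMatrix_one_nonneg hκ'.sectorMeasure_univ hs hZ (by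
      have h1 := hexp (fun _ => 1) measurable_const (by simp)
      have h2 : (integralMatrix ν κ fun _ => (1 : ℂ) - 1) = 0 := by
        ext i j
        simp [integralMatrix]
      rw [h2, tsum_minor_zero] at h1
      have h3 : ∑' S, minor (integralMatrix ν κ' fun _ => 1) S =
          ((∑' S, (minor (integralMatrix ν κ' fun _ => 1) S).re : ℝ) : ℂ) := by
        rw [Complex.ofReal_tsum]
        exact tsum_congr fun S => (hκ'.ofReal_re_minor_one S).symm
      rw [h3] at h1
      exact_mod_cast h1.symm)
  refine ⟨P, hP, fun f hf => ?_⟩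
  rw [hPf f hf, hexp _ (measurable_exp_I_mul hf) norm_exp_I_mul_le]
  congr 1
  exact tsum_congr fun S =>
    hκ'.integral_sectorMeasure (measurable_exp_I_mul hf) norm_exp_I_mul_le S

/-- The Bosonic counterpart, with finite sequences of modes in place of finite sets, since modes may
be multiply occupied. -/
theorem IsMatrixDensity.exists_bose_process (hκ : IsMatrixDensity ν κ)
    (htr : Summable fun i => (integralMatrix ν κ (fun _ => 1) i i).re)
    {V : Type*} [NormedAddCommGroup V] [InnerProductSpace ℂ V] (h : ℕ → V)
    (hh : ∀ i j, ⟪h i, h j⟫_ℂ = (1 + integralMatrix ν κ fun _ => 1) i j)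
    {Y₀ : Set Y} (hY₀ : MeasurableSet Y₀) (hν : ∀ᵐ y ∂ν, y ∈ Y₀) :
    ∃ P, IsPointProcessIn Y₀ P ∧ ∀ f : Y → ℝ, Measurable f →
      characteristicFunction P f =
        (∑' S, minor (-integralMatrix ν κ fun y => Complex.exp (Complex.I * f y) - 1) S)⁻¹ := by
  obtain ⟨κ', hκ', hs, Z, hZ, hexp⟩ := hκ.exists_bose_expansion htr h hh
  obtain ⟨P, hP, hPf⟩ := exists_isPointProcessIn_smul (fun x : Σ n : ℕ, Fin n → ℕ => x.1)
    (fun x => modeMeasure ν κ' x.2) hY₀ (fun x => ae_withDensity_pi_mem hν _)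
    (fun x => hκ'.permTerm_integralMatrix_one_nonneg x.2) (fun x => hκ'.modeMeasure_univ x.2)
    hs hZ (by
      have h1 := hexp (fun _ => 1) measurable_const (by simp)
      have h2 : (integralMatrix ν κ fun _ => (1 : ℂ) - 1) = 0 := by
        ext i j
        simp [integralMatrix]
      rw [h2, neg_zero, tsum_minor_zero, one_mul] at h1
      have h3 : ∑' x : Σ n : ℕ, Fin n → ℕ, permTerm (integralMatrix ν κ' fun _ => 1) x.2 =
          ((∑' x : Σ n : ℕ, Fin n → ℕ,
            (permTerm (integralMatrix ν κ' fun _ => 1) x.2).re : ℝ) : ℂ) := by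
        rw [Complex.ofReal_tsum]
        exact tsum_congr fun x => (hκ'.ofReal_re_permTerm_one x.2).symm
      rw [h3] at h1
      exact_mod_cast h1)
  refine ⟨P, hP, fun f hf => ?_⟩
  rw [hPf f hf, ← eq_inv_of_mul_eq_one_right
    (hexp _ (measurable_exp_I_mul hf) norm_exp_I_mul_le)]
  congr 1
  exact tsum_congr fun x =>
    hκ'.integral_modeMeasure (measurable_exp_I_mul hf) norm_exp_I_mul_le x.2

end Determinantal

end Beam

namespace Beam

/-! ### The density of an observable along a sequence of vectors -/

namespace POVM

variable {Y : Type*} [MeasurableSpace Y] {H : Type*} [NormedAddCommGroup H]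
  [InnerProductSpace ℂ H] [CompleteSpace H] (F : POVM Y H)

theorem diag_smul {c : ℂ} (hc : ‖c‖ = 1) (ψ : H) : F.diag (c • ψ) = F.diag ψ := by
  ext A hA
  rw [F.diag_apply _ hA, F.diag_apply _ hA, map_smul, inner_smul_left, inner_smul_right,
    ← mul_assoc, RCLike.conj_mul, hc]
  simp

/-- Being null for `F.diag ψ` is a linear condition on `ψ`, so common null sets of the `c i` are
null for their whole span. -/
theorem diag_apply_eq_zero_iff (ψ : H) {A : Set Y} (hA : MeasurableSet A) :
    F.diag ψ A = 0 ↔ CFC.sqrt (F.op A) ψ = 0 := by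
  rw [F.diag_apply _ hA, ← inner_sqrt_sqrt (F.isPositive A hA), inner_self_eq_norm_sq_to_K]
  norm_cast
  rw [ENNReal.ofReal_eq_zero]
  constructor
  · intro h
    have : ‖CFC.sqrt (F.op A) ψ‖ ^ 2 = 0 := le_antisymm h (by positivity)
    simpa using this
  · intro h
    simp [h]

theorem op_le_one {A : Set Y} (hA : MeasurableSet A) (ψ : H) :
    (⟪ψ, F.op A ψ⟫_ℂ).re ≤ ‖ψ‖ ^ 2 := by
  have h1 : F.diag ψ A ≤ F.diag ψ Set.univ := measure_mono (Set.subset_univ A)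
  rw [F.diag_apply _ hA, F.diag_apply _ MeasurableSet.univ,
    ENNReal.ofReal_le_ofReal_iff (F.re_nonneg MeasurableSet.univ ψ)] at h1
  refine h1.trans ?_
  have h2 := ((ContinuousLinearMap.le_def _ _).1 F.le_one).re_inner_nonneg_right ψ
  rw [sub_apply, inner_sub_right, map_sub] at h2
  change 0 ≤ RCLike.re ⟪ψ, ψ⟫_ℂ - _ at h2
  rw [inner_self_eq_norm_sq] at h2
  simpa using h2

/-- The sum of the measures `A ↦ ⟨cᵢ, F(A ∩ Y₀) cᵢ⟩`. -/
noncomputable def refMeasure (c : ℕ → H) (Y₀ : Set Y) : Measure Y :=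
  Measure.sum fun i => (F.diag (c i)).restrict Y₀

variable (c : ℕ → H) {Y₀ : Set Y}

theorem ae_mem_refMeasure (hY₀ : MeasurableSet Y₀) : ∀ᵐ y ∂(F.refMeasure c Y₀), y ∈ Y₀ :=
  (Measure.ae_sum_iff' (p := fun y => y ∈ Y₀) hY₀).2 fun _ => ae_restrict_mem hY₀

theorem restrict_diag_absolutelyContinuous (hY₀ : MeasurableSet Y₀) {ψ : H}
    (hψ : ψ ∈ Submodule.span ℂ (Set.range c)) :
    (F.diag ψ).restrict Y₀ ≪ F.refMeasure c Y₀ := by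
  refine Measure.AbsolutelyContinuous.mk fun A hA h0 => ?_
  rw [refMeasure, Measure.sum_apply _ hA, ENNReal.tsum_eq_zero] at h0
  rw [Measure.restrict_apply hA, F.diag_apply_eq_zero_iff _ (hA.inter hY₀)]
  have hle : Submodule.span ℂ (Set.range c) ≤
      LinearMap.ker (CFC.sqrt (F.op (A ∩ Y₀)) : H →L[ℂ] H).toLinearMap := by
    rw [Submodule.span_le]
    rintro _ ⟨i, rfl⟩
    have := h0 i
    rw [Measure.restrict_apply hA, F.diag_apply_eq_zero_iff _ (hA.inter hY₀)] at this
    exact this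
  exact hle hψ

/-- The density of `A ↦ ⟨ψ, F(A ∩ Y₀) ψ⟩`. -/
noncomputable def diagDensity (c : ℕ → H) (Y₀ : Set Y) (ψ : H) (y : Y) : ℝ :=
  (((F.diag ψ).restrict Y₀).rnDeriv (F.refMeasure c Y₀) y).toReal

theorem measurable_diagDensity (ψ : H) : Measurable (F.diagDensity c Y₀ ψ) :=
  (Measure.measurable_rnDeriv _ _).ennreal_toReal

theorem integrable_diagDensity (ψ : H) :
    Integrable (F.diagDensity c Y₀ ψ) (F.refMeasure c Y₀) :=
  Measure.integrable_toReal_rnDeriv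

theorem integral_mul_diagDensity [IsFiniteMeasure (F.refMeasure c Y₀)] (hY₀ : MeasurableSet Y₀)
    {ψ : H} (hψ : ψ ∈ Submodule.span ℂ (Set.range c)) {z : Y → ℂ} (h0 : ∀ y ∉ Y₀, z y = 0) :
    ∫ y, z y * F.diagDensity c Y₀ ψ y ∂(F.refMeasure c Y₀) = ∫ y, z y ∂(F.diag ψ) := by
  rw [← setIntegral_eq_integral_of_forall_compl_eq_zero h0,
    ← integral_rnDeriv_smul (F.restrict_diag_absolutelyContinuous c hY₀ hψ)]
  refine integral_congr_ae (Eventually.of_forall fun y => ?_)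
  simp only [diagDensity, Complex.real_smul, mul_comm]

/-- The matrix valued density of `A ↦ ⟨cᵢ, F(A ∩ Y₀) cⱼ⟩`. -/
noncomputable def polarDensity (c : ℕ → H) (Y₀ : Set Y) (y : Y) : Matrix ℕ ℕ ℂ :=
  Matrix.of fun i j => (F.diagDensity c Y₀ (c j + c i) y - F.diagDensity c Y₀ (c j - c i) y +
    Complex.I * F.diagDensity c Y₀ (c j + Complex.I • c i) y -
    Complex.I * F.diagDensity c Y₀ (c j - Complex.I • c i) y) / 4

/-- Holds at every `y`, not only almost everywhere: the densities depend on a vector only through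
its measure, which a phase does not change, and exchanging `i` and `j` alters the four polarization
vectors only by phases. -/
theorem star_polarDensity (y : Y) (i j : ℕ) :
    star (F.polarDensity c Y₀ y i j) = F.polarDensity c Y₀ y j i := by
  have h : ∀ (a : ℂ) (φ ψ : H), ‖a‖ = 1 → φ = a • ψ →
      F.diagDensity c Y₀ φ y = F.diagDensity c Y₀ ψ y := by
    rintro a _ ψ ha rfl
    rw [diagDensity, F.diag_smul ha, diagDensity]
  have h1 := h 1 (c i + c j) (c j + c i) (by simp) (by rw [one_smul, add_comm])
  have h2 := h (-1) (c i - c j) (c j - c i) (by simp) (by simp)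
  have h3 := h Complex.I (c i + Complex.I • c j) (c j - Complex.I • c i) (by simp)
    (by rw [smul_sub, smul_smul, Complex.I_mul_I]; simp [add_comm])
  have h4 := h (-Complex.I) (c i - Complex.I • c j) (c j + Complex.I • c i) (by simp)
    (by rw [smul_add, smul_smul, neg_mul, Complex.I_mul_I]; simp [add_comm, sub_eq_add_neg])
  simp only [polarDensity, Matrix.of_apply, h1, h2, h3, h4, RCLike.star_def, map_div₀, map_sub,
    map_add, map_mul, Complex.conj_I, Complex.conj_ofReal]
  rw [show (starRingEnd ℂ) 4 = 4 from map_ofNat _ 4]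
  ring

theorem measurable_polarDensity (i j : ℕ) : Measurable fun y => F.polarDensity c Y₀ y i j := by
  have h := fun ψ => Complex.measurable_ofReal.comp (F.measurable_diagDensity c (Y₀ := Y₀) ψ)
  exact ((((h _).sub (h _)).add ((h _).const_mul _)).sub ((h _).const_mul _)).div_const _

theorem integrable_polarDensity (i j : ℕ) :
    Integrable (fun y => F.polarDensity c Y₀ y i j) (F.refMeasure c Y₀) := by
  have h := fun ψ => (F.integrable_diagDensity c (Y₀ := Y₀) ψ).ofReal (𝕜 := ℂ)
  exact ((((h _).sub (h _)).add ((h _).const_mul _)).sub ((h _).const_mul _)).div_const _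

omit [CompleteSpace H] in
theorem mem_span_range (i : ℕ) : c i ∈ Submodule.span ℂ (Set.range c) :=
  Submodule.subset_span ⟨i, rfl⟩

/-- Polarization on both sides; the four vectors lie in the span of `c`, where the measures have
densities with respect to `refMeasure`. -/
theorem integralMatrix_polarDensity [IsFiniteMeasure (F.refMeasure c Y₀)]
    (hY₀ : MeasurableSet Y₀) {z : Y → ℂ} (hz : Measurable z) {r : ℝ} (hr : ∀ y, ‖z y‖ ≤ r)
    (h0 : ∀ y ∉ Y₀, z y = 0) (i j : ℕ) :
    integralMatrix (F.refMeasure c Y₀) (F.polarDensity c Y₀) z i j =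
      ⟪c i, F.expect z (c j)⟫_ℂ := by
  have hi : ∀ ψ, Integrable (fun y => z y * F.diagDensity c Y₀ ψ y) (F.refMeasure c Y₀) := fun ψ =>
    (F.integrable_diagDensity c ψ).ofReal.bdd_mul hz.aestronglyMeasurable
      (Eventually.of_forall hr)
  have hm := mem_span_range c
  have h := fun (ψ : H) hψ => F.integral_mul_diagDensity c hY₀ (ψ := ψ) hψ h0
  rw [F.inner_expect_polarization hz ⟨r, hr⟩,
    ← h _ (Submodule.add_mem _ (hm j) (hm i)), ← h _ (Submodule.sub_mem _ (hm j) (hm i)),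
    ← h _ (Submodule.add_mem _ (hm j) (Submodule.smul_mem _ Complex.I (hm i))),
    ← h _ (Submodule.sub_mem _ (hm j) (Submodule.smul_mem _ Complex.I (hm i)))]
  have e : ∀ y, z y * F.polarDensity c Y₀ y i j =
      (z y * F.diagDensity c Y₀ (c j + c i) y - z y * F.diagDensity c Y₀ (c j - c i) y +
        Complex.I * (z y * F.diagDensity c Y₀ (c j + Complex.I • c i) y) -
        Complex.I * (z y * F.diagDensity c Y₀ (c j - Complex.I • c i) y)) / 4 := by
    intro y
    rw [polarDensity, Matrix.of_apply]
    ring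
  rw [integralMatrix, Matrix.of_apply, integral_congr_ae (Eventually.of_forall e), integral_div,
    integral_sub, integral_add, integral_sub, integral_const_mul, integral_const_mul]
  · exact hi _
  · exact hi _
  · exact (hi _).sub (hi _)
  · exact (hi _).const_mul _
  · exact ((hi _).sub (hi _)).add ((hi _).const_mul _)
  · exact (hi _).const_mul _

open Matrix in
open scoped ComplexOrder in
theorem ae_dotProduct_polarDensity_nonneg [IsFiniteMeasure (F.refMeasure c Y₀)]
    (hY₀ : MeasurableSet Y₀) (N : ℕ) (x : Fin N → ℂ) :
    ∀ᵐ y ∂(F.refMeasure c Y₀), 0 ≤ star x ⬝ᵥ (corner (F.polarDensity c Y₀ y) N *ᵥ x) := by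
  set ψ := ∑ i, x i • c i with hψ
  have hmem : ψ ∈ Submodule.span ℂ (Set.range c) :=
    Submodule.sum_mem _ fun i _ => Submodule.smul_mem _ _ (mem_span_range c i)
  have hexp : ∀ y, star x ⬝ᵥ (corner (F.polarDensity c Y₀ y) N *ᵥ x) =
      ∑ i, ∑ j, star (x i) * x j * F.polarDensity c Y₀ y i j := by
    intro y
    simp only [dotProduct, mulVec, corner, submatrix_apply, Finset.mul_sum, Pi.star_apply]
    exact Finset.sum_congr rfl fun i _ => Finset.sum_congr rfl fun j _ => by ring
  have hi : ∀ i j : Fin N, Integrable (fun y => star (x i) * x j * F.polarDensity c Y₀ y i j)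
      (F.refMeasure c Y₀) := fun i j => (F.integrable_polarDensity c i j).const_mul _
  -- Both functions integrate over each measurable `A` to `⟨ψ, F(A ∩ Y₀) ψ⟩`, so the form agrees
  -- almost everywhere with a nonnegative Radon–Nikodym derivative.
  have hae : (fun y => star x ⬝ᵥ (corner (F.polarDensity c Y₀ y) N *ᵥ x)) =ᵐ[F.refMeasure c Y₀]
      fun y => (F.diagDensity c Y₀ ψ y : ℂ) := by
    simp_rw [hexp]
    refine Integrable.ae_eq_of_forall_setIntegral_eq _ _
      (integrable_finsetSum _ fun i _ => integrable_finsetSum _ fun j _ => hi i j)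
      (F.integrable_diagDensity c ψ).ofReal fun A hA _ => ?_
    have hν0 := F.ae_mem_refMeasure c hY₀
    set z : Y → ℂ := (A ∩ Y₀).indicator fun _ => 1 with hz
    have hzm : Measurable z := measurable_const.indicator (hA.inter hY₀)
    have hzr : ∀ y, ‖z y‖ ≤ 1 := fun y => by by_cases h : y ∈ A ∩ Y₀ <;> simp [hz, h]
    have hz0 : ∀ y ∉ Y₀, z y = 0 := fun y hy => by simp [hz, hy]
    have hset : ∀ g : Y → ℂ, ∫ y in A, g y ∂(F.refMeasure c Y₀) =
        ∫ y, z y * g y ∂(F.refMeasure c Y₀) := by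
      intro g
      rw [← integral_indicator hA]
      refine integral_congr_ae ?_
      filter_upwards [hν0] with y hy
      by_cases h : y ∈ A <;> simp [hz, h, hy]
    rw [hset, hset, F.integral_mul_diagDensity c hY₀ hmem hz0,
      ← F.inner_expect hzm ⟨1, hzr⟩, hψ]
    simp only [Finset.mul_sum, map_sum, map_smul, sum_inner, inner_sum, inner_smul_left,
      inner_smul_right]
    have hi' : ∀ i j : Fin N, Integrable
        (fun y => z y * (star (x i) * x j * F.polarDensity c Y₀ y i j)) (F.refMeasure c Y₀) :=
      fun i j => (hi i j).bdd_mul hzm.aestronglyMeasurable (Eventually.of_forall hzr)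
    rw [integral_finsetSum _ fun i _ => integrable_finsetSum _ fun j _ => hi' i j,
      Finset.sum_comm (γ := Fin N)]
    refine Finset.sum_congr rfl fun i _ => ?_
    rw [integral_finsetSum _ fun j _ => hi' i j]
    refine Finset.sum_congr rfl fun j _ => ?_
    rw [← F.integralMatrix_polarDensity c hY₀ hzm hzr hz0, integralMatrix, of_apply,
      ← integral_const_mul, ← integral_const_mul]
    congr 1
    ext y
    simp only [RCLike.star_def]
    ring
  filter_upwards [hae] with y hy
  rw [hy]
  exact_mod_cast ENNReal.toReal_nonneg

open Matrix in
open scoped ComplexOrder in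
theorem ae_posSemidef_polarDensity [IsFiniteMeasure (F.refMeasure c Y₀)]
    (hY₀ : MeasurableSet Y₀) :
    ∀ᵐ y ∂(F.refMeasure c Y₀), ∀ N, (corner (F.polarDensity c Y₀ y) N).PosSemidef := by
  -- The null set depends on `x`; testing on a dense sequence leaves one null set, and continuity in
  -- `x` does the rest.
  have h1 : ∀ᵐ y ∂(F.refMeasure c Y₀), ∀ N k : ℕ,
      0 ≤ star (TopologicalSpace.denseSeq (Fin N → ℂ) k) ⬝ᵥ
        (corner (F.polarDensity c Y₀ y) N *ᵥ TopologicalSpace.denseSeq (Fin N → ℂ) k) :=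
    ae_all_iff.2 fun N => ae_all_iff.2 fun k => F.ae_dotProduct_polarDensity_nonneg c hY₀ N _
  filter_upwards [h1] with y hy N
  refine PosSemidef.of_dotProduct_mulVec_nonneg ?_ fun x => ?_
  · ext i j
    exact F.star_polarDensity c y j i
  · have hcl : IsClosed {x : Fin N → ℂ | 0 ≤ star x ⬝ᵥ
        (corner (F.polarDensity c Y₀ y) N *ᵥ x)} := by
      refine isClosed_Ici.preimage (f := fun x : Fin N → ℂ => star x ⬝ᵥ
        (corner (F.polarDensity c Y₀ y) N *ᵥ x)) ?_
      simp only [dotProduct, mulVec, Pi.star_apply]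
      fun_prop
    exact (TopologicalSpace.denseRange_denseSeq (Fin N → ℂ)).induction_on x hcl fun k => hy N k

open scoped ComplexOrder in
/-- The matrix elements of an observable along a sequence of vectors have a positive semidefinite
density. -/
theorem exists_isMatrixDensity (hY₀ : MeasurableSet Y₀) (htr : ∑' i, F.diag (c i) Y₀ ≠ ∞) :
    ∃ (ν : Measure Y) (κ : Y → Matrix ℕ ℕ ℂ), IsFiniteMeasure ν ∧ (∀ᵐ y ∂ν, y ∈ Y₀) ∧
      IsMatrixDensity ν κ ∧ ∀ z : Y → ℂ, Measurable z → (∃ r : ℝ, ∀ y, ‖z y‖ ≤ r) →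
        (∀ y ∉ Y₀, z y = 0) → ∀ i j, integralMatrix ν κ z i j = ⟪c i, F.expect z (c j)⟫_ℂ := by
  have hfin : IsFiniteMeasure (F.refMeasure c Y₀) := by
    constructor
    rw [refMeasure, Measure.sum_apply _ MeasurableSet.univ]
    simpa using htr.lt_top
  have hν0 := F.ae_mem_refMeasure c hY₀
  classical
  have hae := F.ae_posSemidef_polarDensity c hY₀
  set bad := {y | ¬ ∀ N, (corner (F.polarDensity c Y₀ y) N).PosSemidef} with hbad
  -- The density is set to zero on a measurable null set, which makes positivity hold at every
  -- point.
  set G := toMeasurable (F.refMeasure c Y₀) bad with hG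
  have hGm : MeasurableSet G := measurableSet_toMeasurable _ _
  have hG0 : ∀ᵐ y ∂(F.refMeasure c Y₀), y ∉ G := by
    rw [ae_iff]
    simp only [not_not]
    change F.refMeasure c Y₀ G = 0
    rw [hG, measure_toMeasurable]
    exact ae_iff.1 hae
  have hne : ∀ i j, (fun y => (if y ∈ G then 0 else F.polarDensity c Y₀ y) i j) =
      fun y => if y ∈ G then 0 else F.polarDensity c Y₀ y i j := by
    intro i j
    ext y
    split_ifs <;> rfl
  have haee : ∀ i j, (fun y => (if y ∈ G then 0 else F.polarDensity c Y₀ y) i j)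
      =ᵐ[F.refMeasure c Y₀] fun y => F.polarDensity c Y₀ y i j := by
    intro i j
    filter_upwards [hG0] with y hy
    rw [if_neg hy]
  refine ⟨F.refMeasure c Y₀, fun y => if y ∈ G then 0 else F.polarDensity c Y₀ y, hfin, hν0,
    ⟨fun i j => ?_, fun i j => ?_, fun y N => ?_⟩, fun z hz ⟨r, hr⟩ h0 i j => ?_⟩
  · rw [hne]
    exact Measurable.ite hGm measurable_const (F.measurable_polarDensity c i j)
  · exact (F.integrable_polarDensity c i j).congr (haee i j).symm
  · by_cases hy : y ∈ G
    · rw [if_pos hy]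
      exact Matrix.PosSemidef.zero
    · rw [if_neg hy]
      by_contra hc
      exact hy (subset_toMeasurable _ _ fun h => hc (h N))
  · rw [← F.integralMatrix_polarDensity c hY₀ hz hr h0]
    refine integral_congr_ae ?_
    filter_upwards [haee i j] with y hy
    rw [hy]

end POVM

/-! ### Gram representations of operator matrices -/

section Gram

variable {H : Type*} [NormedAddCommGroup H] [InnerProductSpace ℂ H] [CompleteSpace H]
  [TopologicalSpace.SeparableSpace H]

/-- The vectors `√(β - W) eᵢ` have the right Gram matrix except at padded indices, where `eᵢ = 0`
but the diagonal entry must be `β`; mutually orthogonal vectors of length `√β` in the summand `ℓ²`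
supply it. -/
theorem exists_gram (W : H →L[ℂ] H) {β : ℝ} (hβ : 0 ≤ β)
    (hW : ((β : ℂ) • (1 : H →L[ℂ] H) - W).IsPositive) :
    ∃ h : ℕ → WithLp 2 (H × lp (fun _ : ℕ => ℂ) 2), ∀ i j,
      ⟪h i, h j⟫_ℂ = ((β : ℂ) • (1 : Matrix ℕ ℕ ℂ) -
        Matrix.of fun i j => ⟪basisSeq H i, W (basisSeq H j)⟫_ℂ) i j := by
  classical
  refine ⟨fun i => WithLp.toLp 2 (CFC.sqrt ((β : ℂ) • (1 : H →L[ℂ] H) - W) (basisSeq H i),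
    if basisSeq H i = 0 then lp.single 2 i (Real.sqrt β : ℂ) else 0), fun i j => ?_⟩
  rw [WithLp.prod_inner_apply]
  simp only
  rw [inner_sqrt_sqrt hW, sub_apply, inner_sub_right, smul_apply, one_apply_eq_self, inner_smul_right,
    Matrix.sub_apply, Matrix.smul_apply, Matrix.of_apply, smul_eq_mul, Matrix.one_apply]
  by_cases hij : i = j
  · subst hij
    rw [if_pos rfl]
    rcases inner_basisSeq_self (H := H) i with ⟨h1, h2⟩ | h1
    · rw [if_pos h2, h1, lp.inner_single_left, lp.single_apply_self]
      have : (Real.sqrt β : ℂ) * (Real.sqrt β : ℂ) = β := by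
        rw [← Complex.ofReal_mul, Real.mul_self_sqrt hβ]
      simp only [RCLike.inner_apply, Complex.conj_ofReal, this]
      ring
    · have h2 : basisSeq H i ≠ 0 := by
        intro h0
        rw [h0, inner_zero_left] at h1
        exact zero_ne_one h1
      rw [if_neg h2, h1, inner_zero_left]
      ring
  · rw [if_neg hij, inner_basisSeq_of_ne hij]
    have : ⟪(if basisSeq H i = 0 then lp.single 2 i (Real.sqrt β : ℂ) else 0 :
        lp (fun _ : ℕ => ℂ) 2), if basisSeq H j = 0 then lp.single 2 j (Real.sqrt β : ℂ) else 0⟫_ℂ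
          = 0 := by
      split_ifs
      · rw [lp.inner_single_left, lp.single_apply_ne _ _ _ hij, inner_zero_right]
      all_goals simp
    rw [this]
    ring

end Gram

end Beam

namespace Beam

/-! ### The local counting statistics -/

theorem isPositive_smul_one_sub {H : Type*} [NormedAddCommGroup H] [InnerProductSpace ℂ H]
    [CompleteSpace H] {W : H →L[ℂ] H} (hW : W.IsPositive) {β : ℝ}
    (h : ∀ ψ, (⟪ψ, W ψ⟫_ℂ).re ≤ β * ‖ψ‖ ^ 2) :
    ((β : ℂ) • (1 : H →L[ℂ] H) - W).IsPositive := by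
  rw [ContinuousLinearMap.isPositive_iff_complex]
  intro ψ
  have h1 : ⟪((β : ℂ) • (1 : H →L[ℂ] H) - W) ψ, ψ⟫_ℂ =
      ((β * ‖ψ‖ ^ 2 - (⟪ψ, W ψ⟫_ℂ).re : ℝ) : ℂ) := by
    have h2 : ⟪W ψ, ψ⟫_ℂ = ((⟪ψ, W ψ⟫_ℂ).re : ℂ) := by
      have h3 : ⟪W ψ, ψ⟫_ℂ = ⟪ψ, W ψ⟫_ℂ := hW.isSymmetric ψ ψ
      rw [h3]
      exact Complex.eq_re_of_ofReal_le (r := 0) (by simpa using hW.inner_nonneg_right ψ)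
    rw [sub_apply, inner_sub_left, smul_apply, one_apply_eq_self, inner_smul_left,
      inner_self_eq_norm_sq_to_K, Complex.conj_ofReal, h2]
    push_cast
    rfl
  rw [h1, RCLike.re_eq_complex_re, Complex.ofReal_re]
  exact ⟨rfl, sub_nonneg.2 (h ψ)⟩

namespace StationaryBeam

variable {H : Type*} [NormedAddCommGroup H] [InnerProductSpace ℂ H] [CompleteSpace H]
  {HE : ℝ → Type*} [∀ E, NormedAddCommGroup (HE E)] [∀ E, InnerProductSpace ℂ (HE E)]
  {D : DirectIntegral H HE} (σ : StationaryBeam D)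
  {X : Type*} [MeasurableSpace X] {F : POVM (ℝ × X) H}

theorem inner_sandwich (F : POVM (ℝ × X) H) (z : ℝ × X → ℂ) (φ ψ : H) :
    ⟪φ, σ.sandwich F z ψ⟫_ℂ = ⟪CFC.sqrt σ.op φ, F.expect z (CFC.sqrt σ.op ψ)⟫_ℂ := by
  rw [sandwich, ContinuousLinearMap.comp_apply, ContinuousLinearMap.comp_apply,
    ← ContinuousLinearMap.adjoint_inner_left, sqrt_adjoint]

theorem inner_window (F : POVM (ℝ × X) H) (t₁ t₂ : ℝ) (φ ψ : H) :
    ⟪φ, σ.window F t₁ t₂ ψ⟫_ℂ =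
      ⟪CFC.sqrt σ.op φ, F.op (Set.Icc t₁ t₂ ×ˢ Set.univ) (CFC.sqrt σ.op ψ)⟫_ℂ := by
  rw [window, ContinuousLinearMap.comp_apply, ContinuousLinearMap.comp_apply,
    ← ContinuousLinearMap.adjoint_inner_left, sqrt_adjoint]

theorem inner_window_le (F : POVM (ℝ × X) H) (t₁ t₂ : ℝ) (ψ : H) :
    (⟪ψ, σ.window F t₁ t₂ ψ⟫_ℂ).re ≤ ‖σ.op‖ * ‖ψ‖ ^ 2 := by
  rw [σ.inner_window]
  refine (F.op_le_one (measurableSet_timeWindow t₁ t₂) _).trans ?_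
  have h3 := inner_sqrt_sqrt σ.isPositive_op ψ ψ
  rw [inner_self_eq_norm_sq_to_K] at h3
  have h4 := norm_inner_le_norm (𝕜 := ℂ) ψ (σ.op ψ)
  rw [← h3] at h4
  have h5 := σ.op.le_opNorm ψ
  have h6 : ‖CFC.sqrt σ.op ψ‖ ^ 2 ≤ ‖ψ‖ * ‖σ.op ψ‖ := by simpa using h4
  calc _ ≤ ‖ψ‖ * ‖σ.op ψ‖ := h6
    _ ≤ ‖ψ‖ * (‖σ.op‖ * ‖ψ‖) := by gcongr
    _ = _ := by ring

theorem isPositive_smul_one_sub_window (F : POVM (ℝ × X) H) (t₁ t₂ : ℝ) {β : ℝ}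
    (hβ : ‖σ.op‖ ≤ β) : ((β : ℂ) • (1 : H →L[ℂ] H) - σ.window F t₁ t₂).IsPositive :=
  isPositive_smul_one_sub (σ.isPositive_window F t₁ t₂) fun ψ =>
    (σ.inner_window_le F t₁ t₂ ψ).trans (by gcongr)

variable [∀ E, CompleteSpace (HE E)] [TopologicalSpace.SeparableSpace H]

/-- Bridge from operators to matrices: for the vectors `√σ̂ eᵢ` the reference measure has the trace
of the window as its mass, so the trace bound makes it finite and `B` of finite trace. -/
theorem exists_density (hγ : σ.rate < ∞) (hF : D.IsTimeCovariant F) (t₁ t₂ : ℝ) :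
    ∃ (ν : Measure (ℝ × X)) (κ : ℝ × X → Matrix ℕ ℕ ℂ), IsFiniteMeasure ν ∧
      (∀ᵐ y ∂ν, y ∈ Set.Icc t₁ t₂ ×ˢ (Set.univ : Set X)) ∧ IsMatrixDensity ν κ ∧
      (Summable fun i => (integralMatrix ν κ (fun _ => 1) i i).re) ∧
      (integralMatrix ν κ fun _ => 1) =
        Matrix.of (fun i j => ⟪basisSeq H i, σ.window F t₁ t₂ (basisSeq H j)⟫_ℂ) ∧
      ∀ f : ℝ × X → ℝ, Measurable f → (∀ y : ℝ × X, y.1 ∉ Set.Icc t₁ t₂ → f y = 0) →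
        (integralMatrix ν κ fun y => Complex.exp (Complex.I * f y) - 1) =
          Matrix.of fun i j => ⟪basisSeq H i, σ.sandwich F
            (fun y => Complex.exp (Complex.I * f y) - 1) (basisSeq H j)⟫_ℂ := by
  have hY₀ : MeasurableSet (Set.Icc t₁ t₂ ×ˢ (Set.univ : Set X)) := measurableSet_timeWindow t₁ t₂
  have htr : ∑' i, F.diag (CFC.sqrt σ.op (basisSeq H i)) (Set.Icc t₁ t₂ ×ˢ Set.univ) =
      posTrace (σ.window F t₁ t₂) := by
    rw [posTrace, ← tsum_basisSeq
      (fun x => ENNReal.ofReal (⟪x, σ.window F t₁ t₂ x⟫_ℂ).re) (by simp)]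
    refine tsum_congr fun i => ?_
    rw [F.diag_apply _ hY₀, σ.inner_window]
  have hfin : ∑' i, F.diag (CFC.sqrt σ.op (basisSeq H i)) (Set.Icc t₁ t₂ ×ˢ Set.univ) ≠ ∞ := by
    rw [htr]
    exact ((σ.posTrace_window_le hγ hF t₁ t₂).trans_lt
      (ENNReal.mul_lt_top hγ ENNReal.ofReal_lt_top)).ne
  obtain ⟨ν, κ, hν, hν0, hκ, hmat⟩ :=
    F.exists_isMatrixDensity (fun i => CFC.sqrt σ.op (basisSeq H i)) hY₀ hfin
  have hB : (integralMatrix ν κ fun _ => 1) =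
      Matrix.of (fun i j => ⟪basisSeq H i, σ.window F t₁ t₂ (basisSeq H j)⟫_ℂ) := by
    ext i j
    have h1 := hmat ((Set.Icc t₁ t₂ ×ˢ Set.univ).indicator fun _ => 1)
      (measurable_const.indicator hY₀) ⟨1, fun y => by
        by_cases h : y ∈ Set.Icc t₁ t₂ ×ˢ (Set.univ : Set X) <;> simp [h]⟩
      (fun y hy => Set.indicator_of_notMem hy _) i j
    rw [F.expect_indicator hY₀] at h1
    rw [Matrix.of_apply, σ.inner_window, ← h1]
    refine integral_congr_ae ?_
    filter_upwards [hν0] with y hy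
    rw [Set.indicator_of_mem hy]
  refine ⟨ν, κ, hν, hν0, hκ, ?_, hB, fun f hf h0 => ?_⟩
  · refine (ENNReal.summable_toReal hfin).congr fun i => ?_
    rw [hB, Matrix.of_apply, σ.inner_window, F.diag_apply _ hY₀,
      ENNReal.toReal_ofReal (F.re_nonneg hY₀ _)]
  · ext i j
    rw [Matrix.of_apply, σ.inner_sandwich]
    refine hmat _ ((measurable_exp_I_mul hf).sub_const 1) ⟨2, fun y => ?_⟩ (fun y hy => ?_) i j
    · refine (norm_sub_le _ _).trans ?_
      rw [norm_exp_I_mul, norm_one]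
      norm_num
    · rw [h0 y fun h => hy ⟨h, Set.mem_univ _⟩]
      simp

theorem exists_fermi_counting_law (hγ : σ.rate < ∞) (hF : D.IsTimeCovariant F) (hσ : ‖σ.op‖ < 1)
    (t₁ t₂ : ℝ) :
    ∃ P, IsPointProcessIn (Set.Icc t₁ t₂ ×ˢ (Set.univ : Set X)) P ∧
      ∀ f : ℝ × X → ℝ, Measurable f → (∀ y : ℝ × X, y.1 ∉ Set.Icc t₁ t₂ → f y = 0) →
        characteristicFunction P f = σ.countingFunction F (-1) f := by
  obtain ⟨ν, κ, hν, hν0, hκ, htr, hB, hf⟩ := σ.exists_density hγ hF t₁ t₂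
  -- Two Gram representations: `β = 1` realises `1 - B` for the triangular congruence, while `β =
  -- ‖σ̂‖ < 1` below yields the spectral gap.
  obtain ⟨h, hh⟩ := exists_gram (σ.window F t₁ t₂) (β := 1) zero_le_one
    (σ.isPositive_smul_one_sub_window F t₁ t₂ hσ.le)
  obtain ⟨h', hh'⟩ := exists_gram (σ.window F t₁ t₂) (norm_nonneg _)
    (σ.isPositive_smul_one_sub_window F t₁ t₂ le_rfl)
  rw [← hB] at hh hh'
  obtain ⟨P, hP, hPf⟩ := hκ.exists_fermi_process htr hσ (fun N => by
      have h1 := Matrix.posSemidef_gram ℂ fun i : Fin N => h' i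
      have h2 : Matrix.gram ℂ (fun i : Fin N => h' i) =
          (‖σ.op‖ : ℂ) • 1 - corner (integralMatrix ν κ fun _ => 1) N := by
        ext i j
        rw [Matrix.gram_apply, hh']
        simp [corner, Matrix.one_apply, Fin.ext_iff]
      rwa [h2] at h1) h (by simpa using hh)
    (measurableSet_timeWindow t₁ t₂) hν0
  refine ⟨P, hP, fun f hfm h0 => ?_⟩
  rw [hPf f hfm, hf f hfm h0, countingFunction, ← detOneAdd_eq_tsum_minor]
  simp

theorem exists_bose_counting_law (hγ : σ.rate < ∞) (hF : D.IsTimeCovariant F) (t₁ t₂ : ℝ) :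
    ∃ P, IsPointProcessIn (Set.Icc t₁ t₂ ×ˢ (Set.univ : Set X)) P ∧
      ∀ f : ℝ × X → ℝ, Measurable f → (∀ y : ℝ × X, y.1 ∉ Set.Icc t₁ t₂ → f y = 0) →
        characteristicFunction P f = σ.countingFunction F 1 f := by
  obtain ⟨ν, κ, hν, hν0, hκ, htr, hB, hf⟩ := σ.exists_density hγ hF t₁ t₂
  -- The sign turns the Gram matrix `1 - (-B)` into `1 + B`.
  obtain ⟨h, hh⟩ := exists_gram (-σ.window F t₁ t₂) (β := 1) zero_le_one (by
    rw [sub_neg_eq_add, Complex.ofReal_one, one_smul]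
    exact ContinuousLinearMap.isPositive_one.add (σ.isPositive_window F t₁ t₂))
  obtain ⟨P, hP, hPf⟩ := hκ.exists_bose_process htr h (fun i j => by
      rw [hh, hB]
      simp) (measurableSet_timeWindow t₁ t₂) hν0
  refine ⟨P, hP, fun f hfm h0 => ?_⟩
  rw [hPf f hfm, hf f hfm h0, countingFunction, detOneAdd_eq_tsum_minor]
  have : -(Matrix.of fun i j => ⟪basisSeq H i, σ.sandwich F
      (fun y => Complex.exp (Complex.I * f y) - 1) (basisSeq H j)⟫_ℂ) =
      Matrix.of fun i j => ⟪basisSeq H i, (-((1 : ℤ) : ℂ) • σ.sandwich F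
        (fun y => Complex.exp (Complex.I * f y) - 1)) (basisSeq H j)⟫_ℂ := by
    ext i j
    simp
  rw [this]
  simp

end StationaryBeam

end Beam

theorem mainTheorem2
    {H : Type*} [NormedAddCommGroup H] [InnerProductSpace ℂ H] [CompleteSpace H]
    [TopologicalSpace.SeparableSpace H]
    {HE : ℝ → Type*} [∀ E, NormedAddCommGroup (HE E)] [∀ E, InnerProductSpace ℂ (HE E)]
    [∀ E, CompleteSpace (HE E)] [∀ E, TopologicalSpace.SeparableSpace (HE E)]
    (D : Beam.DirectIntegral H HE)
    (σ : Beam.StationaryBeam D) (hγ : σ.rate < ∞)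
    {X : Type*} [MeasurableSpace X]
    (F : Beam.POVM (ℝ × X) H) (hF : D.IsTimeCovariant F)
    (t₁ t₂ : ℝ) :
    (∀ f : ℝ × X → ℂ, Measurable f → (∃ C : ℝ, ∀ y, ‖f y‖ ≤ C) →
      (∀ y : ℝ × X, y.1 ∉ Set.Icc t₁ t₂ → f y = 0) →
      Beam.traceNorm (σ.sandwich F f) ≤
        (⨆ y, ‖f y‖ₑ) * σ.rate * ENNReal.ofReal |t₂ - t₁|) ∧
    (∀ s : ℤ, (s = 1 ∨ (s = -1 ∧ ‖σ.op‖ < 1)) →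
      ∃! P : Measure (Measure (ℝ × X)),
        Beam.IsPointProcessIn (Set.Icc t₁ t₂ ×ˢ Set.univ) P ∧
        ∀ f : ℝ × X → ℝ, Measurable f → (∀ y : ℝ × X, y.1 ∉ Set.Icc t₁ t₂ → f y = 0) →
          Beam.characteristicFunction P f = σ.countingFunction F s f) := by
  refine ⟨fun f hf hb h0 => σ.traceNorm_sandwich_le hγ hF hf hb h0, fun s hs => ?_⟩
  obtain ⟨P, hP, hPf⟩ : ∃ P, Beam.IsPointProcessIn (Set.Icc t₁ t₂ ×ˢ (Set.univ : Set X)) P ∧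
      ∀ f : ℝ × X → ℝ, Measurable f → (∀ y : ℝ × X, y.1 ∉ Set.Icc t₁ t₂ → f y = 0) →
        Beam.characteristicFunction P f = σ.countingFunction F s f := by
    rcases hs with rfl | ⟨rfl, hσ⟩
    · exact σ.exists_bose_counting_law hγ hF t₁ t₂
    · exact σ.exists_fermi_counting_law hγ hF hσ t₁ t₂
  refine ⟨P, ⟨hP, hPf⟩, fun P' ⟨hP', hPf'⟩ => ?_⟩
  -- Any competitor has the same characteristic function on test functions supported in the window,
  -- which determines it.
  refine hP'.ext (Beam.measurableSet_timeWindow t₁ t₂) hP fun f hf h0 => ?_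
  have h1 : ∀ y : ℝ × X, y.1 ∉ Set.Icc t₁ t₂ → f y = 0 := fun y hy => h0 y fun h => hy h.1
  rw [hPf f hf h1, hPf' f hf h1]
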